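/- **Setting.** An event record of a detector with a fixed number $L\ge 3$ of layers contains, for each layer $l<L$ and each label $j<n$, a hit $\mathbf m_{l,j}\in\mathbb R^3$ or a flag that nothing was detected. The parameters of the track finder (seeding criterion, seed fit, linear Kalman model of each layer, threshold $\chi_0^2$, weight $\omega>0$, number $\lambda\ge 1$ of retained tracks, allowed fraction $f$ of shared hits, refit score and its threshold) are fixed. Fixed-size computations on hits and state vectors take $O(1)$ time, a QRAM access takes $O(\log n)$ gates, quantum time is the number of gates, and $\tilde O$ hides factors polylogarithmic in $n$. Let $k_{\rm seed}\le n^3$ be the number of good seeds, i.e. of triplets of hits in layers $0,1,2$ that satisfy the seeding criterion. The *classical improved CTF* consists of: (1) seed generation, testing all triplets; (2) track finding: each seed is followed through the layers $l=3,\dots,L-1$; at each layer every current candidate is extended by each hit whose predicted $\chi^2$ is below $\chi_0^2$ (by a ghost hit if there is none), and the $\lambda$ candidates of best quality $q_l=l-m_{\rm ghost}-\omega\chi^2_{\le l}$ are kept; (3) improved cleaning: candidates are sorted by quality, and with balanced search trees of $r$-tuples of hits a candidate is discarded if it shares too many hits with an accepted one; (4) selection: each track is refitted and kept if its new score is not below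 the threshold. Ties in $\chi^2$ or quality are broken by a fixed rule (for $\chi^2$, by label). *Quantum seed generation* estimates $k_{\rm seed}$ by quantum counting as $\tilde k$ and then runs Grover's search with $\lfloor \pi/(4\theta)\rfloor$ iterations, where $\sin^2\theta=\tilde k/N$ and $N$ is the size of the (power of two) search space of triplets, until $\tilde k$ different good seeds have been found. *Quantum track finding* is (2), except that at each layer each candidate is extended only by the up to $\lambda$ hits of smallest predicted $\chi^2$ below $\chi_0^2$, found one after the other, each as the best result of $\lceil\log_2(3L\lambda^2n^3)\rceil$ runs of Dürr–Høyer quantum minimum finding, a run being stopped after $22.5\sqrt{n}$ oracle calls ($n$ rounded up to a power of two). **Theorem.** For all sufficiently large $n$ and every event record: (a) The improved CTF with quantum seed generation and quantum track finding, followed by (3) and (4), halts and returns exactly the output of the classical improved CTF, with probability at least $1/2$, within time $$\tilde O\!\left(\sqrt{n^3\max(k_{\rm seed},1)}+\sqrt n\,k_{\rm seed}\right),$$ and hence within $\tilde O(n^{3.5})$. (b) With classical seed generation (1), then quantum track finding, (3) and (4), the same holds within time $\tilde O(n^3+\sqrt n\,k_{\rm seed})$, and hence within $\tilde O(n^{3.5})$.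 (c) The classical improved CTF takes time $O(n^3+n\,k_{\rm seed})$, hence $O(n^4)$. If $L\ge 4$, it takes time $\Omega(n^3+n\,k_{\rm seed})$ on every event record, so that the time bound in (a) is at most $\tilde O(n^{-1/2})$ times the running time of the classical version on the same record. The implied constants and exponents depend only on the parameters of the detector, of the track finder and of the cost model. -/

import Mathlib

open scoped Matrix ENNReal

noncomputable section

namespace CTF

/-! ### Classical step counting -/

/-- A deterministic computation: its result together with the number of elementary steps used. -/
structure Counted (α : Type) where
  val : α
  cost : ℕ

instance : Monad Counted where
  pure a := ⟨a, 0⟩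
  bind x f := ⟨(f x.val).val, x.cost + (f x.val).cost⟩

/-- Spend `c` steps. -/
def Counted.tick (c : ℕ) : Counted Unit := ⟨(), c⟩

/-! ### Randomised (hybrid classical/quantum) computations with a running time -/

/-- A randomised computation, described by what happens when it is run with a time budget `b`:
either it is still running when the budget is exhausted (`none`), or it halts with a result and
some unused time (`some (result, unused)`).  Computations that may run forever are allowed. -/
def Timed (α : Type) : Type := ℕ → PMF (Option (α × ℕ))

namespace Timed

/-- Sequential composition; the second computation runs on the time left by the first one. -/
def andThen {α β : Type} (x : Timed α) (f : α → Timed β) : Timed β := fun b =>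
  (x b).bind fun r => match r with
    | none => PMF.pure none
    | some (a, b') => f a b'

instance : Monad Timed where
  pure a := fun b => PMF.pure (some (a, b))
  bind := andThen

/-- Spend `c` units of time. -/
def tick (c : ℕ) : Timed Unit := fun b =>
  PMF.pure (if c ≤ b then some ((), b - c) else none)

/-- Draw a random value; drawing itself is free, the caller pays for it with `tick`. -/
def sample {α : Type} (p : PMF α) : Timed α := fun b => p.map fun a => some (a, b)

/-- A deterministic computation, run as part of a randomised one. -/
def ofCounted {α : Type} (x : Counted α) : Timed α := do
  tick x.cost
  pure x.val

instance : MonadLift Counted Timed := ⟨ofCounted⟩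

/-- At most `fuel` tests of the condition of a while loop; each round costs at least one step. -/
def whileAux {σ : Type} (cond : σ → Prop) (body : σ → Timed σ) : ℕ → σ → Timed σ
  | 0, _ => fun _ => PMF.pure none
  | fuel + 1, s => open Classical in
      if cond s then do
        tick 1
        let s' ← body s
        whileAux cond body fuel s'
      else pure s

/-- The unbounded loop "while `cond` do `body`".  Every round spends at least one unit of time, so
with budget `b` the condition is tested at most `b + 1` times before the budget is exhausted. -/
def whileLoop {σ : Type} (cond : σ → Prop) (body : σ → Timed σ) (s : σ) : Timed σ :=
  fun b => whileAux cond body (b + 1) s b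

/-- The probability that the computation halts within time `T` and returns `a`. -/
def probWithin {α : Type} (x : Timed α) (T : ℕ) (a : α) : ℝ≥0∞ :=
  ((x T).map (Option.map Prod.fst)) (some a)

end Timed

/-- Run `f` on every element of a list, in order, and concatenate the outputs. -/
def forEach {m : Type → Type} [Monad m] {α β : Type} (l : List α) (f : α → m (List β)) :
    m (List β) :=
  l.foldlM (fun acc a => do
    let r ← f a
    pure (acc ++ r)) []

/-! ### The constants of the computational model -/

/-- The constants hidden in the unit costs of the model.
* `step`: one computation of fixed size on `O(1)` numbers, hits, labels and state vectors, done
  classically or by a quantum circuit (arithmetic, comparison, random access to a hit, ...);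
* `qram`: a QRAM access with `q` address qubits takes `qram * (q + 1)` gates;
* `gate`: a reflection about the all-zero state of `s` qubits takes `gate * s` gates, a quantum
  Fourier transform on `p` qubits takes `gate * p ^ 2` gates, and controlling a circuit by one qubit
  multiplies its number of gates by `gate`. -/
structure CostModel where
  step : ℕ
  qram : ℕ
  gate : ℕ
  step_pos : 0 < step
  qram_pos : 0 < qram
  gate_pos : 0 < gate

/-! ### Quantum circuits -/

/-- A circuit on a register with computational basis `ι`: the unitary it implements and the number
of gates it is built from. -/
structure Circuit (ι : Type) [Fintype ι] [DecidableEq ι] where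
  op : Matrix.unitaryGroup ι ℂ
  gates : ℕ

section Circuits

variable {ι : Type} [Fintype ι] [DecidableEq ι]

lemma born_sum (U : Matrix.unitaryGroup ι ℂ) (x₀ : ι) :
    ∑ x, ENNReal.ofReal (‖U.1 x x₀‖ ^ 2) = 1 := by
  rw [← ENNReal.ofReal_sum_of_nonneg (fun _ _ => by positivity)]
  have h : (star U.1 * U.1) x₀ x₀ = 1 := by
    rw [Matrix.mem_unitaryGroup_iff'.mp U.2]; simp
  have h2 : ((∑ x, ‖U.1 x x₀‖ ^ 2 : ℝ) : ℂ) = 1 := by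
    rw [← h, Matrix.mul_apply]
    push_cast
    refine Finset.sum_congr rfl fun x _ => ?_
    rw [Matrix.star_apply]
    exact (Complex.conj_mul' _).symm
  have h3 : (∑ x, ‖U.1 x x₀‖ ^ 2 : ℝ) = 1 := by exact_mod_cast h2
  rw [h3]; simp

/-- Born's rule: the outcome of measuring `U |x₀⟩` in the computational basis. -/
def measure (U : Matrix.unitaryGroup ι ℂ) (x₀ : ι) : PMF ι :=
  PMF.ofFintype (fun x => ENNReal.ofReal (‖U.1 x x₀‖ ^ 2)) (born_sum U x₀)

/-- Run a circuit on the basis state `x₀` and measure all qubits; time is the number of gates. -/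
def Circuit.run (U : Circuit ι) (x₀ : ι) : Timed ι := do
  Timed.tick U.gates
  Timed.sample (measure U.op x₀)

/-- `U * V`: first `V`, then `U`. -/
instance : Mul (Circuit ι) := ⟨fun U V => ⟨U.op * V.op, U.gates + V.gates⟩⟩

/-- `m` repetitions of a circuit. -/
def Circuit.iterate (U : Circuit ι) (m : ℕ) : Circuit ι := ⟨U.op ^ m, m * U.gates⟩

open Classical in
/-- The phase oracle `|x⟩ ↦ -|x⟩` if `f x`, and `|x⟩ ↦ |x⟩` otherwise, built from `g` gates. -/
def phaseOracle (f : ι → Prop) (g : ℕ) : Circuit ι where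
  op := ⟨Matrix.diagonal fun x => if f x then (-1 : ℂ) else 1, by
    rw [Matrix.mem_unitaryGroup_iff, Matrix.star_eq_conjTranspose, Matrix.diagonal_conjTranspose,
      Matrix.diagonal_mul_diagonal, ← Matrix.diagonal_one]
    congr 1
    funext x
    by_cases h : f x <;> simp [h]⟩
  gates := g

/-- The reflection `2|x₀⟩⟨x₀| - I`, built from `g` gates. -/
def reflection (x₀ : ι) (g : ℕ) : Circuit ι where
  op := ⟨Matrix.diagonal fun x => if x = x₀ then (1 : ℂ) else -1, by
    rw [Matrix.mem_unitaryGroup_iff, Matrix.star_eq_conjTranspose, Matrix.diagonal_conjTranspose,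
      Matrix.diagonal_mul_diagonal, ← Matrix.diagonal_one]
    congr 1
    funext x
    by_cases h : x = x₀ <;> simp [h]⟩
  gates := g

/-- Two circuits on disjoint registers. -/
def Circuit.tensor {κ : Type} [Fintype κ] [DecidableEq κ] (U : Circuit ι) (V : Circuit κ) :
    Circuit (ι × κ) where
  op := ⟨Matrix.kronecker U.op.1 V.op.1, Matrix.kronecker_mem_unitary U.op.2 V.op.2⟩
  gates := U.gates + V.gates

end Circuits

/-- Computational basis of a register whose qubits are indexed by `κ`. -/
abbrev Reg (κ : Type) : Type := κ → Fin 2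

/-- The number in `{0, …, 2 ^ p - 1}` with the given binary digits. -/
def regVal {p : ℕ} (x : Reg (Fin p)) : ℕ := (finFunctionFinEquiv x : Fin (2 ^ p))

/-- The entries of the one-qubit Hadamard gate. -/
def hadamardEntry (a b : Fin 2) : ℂ := (if a = 1 ∧ b = 1 then -1 else 1) / (√2 : ℝ)

lemma hadamardEntry_orth (a c : Fin 2) :
    ∑ b, hadamardEntry a b * star (hadamardEntry c b) = if a = c then 1 else 0 := by
  have h2 : ((√2 : ℝ) : ℂ) * ((√2 : ℝ) : ℂ) = 2 := by
    rw [← Complex.ofReal_mul, Real.mul_self_sqrt (by norm_num)]; norm_num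
  have h0 : ((√2 : ℝ) : ℂ) ≠ 0 := by
    intro h; rw [h] at h2; norm_num at h2
  fin_cases a <;> fin_cases c <;>
    simp [hadamardEntry, Fin.sum_univ_two] <;> field_simp <;>
    simp [pow_two, h2]
  norm_num

section Registers

variable (κ : Type) [Fintype κ] [DecidableEq κ]

/-- The Walsh–Hadamard transform: one Hadamard gate on every qubit. -/
def walshHadamard : Circuit (Reg κ) where
  op := ⟨Matrix.of fun x y => ∏ i, hadamardEntry (x i) (y i), by
    rw [Matrix.mem_unitaryGroup_iff]
    ext x z
    rw [Matrix.mul_apply]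
    simp only [Matrix.star_apply, Matrix.of_apply, star_prod, ← Finset.prod_mul_distrib]
    have h := (Finset.prod_univ_sum (fun _ : κ => (Finset.univ : Finset (Fin 2)))
      (fun i b => hadamardEntry (x i) b * star (hadamardEntry (z i) b))).symm
    rw [Fintype.piFinset_univ] at h
    rw [h]
    simp only [hadamardEntry_orth, Matrix.one_apply]
    by_cases hxz : x = z
    · simp [hxz]
    · obtain ⟨i, hi⟩ := Function.ne_iff.mp hxz
      rw [if_neg hxz]
      exact Finset.prod_eq_zero (Finset.mem_univ i) (by simp [hi])⟩
  gates := Fintype.card κ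

/-- One Grover iteration `H (2|0⟩⟨0| - I) H O` for the marked states `f`, the oracle `O` being
built from `g` gates. -/
def groverStep (cm : CostModel) (f : Reg κ → Prop) (g : ℕ) : Circuit (Reg κ) :=
  walshHadamard κ * (reflection 0 (cm.gate * Fintype.card κ) * (walshHadamard κ * phaseOracle f g))

/-- Prepare the uniform superposition, apply `m` Grover iterations, and measure. -/
def groverSample (cm : CostModel) (f : Reg κ → Prop) (g m : ℕ) : Timed (Reg κ) :=
  ((groverStep κ cm f g).iterate m * walshHadamard κ).run 0

/-- `|x⟩|y⟩ ↦ (U ^ y |x⟩)|y⟩` with a `p`-qubit control register, by `2 ^ p - 1` controlled calls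
of `U`. -/
def controlledPowers (cm : CostModel) (U : Circuit (Reg κ)) (p : ℕ) :
    Circuit (Reg κ × Reg (Fin p)) where
  op := ⟨Matrix.blockDiagonal fun y => (U.op ^ regVal y).1, by
    rw [Matrix.mem_unitaryGroup_iff, Matrix.star_eq_conjTranspose,
      Matrix.blockDiagonal_conjTranspose, ← Matrix.blockDiagonal_mul, ← Matrix.blockDiagonal_one]
    congr 1
    funext y
    exact Matrix.mem_unitaryGroup_iff.mp (U.op ^ regVal y).2⟩
  gates := (2 ^ p - 1) * (cm.gate * U.gates)

end Registers

/-- The entries of the inverse quantum Fourier transform on `p` qubits. -/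
def fourierEntry (p : ℕ) (x y : Reg (Fin p)) : ℂ :=
  Complex.exp (-(2 * Real.pi * Complex.I * regVal x * regVal y / (2 ^ p : ℕ))) / (√(2 ^ p : ℕ) : ℝ)

lemma fourier_unitary (p : ℕ) :
    Matrix.of (fourierEntry p) ∈ Matrix.unitaryGroup (Reg (Fin p)) ℂ := by
  rw [Matrix.mem_unitaryGroup_iff]
  ext x z
  rw [Matrix.mul_apply, Matrix.one_apply]
  simp only [Matrix.star_apply, Matrix.of_apply, fourierEntry]
  set P : ℕ := 2 ^ p with hP
  have hP0 : (P : ℂ) ≠ 0 := by simp [hP]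
  have hs : ((√(P : ℝ) : ℝ) : ℂ) * ((√(P : ℝ) : ℝ) : ℂ) = P := by
    rw [← Complex.ofReal_mul, Real.mul_self_sqrt (by positivity)]; simp
  set w : ℂ := Complex.exp (-(2 * Real.pi * Complex.I * ((regVal x : ℂ) - regVal z) / P)) with hw
  have hterm : ∀ y : Reg (Fin p),
      Complex.exp (-(2 * Real.pi * Complex.I * regVal x * regVal y / P)) / (√(P : ℝ) : ℝ) *
        star (Complex.exp (-(2 * Real.pi * Complex.I * regVal z * regVal y / P)) / (√(P : ℝ) : ℝ))
      = w ^ regVal y / P := by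
    intro y
    rw [star_div₀, div_mul_div_comm]
    have h1 : star ((√(P : ℝ) : ℝ) : ℂ) = ((√(P : ℝ) : ℝ) : ℂ) := Complex.conj_ofReal _
    have h2 : star (Complex.exp (-(2 * Real.pi * Complex.I * regVal z * regVal y / P))) =
        Complex.exp (2 * Real.pi * Complex.I * regVal z * regVal y / P) := by
      change (starRingEnd ℂ) _ = _
      rw [← Complex.exp_conj]
      congr 1
      have h2 : (starRingEnd ℂ) 2 = 2 := map_ofNat _ 2
      simp [h2]
      ring
    rw [h1, h2, hs, ← Complex.exp_add, hw, ← Complex.exp_nat_mul]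
    congr 2
    ring
  rw [Finset.sum_congr rfl fun y _ => hterm y, ← Finset.sum_div]
  have hsum : ∑ y : Reg (Fin p), w ^ regVal y = ∑ j ∈ Finset.range P, w ^ j := by
    rw [Finset.sum_range]
    exact Fintype.sum_equiv finFunctionFinEquiv _ _ fun y => rfl
  rw [hsum]
  by_cases hxz : x = z
  · subst hxz
    simp [hw, hP0]
  · rw [if_neg hxz]
    have hv : regVal x ≠ regVal z := fun h =>
      hxz (finFunctionFinEquiv.injective (Fin.ext h))
    have hpi : (2 * Real.pi * Complex.I : ℂ) ≠ 0 := Complex.two_pi_I_ne_zero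
    have hx : regVal x < P := (finFunctionFinEquiv x).2
    have hz : regVal z < P := (finFunctionFinEquiv z).2
    have hw1 : w ≠ 1 := by
      intro h
      obtain ⟨m, hm⟩ := Complex.exp_eq_one_iff.mp h
      have h3 : (2 * Real.pi * Complex.I : ℂ) * ((regVal z : ℂ) - regVal x) =
          (2 * Real.pi * Complex.I : ℂ) * (m * P) := by
        field_simp at hm
        linear_combination (2 * Real.pi * Complex.I : ℂ) * hm
      have h4 : ((regVal z : ℂ) - regVal x) = m * P := mul_left_cancel₀ hpi h3
      have h5 : ((regVal z : ℤ) - regVal x) = m * P := by exact_mod_cast h4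
      have hm0 : m = 0 := by
        by_contra hne
        rcases lt_or_gt_of_ne hne with hneg | hpos
        · nlinarith
        · nlinarith
      rw [hm0] at h5
      omega
    have hwP : w ^ P = 1 := by
      rw [hw, ← Complex.exp_nat_mul, Complex.exp_eq_one_iff]
      refine ⟨(regVal z : ℤ) - regVal x, ?_⟩
      push_cast
      field_simp
      ring
    rw [geom_sum_eq hw1, hwP]
    simp

/-- The inverse quantum Fourier transform on `p` qubits. -/
def inverseFourier (cm : CostModel) (p : ℕ) : Circuit (Reg (Fin p)) where
  op := ⟨Matrix.of (fourierEntry p), fourier_unitary p⟩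
  gates := cm.gate * p ^ 2

section Counting

variable (κ : Type) [Fintype κ] [DecidableEq κ]

/-- One run of phase estimation for the Grover iteration with a `p`-qubit counting register.  The
outcome `y` estimates `± 2 ^ p * θ / π` modulo `2 ^ p`, where `sin θ ^ 2` is the fraction of marked
states. -/
def phaseSample (cm : CostModel) (f : Reg κ → Prop) (g p : ℕ) : Timed ℕ := do
  let r ← (Circuit.tensor ⟨1, 0⟩ (inverseFourier cm p) *
    (controlledPowers κ cm (groverStep κ cm f g) p *
      Circuit.tensor (walshHadamard κ) (walshHadamard (Fin p)))).run (0, 0)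
  pure (regVal r.2)

/-- The number of marked states, out of `2 ^ card κ`, that corresponds to the outcome `y`. -/
def countEstimate (p y : ℕ) : ℝ :=
  2 ^ Fintype.card κ * Real.sin (Real.pi * y / 2 ^ p) ^ 2

/-- Quantum counting (Brassard, Høyer, Tapp): a rough estimate `t₁` of the number of marked states
is used to choose the precision of a second estimate, which is rounded to an integer. -/
def quantumCount (cm : CostModel) (f : Reg κ → Prop) (g : ℕ) : Timed ℕ := do
  let N : ℝ := 2 ^ Fintype.card κ
  let p₁ := Nat.clog 2 ⌈2 ^ 10 * √N⌉₊
  let y₁ ← phaseSample κ cm f g p₁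
  let t₁ := countEstimate κ p₁ y₁
  let p₂ := Nat.clog 2 ⌈2 ^ 10 * √((t₁ + 1) * N)⌉₊
  let y₂ ← phaseSample κ cm f g p₂
  Timed.tick cm.step
  pure ⌊countEstimate κ p₂ y₂ + 1 / 2⌋₊

end Counting

/-! ### Balanced search trees and sorting, with counted comparisons

`Ordnode` is Mathlib's self-balancing (size balanced) binary search tree. -/

/-- The number of nodes (including the final leaf) visited when searching for `x`. -/
def searchPath {α : Type} [LinearOrder α] (x : α) : Ordnode α → ℕ
  | .nil => 1
  | .node _ l y r => 1 + match cmpLE x y with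
    | Ordering.lt => searchPath x l
    | Ordering.eq => 0
    | Ordering.gt => searchPath x r

/-- Search for `x` in a tree. -/
def treeMem {α : Type} [LinearOrder α] (cm : CostModel) (x : α) (t : Ordnode α) : Counted Bool :=
  ⟨Ordnode.mem x t, searchPath x t * cm.step⟩

/-- Insert `x` into a tree, rebalancing along the search path. -/
def treeInsert {α : Type} [LinearOrder α] (cm : CostModel) (x : α) (t : Ordnode α) :
    Counted (Ordnode α) :=
  ⟨Ordnode.insert x t, searchPath x t * cm.step⟩

open Classical in
/-- Merge two lists; an element of the first list goes first unless the head of the second list is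
strictly before it. -/
def mergeLists {α : Type} (cm : CostModel) (before : α → α → Prop) :
    List α → List α → Counted (List α)
  | [], ys => pure ys
  | xs, [] => pure xs
  | x :: xs, y :: ys =>
    if before y x then do
      Counted.tick cm.step
      let r ← mergeLists cm before (x :: xs) ys
      pure (y :: r)
    else do
      Counted.tick cm.step
      let r ← mergeLists cm before xs (y :: ys)
      pure (x :: r)
  termination_by xs ys => xs.length + ys.length

/-- Stable merge sort. -/
def mergeSort {α : Type} (cm : CostModel) (before : α → α → Prop) (l : List α) :
    Counted (List α) :=
  if h : l.length ≤ 1 then pure l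
  else do
    Counted.tick (l.length * cm.step)
    let a ← mergeSort cm before (l.take (l.length / 2))
    let b ← mergeSort cm before (l.drop (l.length / 2))
    mergeLists cm before a b
  termination_by l.length
  decreasing_by
    · simp only [List.length_take]; omega
    · simp only [List.length_drop]; omega

/-! ### Events, detector and track candidates -/

/-- A hit is a point of three-dimensional space. -/
abbrev Hit : Type := Fin 3 → ℝ

/-- The event record of a detector with `L` layers and `n` particles: for every layer and every
label in `{0, …, n - 1}` a hit, or nothing if it was not detected. -/
abbrev EventRecord (L n : ℕ) : Type := Fin L → Fin n → Option Hit

/-- Memory access; labels and layers out of range hold the flag `none`. -/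
def EventRecord.load {L n : ℕ} (ev : EventRecord L n) (l j : ℕ) : Option Hit :=
  if h : l < L ∧ j < n then ev ⟨l, h.1⟩ ⟨j, h.2⟩ else none

/-- Estimated track parameters at some layer, with their covariance matrix. -/
structure TrackState where
  param : Fin 5 → ℝ
  cov : Matrix (Fin 5) (Fin 5) ℝ

/-- The linear model at a layer: process matrix, process noise covariance, measurement matrix,
measurement noise covariance. -/
structure LayerModel where
  process : Matrix (Fin 5) (Fin 5) ℝ
  processCov : Matrix (Fin 5) (Fin 5) ℝ
  meas : Matrix (Fin 3) (Fin 5) ℝ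
  measCov : Matrix (Fin 3) (Fin 3) ℝ

namespace LayerModel

/-- Prediction of the state at this layer from the filtered state at the previous one. -/
def predict (M : LayerModel) (s : TrackState) : TrackState :=
  ⟨M.process *ᵥ s.param, M.process * s.cov * M.processᵀ + M.processCov⟩

/-- Covariance matrix of the predicted residual; `s` is the predicted state. -/
def residualCov (M : LayerModel) (s : TrackState) : Matrix (Fin 3) (Fin 3) ℝ :=
  M.meas * s.cov * M.measᵀ + M.measCov

/-- Predicted residual of a hit; `s` is the predicted state. -/
def residual (M : LayerModel) (s : TrackState) (h : Hit) : Hit := h - M.meas *ᵥ s.param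

/-- Predicted `χ²` of a hit; `s` is the predicted state. -/
def chiSq (M : LayerModel) (s : TrackState) (h : Hit) : ℝ :=
  M.residual s h ⬝ᵥ ((M.residualCov s)⁻¹ *ᵥ M.residual s h)

/-- Kalman gain; `s` is the predicted state. -/
def gain (M : LayerModel) (s : TrackState) : Matrix (Fin 5) (Fin 3) ℝ :=
  s.cov * M.measᵀ * (M.residualCov s)⁻¹

/-- Filtered state after adding a hit to a track with predicted state `s`. -/
def update (M : LayerModel) (s : TrackState) (h : Hit) : TrackState :=
  ⟨s.param + M.gain s *ᵥ M.residual s h, (1 - M.gain s * M.meas) * s.cov⟩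

end LayerModel

/-- The parameters of the track finder.  They are fixed, independently of the event. -/
structure Config where
  /-- The seeding criterion. -/
  good : Hit → Hit → Hit → Prop
  /-- Initial state estimate of a seed, and its total `χ²`. -/
  seedFit : Hit → Hit → Hit → TrackState × ℝ
  layer : ℕ → LayerModel
  /-- Threshold for the predicted `χ²` of a hit. -/
  chiMax : ℝ
  /-- Weight of `χ²` in the quality score. -/
  weight : ℝ
  weight_pos : 0 < weight
  /-- Number of tracks retained per seed at each layer. -/
  lam : ℕ
  lam_pos : 0 < lam
  /-- Maximum allowed fraction of shared hits. -/
  shareFrac : ℝ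
  /-- Quality score of a track, given by the layers and positions of its hits, after the
  smoothing refit. -/
  refitScore : List (ℕ × Hit) → ℝ
  /-- Minimum quality score of the selected tracks. -/
  minScore : ℝ

/-- A track candidate: layers and labels of its (real) hits in increasing order of layers, current
filtered state, number of ghost hits, and total `χ²`. -/
structure Candidate where
  hits : List (ℕ ×ₗ ℕ)
  state : TrackState
  ghosts : ℕ
  chi : ℝ

/-- Quality score of a candidate that has reached layer `l`. -/
def quality (cfg : Config) (l : ℕ) (t : Candidate) : ℝ := l - t.ghosts - cfg.weight * t.chi

section Algorithms

variable {L n : ℕ} (cfg : Config) (cm : CostModel) (ev : EventRecord L n)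

/-! ### Seed generation -/

/-- The labels of a hit triplet in layers `0`, `1`, `2`. -/
abbrev Seed : Type := ℕ ×ₗ ℕ ×ₗ ℕ

/-- The triplet consists of detected hits and satisfies the seeding criterion. -/
def IsGoodSeed (s : Seed) : Prop :=
  ∃ h₀ h₁ h₂, EventRecord.load ev 0 (ofLex s).1 = some h₀ ∧
    EventRecord.load ev 1 (ofLex (ofLex s).2).1 = some h₁ ∧
    EventRecord.load ev 2 (ofLex (ofLex s).2).2 = some h₂ ∧ cfg.good h₀ h₁ h₂

open Classical in
/-- Classical seed generation. -/
def seedGeneration : Counted (List Seed) :=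
  forEach (List.range n) fun j₀ =>
  forEach (List.range n) fun j₁ =>
  forEach (List.range n) fun j₂ => do
    Counted.tick cm.step
    let s : Seed := toLex (j₀, toLex (j₁, j₂))
    pure (if IsGoodSeed cfg ev s then [s] else [])

/-- The number of seeds that are formed. -/
def kSeed : ℕ :=
  Nat.card {x : Fin n × Fin n × Fin n //
    IsGoodSeed cfg ev (toLex ((x.1 : ℕ), toLex ((x.2.1 : ℕ), (x.2.2 : ℕ))))}

/-- The number of qubits that hold a label; labels `≥ n` are padding and carry no hit. -/
def labelBits (n : ℕ) : ℕ := Nat.clog 2 n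

/-- The triplet of labels held by a register of three labels. -/
def regSeed {q : ℕ} (x : Reg (Fin 3 × Fin q)) : Seed :=
  toLex (regVal fun b => x (0, b), toLex (regVal fun b => x (1, b), regVal fun b => x (2, b)))

/-- Gates of the seed oracle: load three hits, test the seeding criterion, unload. -/
def seedOracleGates (n : ℕ) : ℕ := 2 * (3 * (cm.qram * (labelBits n + 1))) + cm.step

open Classical in
/-- Seed generation with quantum search: count the good seeds, then sample with the corresponding
number of Grover iterations until that many different good seeds have been found. -/
def quantumSeedGeneration : Timed (List Seed) := do
  let κ := Fin 3 × Fin (labelBits n)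
  let f : Reg κ → Prop := fun x => IsGoodSeed cfg ev (regSeed x)
  let k ← quantumCount κ cm f (seedOracleGates cm n)
  let θ := Real.arcsin √((k : ℝ) / 2 ^ Fintype.card κ)
  let m := ⌊Real.pi / (4 * θ)⌋₊
  let found ← Timed.whileLoop (fun t : Ordnode Seed => t.size < k) (fun t => do
    let x ← groverSample κ cm f (seedOracleGates cm n) m
    Timed.tick cm.step
    if f x then Timed.ofCounted (treeInsert cm (regSeed x) t) else pure t) Ordnode.nil
  Timed.tick (found.size * cm.step)
  pure found.toList

/-! ### Track finding -/

/-- The initial candidate formed by a seed. -/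
def seedCandidate (s : Seed) : Candidate :=
  let j₀ := (ofLex s).1
  let j₁ := (ofLex (ofLex s).2).1
  let j₂ := (ofLex (ofLex s).2).2
  let fit := cfg.seedFit ((EventRecord.load ev 0 j₀).getD 0) ((EventRecord.load ev 1 j₁).getD 0)
    ((EventRecord.load ev 2 j₂).getD 0)
  ⟨[toLex (0, j₀), toLex (1, j₁), toLex (2, j₂)], fit.1, 0, fit.2⟩

/-- Predicted state of a candidate at layer `l`. -/
def predicted (l : ℕ) (t : Candidate) : TrackState := (cfg.layer l).predict t.state

/-- Predicted `χ²` of the hit with label `j` in layer `l`, if there is such a hit. -/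
def chiOf (l : ℕ) (t : Candidate) (j : ℕ) : Option ℝ :=
  (EventRecord.load ev l j).map ((cfg.layer l).chiSq (predicted cfg l t))

/-- The candidate extended by the hit with label `j` in layer `l`. -/
def extend (l : ℕ) (t : Candidate) (j : ℕ) : Candidate :=
  let h := (EventRecord.load ev l j).getD 0
  let s := predicted cfg l t
  ⟨t.hits ++ [toLex (l, j)], (cfg.layer l).update s h, t.ghosts, t.chi + (cfg.layer l).chiSq s h⟩

/-- The candidate extended by a ghost hit at the predicted measurement in layer `l`: the residual
vanishes and there is no new information on the state. -/
def extendGhost (l : ℕ) (t : Candidate) : Candidate :=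
  ⟨t.hits, predicted cfg l t, t.ghosts + 1, t.chi⟩

/-- If no new candidate was formed, use a ghost hit. -/
def orGhost (l : ℕ) (t : Candidate) (new : List Candidate) : List Candidate :=
  match new with
  | [] => [extendGhost cfg l t]
  | _ :: _ => new

open Classical in
/-- Classical filtering of one candidate at layer `l`: loop over all hits of the layer. -/
def classicalFilter (l : ℕ) (t : Candidate) : Counted (List Candidate) := do
  Counted.tick cm.step
  let new ← forEach (List.range n) fun j => do
    Counted.tick cm.step
    if ∃ x, chiOf cfg ev l t j = some x ∧ x < cfg.chiMax then do
      Counted.tick cm.step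
      pure [extend cfg ev l t j]
    else pure []
  Counted.tick cm.step
  pure (orGhost cfg l t new)

open Classical in
/-- Insert a candidate behind those of at least the same quality at layer `l`. -/
def insertByQuality (l : ℕ) (t : Candidate) : List Candidate → List Candidate
  | [] => [t]
  | u :: us => if quality cfg l u < quality cfg l t then t :: u :: us
      else u :: insertByQuality l t us

/-- Keep the best `lam` candidates at layer `l` (the earlier one if qualities are equal), by
insertion into a sorted list of length at most `lam`. -/
def selectBest (l : ℕ) (ts : List Candidate) : Counted (List Candidate) :=
  ts.foldlM (fun best t => do
    Counted.tick ((cfg.lam + 1) * cm.step)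
    pure ((insertByQuality cfg l t best).take cfg.lam)) []

/-- The common skeleton of classical and quantum track finding: every seed is followed through the
layers `3, …, L - 1`, `filter l t` being the list of new candidates that replace `t` at layer
`l`. -/
def findTracks {m : Type → Type} [Monad m] [MonadLiftT Counted m]
    (L : ℕ) (filter : ℕ → Candidate → m (List Candidate)) (seeds : List Seed) :
    m (List Candidate) :=
  forEach seeds fun s => do
    liftM (Counted.tick cm.step)
    (List.range' 3 (L - 3)).foldlM (fun ts l => do
      let new ← forEach ts (filter l)
      liftM (selectBest cfg cm l new)) [seedCandidate cfg ev s]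

/-- Classical track finding. -/
def trackFinding (seeds : List Seed) : Counted (List Candidate) :=
  findTracks cfg cm ev L (classicalFilter cfg cm ev) seeds

/-- The hits marked in quantum minimum finding, for a table `χ` of predicted `χ²` values: `j` has
not been used before and is better than the best hit so far (or than the threshold, if there is
none yet).  Equal values of `χ²` are ordered by their labels. -/
def Better (χ : ℕ → Option ℝ) (chiMax : ℝ) (used : List ℕ) (best : Option ℕ) (j : ℕ) : Prop :=
  j ∉ used ∧ ∃ x, χ j = some x ∧ match best with
    | none => x < chiMax
    | some i => ∃ y, χ i = some y ∧ (x < y ∨ x = y ∧ j < i)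

/-- A uniformly random element of `{0, …, k - 1}`, for `k ≥ 1`. -/
def uniformBelow (k : ℕ) : PMF ℕ := (PMF.uniformOfFintype (Fin (k - 1 + 1))).map Fin.val

/-- Gates of the oracle of quantum minimum finding: load a hit, compute its `χ²`, compare it with
the threshold and its label with the labels of the best and of the used hits, uncompute. -/
def findOracleGates (n : ℕ) : ℕ :=
  2 * (cm.qram * (labelBits n + 1)) + 3 * cm.step + (cfg.lam + 1) * (labelBits n + 1)

/-- State of quantum minimum finding: number of oracle calls so far, current bound on the number of
Grover iterations in the exponential search, best hit so far. -/
structure MinState where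
  calls : ℕ
  bound : ℝ
  best : Option ℕ

open Classical in
/-- Quantum minimum finding (Dürr, Høyer) in layer `l`.  One round of the loop is one round of the
exponential searching algorithm (Boyer, Brassard, Høyer, Tapp), which starts anew whenever a better
hit has been found; the test of a measured label counts as a call of the oracle. -/
def quantumMinimumFinding (l : ℕ) (t : Candidate) (used : List ℕ) : Timed (Option ℕ) := do
  let q := labelBits n
  let rootN : ℝ := √(2 ^ q)
  let marked := Better (chiOf cfg ev l t) cfg.chiMax used
  let final ← Timed.whileLoop (fun s : MinState => (s.calls : ℝ) < 22.5 * rootN) (fun s => do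
    let j ← Timed.sample (uniformBelow ⌈s.bound⌉₊)
    let x ← groverSample (Fin q) cm (fun x => marked s.best (regVal x)) (findOracleGates cfg cm n) j
    Timed.tick (findOracleGates cfg cm n)
    if marked s.best (regVal x) then pure ⟨s.calls + j + 1, 1, some (regVal x)⟩
    else pure ⟨s.calls + j + 1, min (6 / 5 * s.bound) rootN, s.best⟩) ⟨0, 1, none⟩
  pure final.best

open Classical in
/-- Run quantum minimum finding `r` times and return the best of the samples. -/
def repeatedMinimumFinding (l : ℕ) (t : Candidate) (used : List ℕ) (r : ℕ) : Timed (Option ℕ) :=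
  (List.range r).foldlM (fun best _ => do
    let o ← quantumMinimumFinding cfg cm ev l t used
    Timed.tick cm.step
    match o with
    | none => pure best
    | some j => pure (if Better (chiOf cfg ev l t) cfg.chiMax used best j then some j else best))
    none

/-- Quantum filtering of one candidate at layer `l`: find `lam` times the best hit that has not
been used yet. -/
def quantumFilter (l : ℕ) (t : Candidate) : Timed (List Candidate) := do
  Timed.tick cm.step
  let used ← (List.range cfg.lam).foldlM (fun (used : List ℕ) _ => do
    let o ← repeatedMinimumFinding cfg cm ev l t used
      (Nat.clog 2 (3 * L * cfg.lam ^ 2 * n ^ 3))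
    match o with
    | none => pure used
    | some j => do
      Timed.tick cm.step
      pure (used ++ [j])) []
  Timed.tick cm.step
  pure (orGhost cfg l t (used.map (extend cfg ev l t)))

/-- Quantum track finding. -/
def quantumTrackFinding (seeds : List Seed) : Timed (List Candidate) :=
  findTracks cfg cm ev L (quantumFilter cfg cm ev) seeds

/-! ### Improved track cleaning -/

/-- An `r`-tuple of a track: a sublist of `r` of its hits. -/
abbrev HitTuple : Type := List (ℕ ×ₗ ℕ)

/-- The number of shared hits beyond which a track of `h` hits is discarded. -/
def shareBound (h : ℕ) : ℕ := ⌈cfg.shareFrac * h⌉₊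

/-- Does one of the given tuples occur in the tree? -/
def anyMem (tuples : List HitTuple) (T : Ordnode HitTuple) : Counted Bool :=
  tuples.foldlM (fun b x => do
    let c ← treeMem cm x T
    pure (b || c)) false

/-- Treat one track.  `trees i j` holds the `i`-tuples of the accepted tracks whose bound on the
number of shared hits is `j`. -/
def cleanStep (R : ℕ) (st : (ℕ → ℕ → Ordnode HitTuple) × List Candidate) (t : Candidate) :
    Counted ((ℕ → ℕ → Ordnode HitTuple) × List Candidate) := do
  let r := shareBound cfg t.hits.length
  Counted.tick cm.step
  let b₁ ← (List.range' 1 r).foldlM (fun b i => do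
    let c ← anyMem cm (List.sublistsLen i t.hits) (st.1 i i)
    pure (b || c)) false
  let b₂ ← (List.range' r (R + 1 - r)).foldlM (fun b i => do
    let c ← anyMem cm (List.sublistsLen r t.hits) (st.1 r i)
    pure (b || c)) false
  if b₁ || b₂ then pure st
  else do
    let trees ← (List.range' 1 r).foldlM (fun trees i => do
      let T ← (List.sublistsLen i t.hits).foldlM (fun T x => treeInsert cm x T) (trees i r)
      pure (Function.update trees i (Function.update (trees i) r T))) st.1
    pure (trees, st.2 ++ [t])

/-- Improved track cleaning, for a detector with `L` layers: go through the candidates by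
decreasing quality and discard those that share too many hits with an accepted one. -/
def improvedCleaning (L : ℕ) (ts : List Candidate) : Counted (List Candidate) := do
  let R := shareBound cfg L
  let sorted ← mergeSort cm (fun t u => quality cfg (L - 1) u < quality cfg (L - 1) t) ts
  Counted.tick (R ^ 2 * cm.step)
  let st ← sorted.foldlM (cleanStep cfg cm R) (fun _ _ => Ordnode.nil, [])
  pure st.2

/-! ### Track selection -/

/-- The layers and positions of the hits of a track. -/
def hitPositions (t : Candidate) : List (ℕ × Hit) :=
  t.hits.map fun x => ((ofLex x).1, (EventRecord.load ev (ofLex x).1 (ofLex x).2).getD 0)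

open Classical in
/-- Track selection: refit every track and keep those whose new score reaches the threshold. -/
def trackSelection (ts : List Candidate) : Counted (List Candidate) :=
  forEach ts fun t => do
    Counted.tick cm.step
    pure (if cfg.refitScore (hitPositions ev t) < cfg.minScore then [] else [t])

/-! ### The complete track finders -/

/-- The classical improved combinatorial track finder. -/
def classicalCTF : Counted (List Candidate) := do
  let seeds ← seedGeneration cfg cm ev
  let tracks ← trackFinding cfg cm ev seeds
  let cleaned ← improvedCleaning cfg cm L tracks
  trackSelection cfg cm ev cleaned

/-- Quantum seed generation, quantum track finding, improved cleaning, selection. -/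
def quantumCTF : Timed (List Candidate) := do
  let seeds ← quantumSeedGeneration cfg cm ev
  let tracks ← quantumTrackFinding cfg cm ev seeds
  let cleaned ← Timed.ofCounted (improvedCleaning cfg cm L tracks)
  Timed.ofCounted (trackSelection cfg cm ev cleaned)

/-- Classical seed generation, quantum track finding, improved cleaning, selection. -/
def semiQuantumCTF : Timed (List Candidate) := do
  let seeds ← Timed.ofCounted (seedGeneration cfg cm ev)
  let tracks ← quantumTrackFinding cfg cm ev seeds
  let cleaned ← Timed.ofCounted (improvedCleaning cfg cm L tracks)
  Timed.ofCounted (trackSelection cfg cm ev cleaned)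

end Algorithms

end CTF

end

open scoped Matrix ENNReal

noncomputable section

namespace CTF

/-! Each quantum routine is shown to return, outside an event of small probability, exactly the
object computed by its classical counterpart. Cleaning and selection are then the same deterministic
code on the same input, so the outputs coincide and only times and failure probabilities have to be
added up.

The bookkeeping is done by `Timed.Spec`, under which times and failure probabilities add along
composition (`Timed.Spec.bind`, `Timed.spec_foldlM`). Unbounded loops are handled by
`Timed.loss_whileLoop_le`: a potential that does not increase in expectation and dominates the loss
at the end bounds the failure probability. Taking as potential the time spent plus the expected time
still needed, divided by the limit, makes this Markov's inequality.

Seeds: a Grover iteration is a rotation by `2θ`, where `sin² θ` is the fraction of good seeds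
(`grover_amplitude`). Phase estimation reads off `±θ`, with errors controlled by tails of the Fejér
kernel. A first estimate fixes the order of magnitude of the count and a second one has error below
`1 / 2`, so rounding is exact with probability at least `19 / 20`. With the exact count, a sample is
a uniformly distributed good seed with probability at least `1 / 2`; a coupon collector argument
(`spec_collect`) then needs about `k log k` samples of `√(n³ / k)` iterations. The ordered tree
lists the seeds lexicographically, which is the order of the classical loops.

Minimum finding: `minPotential` bounds the expected number of oracle calls. Exponential search for
one of `t` among `N` items takes `O(√(N / t))` calls, and a threshold with `r` better items is met
with probability `1 / (r + 1)`. For `N ≥ 136 ^ 4` the sum is at most `45 / 4 * √N`, half of the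
allowed `22.5 * √N`, so one run succeeds with probability at least `1 / 2`. A failure of repeated
minimum finding needs all repetitions to fail, and the number of repetitions makes the union bound
over all calls equal to `1 / 3`. Altogether `1 / 20 + 1 / 20 + 1 / 3 < 1 / 2`.

Track finding: extending a candidate only by its `lam` best hits does not change the selection,
because quality is strictly decreasing in `χ²` (the weight is positive) and only `lam` candidates
survive. Ties are the delicate point. Insertion by quality is stable and candidates of different
quality commute, while equal `χ²` is resolved by label, that is, in the order of the classical loop
(`foldl_selectStep_greedyHits`).

Times: cleaning is linear up to a logarithm, since the trees have polynomially many nodes and are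
balanced. The classical lower bound counts only the triple loop and the scan of layer `3`; comparing
it with the quantum bound is the elementary inequality `bound_mul_sqrt_le`. -/

/-! ### Expectations -/

/-- The expectation of a nonnegative function. -/
def expect {α : Type} (p : PMF α) (f : α → ℝ≥0∞) : ℝ≥0∞ := ∑' a, p a * f a

section Expect
variable {α β : Type}

lemma expect_pure (a : α) (f : α → ℝ≥0∞) : expect (PMF.pure a) f = f a := by
  classical
  unfold expect
  rw [tsum_eq_single a]
  · simp
  · intro b hb; simp [PMF.pure_apply, hb]

lemma expect_bind (p : PMF α) (g : α → PMF β) (f : β → ℝ≥0∞) :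
    expect (p.bind g) f = expect p fun a => expect (g a) f := by
  unfold expect
  simp_rw [PMF.bind_apply, ← ENNReal.tsum_mul_right, ← ENNReal.tsum_mul_left]
  rw [ENNReal.tsum_comm]
  simp_rw [mul_assoc]

lemma expect_map (p : PMF α) (g : α → β) (f : β → ℝ≥0∞) :
    expect (p.map g) f = expect p fun a => f (g a) := by
  rw [← PMF.bind_pure_comp, expect_bind]
  simp [Function.comp, expect_pure]

lemma expect_mono_support (p : PMF α) {f g : α → ℝ≥0∞} (h : ∀ a ∈ p.support, f a ≤ g a) :
    expect p f ≤ expect p g := by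
  refine ENNReal.tsum_le_tsum fun a => ?_
  by_cases ha : a ∈ p.support
  · exact mul_le_mul_right (h a ha) _
  · rw [PMF.mem_support_iff, not_not] at ha
    simp [ha]

lemma expect_mono (p : PMF α) {f g : α → ℝ≥0∞} (h : ∀ a, f a ≤ g a) :
    expect p f ≤ expect p g := expect_mono_support p fun a _ => h a

lemma expect_const (p : PMF α) (c : ℝ≥0∞) : expect p (fun _ => c) = c := by
  unfold expect
  rw [ENNReal.tsum_mul_right, p.tsum_coe, one_mul]

lemma expect_le_of_forall (p : PMF α) {f : α → ℝ≥0∞} {c : ℝ≥0∞} (h : ∀ a ∈ p.support, f a ≤ c) :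
    expect p f ≤ c := (expect_mono_support p h).trans (expect_const p c).le

lemma expect_add (p : PMF α) (f g : α → ℝ≥0∞) :
    expect p (fun a => f a + g a) = expect p f + expect p g := by
  unfold expect
  rw [← ENNReal.tsum_add]
  simp_rw [mul_add]

lemma expect_const_mul (p : PMF α) (c : ℝ≥0∞) (f : α → ℝ≥0∞) :
    expect p (fun a => c * f a) = c * expect p f := by
  unfold expect
  rw [← ENNReal.tsum_mul_left]
  simp_rw [mul_left_comm]

lemma expect_fintype [Fintype α] (p : PMF α) (f : α → ℝ≥0∞) :
    expect p f = ∑ a, p a * f a := tsum_fintype _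

end Expect

/-! ### Expected loss of a timed computation -/

namespace Timed

variable {α β σ : Type}

/-- The expected value of `Θ` at the result and the unused time, the loss of a computation that
does not halt within its budget being `1`. -/
def loss (x : Timed α) (b : ℕ) (Θ : α → ℕ → ℝ≥0∞) : ℝ≥0∞ :=
  expect (x b) fun r => r.elim 1 fun y => Θ y.1 y.2

lemma loss_pure (a : α) (b : ℕ) (Θ : α → ℕ → ℝ≥0∞) : loss (pure a : Timed α) b Θ = Θ a b :=
  expect_pure _ _

lemma loss_bind (x : Timed α) (f : α → Timed β) (b : ℕ) (Θ : β → ℕ → ℝ≥0∞) :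
    loss (x >>= f) b Θ = loss x b fun a b' => loss (f a) b' Θ := by
  change expect ((x b).bind _) _ = _
  rw [expect_bind]
  unfold loss
  congr 1
  funext r
  rcases r with _ | ⟨a, b'⟩
  · exact expect_pure _ _
  · rfl

lemma loss_tick (c b : ℕ) (Θ : Unit → ℕ → ℝ≥0∞) :
    loss (tick c) b Θ = if c ≤ b then Θ () (b - c) else 1 := by
  unfold loss tick
  rw [expect_pure]
  split_ifs <;> rfl

lemma loss_sample (p : PMF α) (b : ℕ) (Θ : α → ℕ → ℝ≥0∞) :
    loss (sample p) b Θ = expect p fun a => Θ a b := by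
  unfold loss sample
  rw [expect_map]
  rfl

lemma loss_ofCounted (x : Counted α) (b : ℕ) (Θ : α → ℕ → ℝ≥0∞) :
    loss (ofCounted x) b Θ = if x.cost ≤ b then Θ x.val (b - x.cost) else 1 := by
  unfold ofCounted
  rw [loss_bind, loss_tick]
  simp only [loss_pure]

lemma loss_mono (x : Timed α) (b : ℕ) {Θ Θ' : α → ℕ → ℝ≥0∞} (h : ∀ a b', Θ a b' ≤ Θ' a b') :
    loss x b Θ ≤ loss x b Θ' :=
  expect_mono _ fun r => by rcases r with _ | ⟨a, b'⟩ <;> simp [h]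

lemma loss_le_one (x : Timed α) (b : ℕ) {Θ : α → ℕ → ℝ≥0∞} (h : ∀ a b', Θ a b' ≤ 1) :
    loss x b Θ ≤ 1 :=
  expect_le_of_forall _ fun r _ => by rcases r with _ | ⟨a, b'⟩ <;> simp [h]

/-- If a loss is dominated by a combination of two other ones, so is its expectation. -/
lemma loss_le_add_mul (x : Timed α) (b : ℕ) {Θ Θ₁ Θ₂ : α → ℕ → ℝ≥0∞} (δ : ℝ≥0∞)
    (h : ∀ a b', Θ a b' ≤ Θ₁ a b' + δ * Θ₂ a b') :
    loss x b Θ ≤ loss x b Θ₁ + δ * loss x b Θ₂ := by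
  unfold loss
  rw [← expect_const_mul, ← expect_add]
  refine expect_mono _ fun r => ?_
  rcases r with _ | ⟨a, c⟩
  · simp
  · exact h a c

/-- The computation never returns more time than it was given. -/
def NonInc (x : Timed α) : Prop := ∀ b a b', some (a, b') ∈ (x b).support → b' ≤ b

lemma nonInc_pure (a : α) : NonInc (pure a : Timed α) := by
  intro b a' b' h
  change some (a', b') ∈ (PMF.pure (some (a, b))).support at h
  rw [PMF.support_pure, Set.mem_singleton_iff] at h
  simp at h
  omega

lemma NonInc.bind {x : Timed α} {f : α → Timed β} (hx : NonInc x) (hf : ∀ a, NonInc (f a)) :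
    NonInc (x >>= f) := by
  intro b a b' h
  change some (a, b') ∈ ((x b).bind _).support at h
  rw [PMF.mem_support_bind_iff] at h
  obtain ⟨r, hr, h⟩ := h
  rcases r with _ | ⟨a₁, b₁⟩
  · rw [PMF.support_pure] at h
    simp at h
  · exact (hf a₁ b₁ a b' h).trans (hx b a₁ b₁ hr)

lemma nonInc_tick (c : ℕ) : NonInc (tick c) := by
  intro b a b' h
  unfold tick at h
  rw [PMF.support_pure, Set.mem_singleton_iff] at h
  split_ifs at h
  · simp at h; omega

lemma nonInc_sample (p : PMF α) : NonInc (sample p) := by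
  intro b a b' h
  unfold sample at h
  rw [PMF.mem_support_map_iff] at h
  obtain ⟨a', _, h⟩ := h
  simp at h; omega

lemma nonInc_ofCounted (x : Counted α) : NonInc (ofCounted x) :=
  (nonInc_tick _).bind fun _ => nonInc_pure _

/-- A potential that does not increase in expectation bounds the loss of a while loop. -/
lemma loss_whileLoop_le {cond : σ → Prop} {body : σ → Timed σ} (hbody : ∀ s, NonInc (body s))
    {Θ post : σ → ℕ → ℝ≥0∞} (hpost : ∀ s b, ¬ cond s → post s b ≤ Θ s b)
    (hzero : ∀ s, cond s → 1 ≤ Θ s 0)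
    (hstep : ∀ s b, cond s → loss (body s) b Θ ≤ Θ s (b + 1)) (s : σ) (b : ℕ) :
    loss (whileLoop cond body s) b post ≤ Θ s b := by
  -- The fuel never runs out: every round ticks once, and by `NonInc` the body gives no time back,
  -- so the budget stays below the fuel. The same tick explains the `b + 1` in `hstep`.
  have key : ∀ fuel s b, b < fuel → loss (whileAux cond body fuel s) b post ≤ Θ s b := by
    intro fuel
    induction fuel with
    | zero => intro s b h; omega
    | succ fuel ih =>
      intro s b hb
      rw [whileAux]
      split_ifs with hc
      · rw [loss_bind, loss_tick]
        split_ifs with h1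
        · obtain ⟨b, rfl⟩ : ∃ c, b = c + 1 := ⟨b - 1, by omega⟩
          rw [loss_bind]
          refine le_trans ?_ (hstep s b hc)
          refine expect_mono_support _ fun r hr => ?_
          rcases r with _ | ⟨s', b'⟩
          · simp
          · refine ih s' b' ?_
            have := hbody s _ _ _ hr
            omega
        · have : b = 0 := by omega
          subst this
          exact hzero s hc
      · rw [loss_pure]
        exact hpost s b hc
  exact key (b + 1) s b (Nat.lt_succ_self b)

open Classical in
/-- With probability at least `1 - ε`, the computation halts within time `T` with a result
satisfying `Q`. -/
def Spec (x : Timed α) (T : ℕ) (ε : ℝ≥0∞) (Q : α → Prop) : Prop :=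
  ∀ B b, B + T ≤ b → loss x b (fun a b' => if Q a ∧ B ≤ b' then 0 else 1) ≤ ε

lemma Spec.mono {x : Timed α} {T T' : ℕ} {ε ε' : ℝ≥0∞} {Q Q' : α → Prop} (h : Spec x T ε Q)
    (hT : T ≤ T') (hε : ε ≤ ε') (hQ : ∀ a, Q a → Q' a) : Spec x T' ε' Q' := by
  classical
  intro B b hb
  refine le_trans (loss_mono _ _ fun a b' => ?_) ((h B b (by omega)).trans hε)
  by_cases h1 : Q a ∧ B ≤ b'
  · simp [h1, hQ a h1.1]
  · simp only [h1, if_false]; split_ifs <;> simp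

lemma spec_pure (a : α) {Q : α → Prop} (h : Q a) : Spec (pure a : Timed α) 0 0 Q := by
  intro B b hb
  rw [loss_pure, if_pos ⟨h, by omega⟩]

lemma spec_tick (c : ℕ) : Spec (tick c) c 0 fun _ => True := by
  intro B b hb
  rw [loss_tick, if_pos (by omega), if_pos ⟨trivial, by omega⟩]

lemma spec_ofCounted (x : Counted α) : Spec (ofCounted x) x.cost 0 fun a => a = x.val := by
  intro B b hb
  rw [loss_ofCounted, if_pos (by omega), if_pos ⟨rfl, by omega⟩]

/-- The reserve `B` quantified in `Spec` is what makes it composable. The first computation is run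
with reserve `B + T₂`, so whenever it succeeds the second one has enough time; otherwise the loss is
bounded by `1`. -/
lemma Spec.bind {x : Timed α} {f : α → Timed β} {T₁ T₂ : ℕ} {ε₁ ε₂ : ℝ≥0∞} {Q₁ : α → Prop}
    {Q₂ : β → Prop} (hx : Spec x T₁ ε₁ Q₁) (hf : ∀ a, Q₁ a → Spec (f a) T₂ ε₂ Q₂) :
    Spec (x >>= f) (T₁ + T₂) (ε₁ + ε₂) Q₂ := by
  classical
  intro B b hb
  rw [loss_bind]
  have h := hx (B + T₂) b (by omega)
  refine (loss_le_add_mul x b (Θ₁ := fun a b' => if Q₁ a ∧ B + T₂ ≤ b' then 0 else 1)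
    (Θ₂ := fun _ _ => 1) ε₂ fun a b' => ?_).trans ?_
  · by_cases h1 : Q₁ a ∧ B + T₂ ≤ b'
    · rw [if_pos h1, zero_add, mul_one]
      exact hf a h1.1 B b' h1.2
    · rw [if_neg h1]
      refine le_trans (loss_le_one _ _ fun _ _ => ?_) le_self_add
      split_ifs <;> simp
  · gcongr
    calc ε₂ * _ ≤ ε₂ * 1 := by gcongr; exact loss_le_one _ _ fun _ _ => le_rfl
      _ = ε₂ := mul_one _

lemma Spec.bind_zero_left {x : Timed α} {f : α → Timed β} {T₁ T₂ : ℕ} {ε : ℝ≥0∞} {Q₁ : α → Prop}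
    {Q₂ : β → Prop} (hx : Spec x T₁ 0 Q₁) (hf : ∀ a, Q₁ a → Spec (f a) T₂ ε Q₂) :
    Spec (x >>= f) (T₁ + T₂) ε Q₂ := by
  simpa using hx.bind hf

/-- Iterating a computation over a list adds up times and failure probabilities. -/
lemma spec_foldlM (f : β → α → Timed β) (I : ℕ → β → Prop) (T : ℕ) (ε : ℝ≥0∞) (l : List α)
    (i : ℕ) (s : β) (h0 : I i s)
    (h : ∀ j (hj : j < l.length) s, I (i + j) s → Spec (f s l[j]) T ε (I (i + j + 1))) :
    Spec (l.foldlM f s) (l.length * T) (l.length * ε) (I (i + l.length)) := by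
  induction l generalizing i s with
  | nil => simpa using spec_pure s h0
  | cons a l ih =>
    rw [List.foldlM_cons]
    have h1 := (h 0 (by simp) s h0).bind (T₂ := l.length * T) (ε₂ := l.length * ε)
      (Q₂ := I (i + (l.length + 1))) (f := fun s' => l.foldlM f s') fun s' hs' => ?_
    · refine h1.mono (by simp [add_mul, add_comm]) ?_ (by simp)
      rw [List.length_cons]
      push_cast
      rw [add_mul, one_mul, add_comm]
    · have := ih (i + 1) s' hs' fun j hj s hs => by
        have := h (j + 1) (by simpa using hj) s (by rwa [show i + (j + 1) = i + 1 + j by ring])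
        rwa [show i + (j + 1) + 1 = i + 1 + j + 1 by ring] at this
      rwa [show i + 1 + l.length = i + (l.length + 1) by ring] at this

/-- Running out of budget has loss `1`, so the indicator of the right answer and the loss add up to
`1` on every outcome. -/
lemma Spec.le_probWithin {x : Timed α} {T : ℕ} {ε : ℝ≥0∞} {a : α} (h : Spec x T ε fun r => r = a)
    {T' : ℕ} (hT : T ≤ T') : 1 - ε ≤ x.probWithin T' a := by
  classical
  have h1 := h 0 T' (by omega)
  have h2 : x.probWithin T' a + loss x T' (fun r b' => if r = a ∧ 0 ≤ b' then 0 else 1) = 1 := by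
    have h3 : x.probWithin T' a
        = expect ((x T').map (Option.map Prod.fst)) fun o => if o = some a then 1 else 0 := by
      unfold probWithin expect
      rw [tsum_eq_single (some a)]
      · simp
      · intro o ho; simp [ho]
    rw [h3, expect_map]
    unfold loss
    rw [← expect_add]
    refine Eq.trans (congrArg _ ?_) (expect_const (x T') 1)
    funext r
    rcases r with _ | ⟨a', b'⟩
    · simp
    · by_cases h : a' = a <;> simp [h]
  rw [← h2]
  exact tsub_le_iff_right.mpr (by gcongr)

end Timed

/-! ### Grover iterations -/

section Grover
variable {κ : Type} [Fintype κ] [DecidableEq κ]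

open Classical in
/-- The number of marked basis states. -/
def markedCount (f : Reg κ → Prop) : ℕ := (Finset.univ.filter f).card

lemma card_reg : Fintype.card (Reg κ) = 2 ^ Fintype.card κ := by simp

open Classical in
lemma markedCount_le (f : Reg κ → Prop) : markedCount f ≤ 2 ^ Fintype.card κ := by
  rw [← card_reg]; exact Finset.card_le_univ _

lemma ofReal_sqrt_two_pow (c : ℕ) : ((√2 : ℝ) : ℂ) ^ c = (√(2 ^ c) : ℝ) := by
  rw [← Complex.ofReal_pow]
  congr 1
  rw [eq_comm, Real.sqrt_eq_iff_mul_self_eq (by positivity) (by positivity), ← mul_pow,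
    Real.mul_self_sqrt (by norm_num)]

lemma walshHadamard_apply_zero (x : Reg κ) :
    (walshHadamard κ).op.1 x 0 = ((√(2 ^ Fintype.card κ) : ℝ) : ℂ)⁻¹ := by
  simp [walshHadamard, hadamardEntry, ← ofReal_sqrt_two_pow]

lemma walshHadamard_symm (x y : Reg κ) :
    (walshHadamard κ).op.1 x y = (walshHadamard κ).op.1 y x := by
  simp only [walshHadamard, Matrix.of_apply, hadamardEntry]
  refine Finset.prod_congr rfl fun i _ => ?_
  simp only [and_comm]

lemma walshHadamard_mul_self :
    (walshHadamard κ).op.1 * (walshHadamard κ).op.1 = 1 := by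
  have h : star (walshHadamard κ).op.1 = (walshHadamard κ).op.1 := by
    ext x y
    rw [Matrix.star_apply, walshHadamard_symm]
    simp only [walshHadamard, Matrix.of_apply, star_prod, hadamardEntry]
    refine Finset.prod_congr rfl fun i _ => ?_
    rw [star_div₀]
    congr 1
    · split_ifs <;> simp
    · exact Complex.conj_ofReal _
  have := Matrix.mem_unitaryGroup_iff.mp (walshHadamard κ).op.2
  rwa [h] at this

-- Conjugating the reflection about the zero state by the Walsh–Hadamard transform gives the
-- inversion about the mean; the oracle flips the signs of the marked entries beforehand.
open Classical in
lemma groverStep_mulVec (cm : CostModel) (f : Reg κ → Prop) (g : ℕ) (v : Reg κ → ℂ) (x : Reg κ) :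
    ((groverStep κ cm f g).op.1 *ᵥ v) x =
      2 / 2 ^ Fintype.card κ * (∑ y, (if f y then -1 else 1) * v y) -
        (if f x then -1 else 1) * v x := by
  set H := (walshHadamard κ).op.1 with hH
  set w : Reg κ → ℂ := fun y => (if f y then -1 else 1) * v y with hw
  have h1 : (groverStep κ cm f g).op.1 *ᵥ v =
      H *ᵥ ((Matrix.diagonal fun x : Reg κ => if x = 0 then (1 : ℂ) else -1) *ᵥ (H *ᵥ w)) := by
    have h2 : (groverStep κ cm f g).op.1 = H * ((Matrix.diagonal fun x : Reg κ =>
      if x = 0 then (1 : ℂ) else -1) * (H * Matrix.diagonal fun x => if f x then (-1 : ℂ) else 1)) :=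
      rfl
    rw [h2, ← Matrix.mulVec_mulVec, ← Matrix.mulVec_mulVec, ← Matrix.mulVec_mulVec]
    congr 3
    funext y
    rw [Matrix.mulVec_diagonal]
  have h3 : ((Matrix.diagonal fun x : Reg κ => if x = 0 then (1 : ℂ) else -1) *ᵥ (H *ᵥ w)) =
      (Pi.single 0 (2 * (H *ᵥ w) 0) : Reg κ → ℂ) - H *ᵥ w := by
    funext y
    rw [Matrix.mulVec_diagonal, Pi.sub_apply]
    by_cases hy : y = 0
    · subst hy; simp; ring
    · simp [hy]
  rw [h1, h3, Matrix.mulVec_sub, Pi.sub_apply, Matrix.mulVec_mulVec, walshHadamard_mul_self,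
    Matrix.one_mulVec, Matrix.mulVec_single]
  simp only [Pi.smul_apply, MulOpposite.smul_eq_mul_unop, MulOpposite.unop_op, Matrix.col_apply]
  congr 1
  rw [hH, walshHadamard_apply_zero, Matrix.mulVec, dotProduct]
  simp_rw [walshHadamard_symm 0, walshHadamard_apply_zero, ← Finset.mul_sum]
  have hs : ((√(2 ^ Fintype.card κ) : ℝ) : ℂ) * ((√(2 ^ Fintype.card κ) : ℝ) : ℂ)
      = 2 ^ Fintype.card κ := by
    rw [← Complex.ofReal_mul, Real.mul_self_sqrt (by positivity)]; simp
  have h0 : ((√(2 ^ Fintype.card κ) : ℝ) : ℂ) ≠ 0 := by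
    have : √(2 ^ Fintype.card κ : ℝ) ≠ 0 := by positivity
    exact_mod_cast this
  rw [← hs]
  field_simp

open Classical in
/-- The amplitudes after `m` Grover iterations. -/
def groverAmp (κ : Type) [Fintype κ] (f : Reg κ → Prop) (θ : ℝ) (m : ℕ) (x : Reg κ) : ℝ :=
  if f x then Real.sin ((2 * m + 1) * θ) / (√(2 ^ Fintype.card κ) * Real.sin θ)
  else Real.cos ((2 * m + 1) * θ) / (√(2 ^ Fintype.card κ) * Real.cos θ)

open Classical in
lemma sum_ite_marked (f : Reg κ → Prop) (a b : ℝ) :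
    ∑ x : Reg κ, (if f x then a else b) =
      markedCount f * a + (2 ^ Fintype.card κ - markedCount f) * b := by
  rw [Finset.sum_ite, Finset.sum_const, Finset.sum_const, Finset.filter_not,
    Finset.card_sdiff_of_subset (Finset.filter_subset _ _), Finset.card_univ, card_reg]
  simp only [nsmul_eq_mul]
  have h : Finset.card (Finset.univ.filter f) = markedCount f := rfl
  rw [h, Nat.cast_sub (markedCount_le f)]
  simp

-- In the plane spanned by the uniform superpositions of the marked and of the unmarked states, an
-- iteration is the rotation by `2 * θ`; the induction is the addition theorem. If one class is
-- empty, its formula has denominator zero, but then no `x` uses it.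
open Classical in
lemma grover_amplitude (cm : CostModel) (f : Reg κ → Prop) (g : ℕ) {θ : ℝ}
    (hθ : Real.sin θ ^ 2 = markedCount f / 2 ^ Fintype.card κ) (m : ℕ) (x : Reg κ) :
    (((groverStep κ cm f g).op ^ m).1 * (walshHadamard κ).op.1) x 0 =
      (groverAmp κ f θ m x : ℂ) := by
  set N : ℝ := 2 ^ Fintype.card κ with hN
  have hN0 : 0 < N := by positivity
  have hc : Real.cos θ ^ 2 = (N - markedCount f) / N := by
    rw [Real.cos_sq', hθ]; field_simp
  have hmk : ∀ x, f x → Real.sin θ ≠ 0 := by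
    intro x hx h
    have h1 : 0 < markedCount f := Finset.card_pos.mpr ⟨x, by simp [hx]⟩
    have h2 : (0 : ℝ) < markedCount f := by exact_mod_cast h1
    rw [h] at hθ
    have : 0 < (markedCount f : ℝ) / N := by positivity
    rw [← hθ] at this; simp at this
  have hum : ∀ x, ¬ f x → Real.cos θ ≠ 0 := by
    intro x hx h
    have h1 : markedCount f < 2 ^ Fintype.card κ := by
      rw [← card_reg, ← Finset.card_univ]
      exact Finset.card_lt_card ⟨Finset.filter_subset _ _, fun hs => by
        have := hs (Finset.mem_univ x); simp [hx] at this⟩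
    have h2 : (markedCount f : ℝ) < N := by rw [hN]; exact_mod_cast h1
    rw [h] at hc
    have : 0 < (N - markedCount f) / N := div_pos (by linarith) hN0
    rw [← hc] at this; simp at this
  have hcol : ∀ m, (((groverStep κ cm f g).op ^ m).1 * (walshHadamard κ).op.1) x 0 =
      (((groverStep κ cm f g).op ^ m).1 *ᵥ fun y => (walshHadamard κ).op.1 y 0) x := fun m => rfl
  rw [hcol]
  clear hcol
  induction m generalizing x with
  | zero =>
    rw [pow_zero]
    simp only [OneMemClass.coe_one, Matrix.one_mulVec, walshHadamard_apply_zero, groverAmp]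
    split_ifs with h
    · have := hmk x h
      push_cast
      simp only [mul_zero, zero_add, one_mul]
      have h' : (Complex.sin θ : ℂ) ≠ 0 := by exact_mod_cast this
      field_simp
    · have := hum x h
      push_cast
      simp only [mul_zero, zero_add, one_mul]
      have h' : (Complex.cos θ : ℂ) ≠ 0 := by exact_mod_cast this
      field_simp
  | succ m ih =>
    have e : ((groverStep κ cm f g).op ^ (m + 1)).1
        = (groverStep κ cm f g).op.1 * ((groverStep κ cm f g).op ^ m).1 := by
      rw [pow_succ']; rfl
    rw [e, ← Matrix.mulVec_mulVec, groverStep_mulVec]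
    simp_rw [ih]
    set φ : ℝ := (2 * m + 1) * θ with hφ
    have hφ' : (2 * ((m + 1 : ℕ) : ℝ) + 1) * θ = φ + 2 * θ := by push_cast; ring
    -- The two classes have `N sin² θ` and `N cos² θ` elements, so one factor cancels against the
    -- denominator of the amplitude. A class with vanishing sine or cosine contributes zero on both
    -- sides.
    have hsum : ∑ y, (if f y then (-1 : ℂ) else 1) * (groverAmp κ f θ m y : ℂ) =
        ((√N * (-Real.sin θ * Real.sin φ + Real.cos θ * Real.cos φ) : ℝ) : ℂ) := by
      have h1 : ∀ y, (if f y then (-1 : ℂ) else 1) * (groverAmp κ f θ m y : ℂ) =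
        ((if f y then -(Real.sin φ / (√N * Real.sin θ)) else Real.cos φ / (√N * Real.cos θ) : ℝ) : ℂ) := by
        intro y
        unfold groverAmp
        rw [← hφ, ← hN]
        split_ifs <;> push_cast <;> ring
      rw [Finset.sum_congr rfl fun y _ => h1 y, ← Complex.ofReal_sum, sum_ite_marked]
      congr 1
      have e1 : (markedCount f : ℝ) = N * Real.sin θ ^ 2 := by rw [hθ]; field_simp
      have e2 : (N - markedCount f : ℝ) = N * Real.cos θ ^ 2 := by rw [hc]; field_simp
      rw [← hN, e2, e1]
      obtain ⟨R, hR⟩ : ∃ R, R = √N := ⟨_, rfl⟩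
      have e3 : N = R * R := by rw [hR]; exact (Real.mul_self_sqrt hN0.le).symm
      have e4 : R ≠ 0 := by rw [hR]; positivity
      rw [← hR, e3]
      by_cases hs : Real.sin θ = 0 <;> by_cases hcs : Real.cos θ = 0
      · simp [hs, hcs]
      · rw [hs]; field_simp
      · rw [hcs]; field_simp
      · field_simp
    have hreal : 2 / N * (√N * (-Real.sin θ * Real.sin φ + Real.cos θ * Real.cos φ)) -
        (if f x then (-1 : ℝ) else 1) * groverAmp κ f θ m x = groverAmp κ f θ (m + 1) x := by
      unfold groverAmp
      rw [hφ', ← hφ, ← hN]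
      obtain ⟨R, hR⟩ : ∃ R, R = √N := ⟨_, rfl⟩
      have e3 : N = R * R := by rw [hR]; exact (Real.mul_self_sqrt hN0.le).symm
      have e4 : R ≠ 0 := by rw [hR]; positivity
      rw [← hR, e3]
      split_ifs with h
      · have hs := hmk x h
        rw [Real.sin_add, Real.sin_two_mul, Real.cos_two_mul]
        have h1 : Real.cos θ ^ 2 = 1 - Real.sin θ ^ 2 := Real.cos_sq' θ
        field_simp
        rw [h1]
        ring
      · have hs := hum x h
        rw [Real.cos_add, Real.sin_two_mul, Real.cos_two_mul]
        field_simp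
        ring
    rw [hsum, ← hreal]
    push_cast
    congr 1
    · rw [hN]; push_cast; rfl
    · split_ifs <;> simp

/-- The angle whose squared sine is the fraction of marked states. -/
def groverAngle (f : Reg κ → Prop) : ℝ := Real.arcsin √(markedCount f / 2 ^ Fintype.card κ)

lemma marked_frac_le_one (f : Reg κ → Prop) :
    (markedCount f : ℝ) / 2 ^ Fintype.card κ ≤ 1 := by
  rw [div_le_one (by positivity)]
  exact_mod_cast markedCount_le f

lemma sin_groverAngle (f : Reg κ → Prop) :
    Real.sin (groverAngle f) = √(markedCount f / 2 ^ Fintype.card κ) :=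
  Real.sin_arcsin (by linarith [Real.sqrt_nonneg ((markedCount f : ℝ) / 2 ^ Fintype.card κ)])
    (Real.sqrt_le_one.mpr (marked_frac_le_one f))

lemma sin_sq_groverAngle (f : Reg κ → Prop) :
    Real.sin (groverAngle f) ^ 2 = markedCount f / 2 ^ Fintype.card κ := by
  rw [sin_groverAngle, Real.sq_sqrt (by positivity)]

lemma groverAngle_nonneg (f : Reg κ → Prop) : 0 ≤ groverAngle f :=
  Real.arcsin_nonneg.mpr (Real.sqrt_nonneg _)

lemma groverAngle_le (f : Reg κ → Prop) : groverAngle f ≤ Real.pi / 2 := Real.arcsin_le_pi_div_two _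

/-- The cost of `m` Grover iterations. -/
def groverGates (κ : Type) [Fintype κ] (cm : CostModel) (g m : ℕ) : ℕ :=
  m * (Fintype.card κ + (cm.gate * Fintype.card κ + (Fintype.card κ + g))) + Fintype.card κ

open Classical in
/-- The distribution of the outcome after `m` Grover iterations. -/
lemma loss_groverSample (cm : CostModel) (f : Reg κ → Prop) (g m b : ℕ)
    (Θ : Reg κ → ℕ → ℝ≥0∞) :
    Timed.loss (groverSample κ cm f g m) b Θ =
      if groverGates κ cm g m ≤ b then
        ∑ x, ENNReal.ofReal (groverAmp κ f (groverAngle f) m x ^ 2) *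
          Θ x (b - groverGates κ cm g m)
      else 1 := by
  unfold groverSample Circuit.run
  rw [Timed.loss_bind, Timed.loss_tick]
  have hg : ((groverStep κ cm f g).iterate m * walshHadamard κ).gates = groverGates κ cm g m := rfl
  rw [hg]
  split_ifs with h
  · rw [Timed.loss_sample, expect_fintype]
    refine Finset.sum_congr rfl fun x _ => ?_
    congr 1
    unfold measure
    rw [PMF.ofFintype_apply]
    congr 1
    have := grover_amplitude cm f g (sin_sq_groverAngle f) m x
    have h2 : ((groverStep κ cm f g).iterate m * walshHadamard κ).op.1 x 0 =
      (groverAmp κ f (groverAngle f) m x : ℂ) := this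
    rw [h2, Complex.norm_real, Real.norm_eq_abs, sq_abs]
  · rfl

open Classical in
/-- The expectation of a function that is `u` on average over the marked states and `v` on the
others. -/
lemma sum_groverAmp_sq (f : Reg κ → Prop) (m : ℕ) (h : Reg κ → ℝ) (v : ℝ)
    (hv : ∀ x, ¬ f x → h x = v) :
    ∑ x, groverAmp κ f (groverAngle f) m x ^ 2 * h x =
      Real.sin ((2 * m + 1) * groverAngle f) ^ 2 *
        ((∑ x ∈ Finset.univ.filter f, h x) / markedCount f) +
      Real.cos ((2 * m + 1) * groverAngle f) ^ 2 * v := by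
  set θ := groverAngle f
  set N : ℝ := 2 ^ Fintype.card κ with hN
  have hN0 : 0 < N := by positivity
  have hθ : Real.sin θ ^ 2 = markedCount f / N := sin_sq_groverAngle f
  have hc : Real.cos θ ^ 2 = (N - markedCount f) / N := by
    rw [Real.cos_sq', hθ]; field_simp
  rw [← Finset.sum_filter_add_sum_filter_not Finset.univ f]
  congr 1
  · rw [Finset.sum_div, Finset.mul_sum]
    refine Finset.sum_congr rfl fun x hx => ?_
    have hx' : f x := by simpa using hx
    have h1 : (0 : ℝ) < markedCount f := by exact_mod_cast Finset.card_pos.mpr ⟨x, hx⟩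
    unfold groverAmp
    rw [if_pos hx', div_pow, mul_pow, hθ, Real.sq_sqrt hN0.le]
    field_simp
  · have h2 : ∀ x ∈ Finset.univ.filter (fun x => ¬ f x),
        groverAmp κ f θ m x ^ 2 * h x =
          Real.cos ((2 * m + 1) * θ) ^ 2 / (N - markedCount f) * v := by
      intro x hx
      have hx' : ¬ f x := by simpa using hx
      unfold groverAmp
      rw [if_neg hx', div_pow, mul_pow, hc, Real.sq_sqrt hN0.le, hv x hx']
      congr 2
      field_simp
    rw [Finset.sum_congr rfl h2, Finset.sum_const, Finset.filter_not,
      Finset.card_sdiff_of_subset (Finset.filter_subset _ _), Finset.card_univ, card_reg]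
    simp only [nsmul_eq_mul]
    have h5 : Finset.card (Finset.univ.filter f) = markedCount f := rfl
    rw [h5, Nat.cast_sub (markedCount_le f)]
    push_cast
    rw [← hN]
    -- If every state is marked, the sum over the unmarked ones is empty and the coefficient of `v`
    -- has to vanish as well. Indeed `cos θ = 0` forces the cosine of every odd multiple of `θ` to
    -- be zero.
    by_cases h3 : N - markedCount f = 0
    · rw [h3] at hc
      have h4 : Real.cos θ = 0 := by simpa using hc
      rw [h3]
      have h5 : Real.cos ((2 * m + 1) * θ) = 0 := by
        have : (2 * (m : ℝ) + 1) * θ = θ + m * (2 * θ) := by ring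
        have hs2 : Real.sin (2 * θ) = 0 := by rw [Real.sin_two_mul, h4]; ring
        rw [this, Real.cos_add, h4]
        have : ∀ m : ℕ, Real.sin (m * (2 * θ)) = 0 := by
          intro m
          induction m with
          | zero => simp
          | succ m ih => push_cast; rw [add_mul, one_mul, Real.sin_add, ih, hs2]; ring
        rw [this]; ring
      rw [h5]; ring
    · field_simp

end Grover

/-! ### Tails of the Fejér kernel -/

/-- Comparison with a telescoping sum: `1 / u ^ 2 ≤ 1 / (u - 1) - 1 / u` for `u > 1`. Clamping `u`
at `K` in `G` makes the differences below the cutoff nonnegative. -/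
lemma sum_inv_sq_tail_le (P : ℕ) (x : ℝ) {K : ℝ} (hK : 1 < K) :
    ∑ y ∈ Finset.range P, (if K ≤ y - x then 1 / ((y : ℝ) - x) ^ 2 else 0) ≤ 1 / (K - 1) := by
  set G : ℕ → ℝ := fun y => 1 / (max ((y : ℝ) - x) K - 1) with hG
  have hpos : ∀ y : ℕ, 0 < max ((y : ℝ) - x) K - 1 := fun y => by
    have := le_max_right ((y : ℝ) - x) K; linarith
  have hle : ∀ y ∈ Finset.range P, (if K ≤ (y : ℝ) - x then 1 / ((y : ℝ) - x) ^ 2 else 0) ≤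
      G y - G (y + 1) := by
    intro y _
    split_ifs with h
    · have e1 : max ((y : ℝ) - x) K = y - x := max_eq_left h
      have e2 : max (((y + 1 : ℕ) : ℝ) - x) K = y - x + 1 := by
        push_cast
        rw [max_eq_left (by linarith)]; ring
      simp only [hG, e1, e2]
      set u : ℝ := y - x
      have h1 : 0 < u - 1 := by linarith
      have h2 : 0 < u := by linarith
      rw [show u + 1 - 1 = u by ring, div_sub_div _ _ h1.ne' h2.ne']
      rw [show 1 * u - (u - 1) * 1 = 1 by ring]
      apply one_div_le_one_div_of_le (by positivity)
      nlinarith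
    · rw [sub_nonneg]
      apply one_div_le_one_div_of_le (hpos y)
      have : max ((y : ℝ) - x) K ≤ max (((y + 1 : ℕ) : ℝ) - x) K := by
        apply max_le_max _ le_rfl
        push_cast; linarith
      linarith
  refine (Finset.sum_le_sum hle).trans ?_
  rw [Finset.sum_range_sub']
  have h0 : G 0 ≤ 1 / (K - 1) := by
    apply one_div_le_one_div_of_le (by linarith)
    have := le_max_right (((0 : ℕ) : ℝ) - x) K; linarith
  have h1 : 0 ≤ G P := one_div_nonneg.mpr (hpos P).le
  linarith

lemma sum_inv_sq_tail_le' (P : ℕ) (x : ℝ) {K : ℝ} (hK : 1 < K) :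
    ∑ y ∈ Finset.range P, (if K ≤ x - y then 1 / (x - (y : ℝ)) ^ 2 else 0) ≤ 1 / (K - 1) := by
  rw [← Finset.sum_range_reflect]
  refine le_trans (le_of_eq (Finset.sum_congr rfl fun y hy => ?_))
    (sum_inv_sq_tail_le P (P - 1 - x) hK)
  have hy' : y < P := Finset.mem_range.mp hy
  have e : x - ((P - 1 - y : ℕ) : ℝ) = y - (P - 1 - x) := by
    rw [Nat.sub_sub, Nat.cast_sub (by omega)]; push_cast; ring
  rw [e]

/-- The sine has period `P` in `y` up to sign, so `y` is compared with `x = P θ / π` or with `x +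
P`, whichever is at distance `|u| ≤ P / 2`. There the sine is at least `2 |u| / P`, so a term is at
most `1 / (4 u ^ 2)`, and it is at most `π |u| / P`, so only `|u| ≥ K` contributes. The four
one-sided tails compensate the factor `1 / 4`. -/
lemma sum_fejer_tail_le {P : ℕ} (hP : 0 < P) {θ : ℝ} (h1 : -(Real.pi / 2) ≤ θ)
    (h2 : θ ≤ Real.pi / 2) {K : ℝ} (hK : 1 < K) :
    ∑ y ∈ Finset.range P, (if Real.pi * K / P < |Real.sin (θ - Real.pi * y / P)| then
      1 / ((P : ℝ) ^ 2 * Real.sin (θ - Real.pi * y / P) ^ 2) else 0) ≤ 1 / (K - 1) := by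
  have hpi := Real.pi_pos
  have hP' : (0 : ℝ) < P := by exact_mod_cast hP
  set x : ℝ := P * θ / Real.pi with hx
  have hx1 : -(P / 2) ≤ x := by
    rw [hx, le_div_iff₀ hpi]; nlinarith
  have hx2 : x ≤ P / 2 := by
    rw [hx, div_le_iff₀ hpi]; nlinarith
  set h : ℝ → ℝ := fun u => if K ≤ u then 1 / u ^ 2 else 0 with hh
  have hnn : ∀ u, 0 ≤ h u := fun u => by simp only [hh]; split_ifs <;> positivity
  have core : ∀ u : ℝ, |u| ≤ P / 2 → Real.pi * K / P < |Real.sin (Real.pi * u / P)| →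
      1 / ((P : ℝ) ^ 2 * Real.sin (Real.pi * u / P) ^ 2) ≤ 1 / 4 * (h u + h (-u)) := by
    intro u hu hs
    have e1 : |Real.pi * u / P| = Real.pi * |u| / P := by
      rw [abs_div, abs_mul, abs_of_pos hpi, abs_of_pos hP']
    have h3 : |Real.sin (Real.pi * u / P)| ≤ Real.pi * |u| / P := by
      rw [← e1]; exact Real.abs_sin_le_abs
    have hKu : K ≤ |u| := by
      have := hs.trans_le h3
      rw [div_lt_div_iff_of_pos_right hP'] at this
      exact (lt_of_mul_lt_mul_left this hpi.le).le
    have h4 : 2 * |u| / P ≤ |Real.sin (Real.pi * u / P)| := by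
      have : |Real.pi * u / P| ≤ Real.pi / 2 := by
        rw [e1, div_le_iff₀ hP']; nlinarith
      have := Real.mul_abs_le_abs_sin this
      rw [e1] at this
      refine le_trans (le_of_eq ?_) this
      field_simp
    have hu0 : 0 < |u| := by linarith
    have h5 : 4 * u ^ 2 ≤ (P : ℝ) ^ 2 * Real.sin (Real.pi * u / P) ^ 2 := by
      rw [div_le_iff₀ hP'] at h4
      rw [← sq_abs u, ← sq_abs (Real.sin _)]
      nlinarith [abs_nonneg (Real.sin (Real.pi * u / P))]
    have h6 : 1 / u ^ 2 ≤ h u + h (-u) := by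
      rcases le_total 0 u with hu' | hu'
      · rw [abs_of_nonneg hu'] at hKu
        have : h u = 1 / u ^ 2 := by simp only [hh]; rw [if_pos hKu]
        linarith [hnn (-u)]
      · rw [abs_of_nonpos hu'] at hKu
        have : h (-u) = 1 / u ^ 2 := by simp only [hh]; rw [if_pos hKu]; simp
        linarith [hnn u]
    have hu2 : 0 < u ^ 2 := by rw [← sq_abs]; positivity
    calc _ ≤ 1 / (4 * u ^ 2) := one_div_le_one_div_of_le (by positivity) h5
      _ = 1 / 4 * (1 / u ^ 2) := by field_simp
      _ ≤ _ := by gcongr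
  have hle : ∀ y ∈ Finset.range P, (if Real.pi * K / P < |Real.sin (θ - Real.pi * y / P)| then
      1 / ((P : ℝ) ^ 2 * Real.sin (θ - Real.pi * y / P) ^ 2) else 0) ≤
      1 / 4 * ((h (y - x) + h (x - y)) + (h (y - (x + P)) + h (x + P - y))) := by
    intro y hy
    have hy' : (y : ℝ) ≤ P := by exact_mod_cast (Finset.mem_range.mp hy).le
    have hy0 : (0 : ℝ) ≤ y := by positivity
    have hang : θ - Real.pi * y / P = Real.pi * (x - y) / P := by
      rw [hx]; field_simp
    rw [hang]
    split_ifs with hs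
    · by_cases hc : (y : ℝ) - x ≤ P / 2
      · have := core (x - y) (abs_le.mpr ⟨by linarith, by linarith⟩) hs
        rw [neg_sub] at this
        linarith [hnn (y - (x + P)), hnn (x + P - y)]
      · push Not at hc
        have e : Real.sin (Real.pi * (x - y) / P) = -Real.sin (Real.pi * (x + P - y) / P) := by
          have : Real.pi * (x - y) / P = Real.pi * (x + P - y) / P - Real.pi := by
            field_simp; ring
          rw [this, Real.sin_sub_pi]
        rw [e, abs_neg] at hs
        rw [e, neg_sq]
        have := core (x + P - y) (abs_le.mpr ⟨by linarith, by linarith⟩) hs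
        rw [neg_sub] at this
        linarith [hnn (y - x), hnn (x - y)]
    · have := hnn (y - x); have := hnn (x - y); have := hnn (y - (x + P))
      have := hnn (x + P - y)
      positivity
  refine (Finset.sum_le_sum hle).trans ?_
  rw [← Finset.mul_sum, Finset.sum_add_distrib, Finset.sum_add_distrib, Finset.sum_add_distrib]
  have a1 := sum_inv_sq_tail_le P x hK
  have a2 := sum_inv_sq_tail_le' P x hK
  have a3 := sum_inv_sq_tail_le P (x + P) hK
  have a4 := sum_inv_sq_tail_le' P (x + P) hK
  simp only [hh]
  linarith

/-! ### Phase estimation -/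

/-- The amplitude of the outcome `y` of phase estimation for an eigenvalue `exp (2 i θ)`. -/
def phaseAmp (p : ℕ) (θ : ℝ) (y : ℕ) : ℂ :=
  (∑ z ∈ Finset.range (2 ^ p), Complex.exp (-(2 * Real.pi * Complex.I * y * z / (2 ^ p : ℕ))) *
    Complex.exp (Complex.I * ((2 * z + 1) * θ))) / (2 ^ p : ℕ)

/-- The amplitude is a geometric sum with ratio `w` on the unit circle; its numerator is at most `2`
in norm and `‖w - 1‖` is twice the absolute value of the sine. -/
lemma norm_phaseAmp_sq_le (p : ℕ) (θ : ℝ) (y : ℕ)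
    (hs : Real.sin (θ - Real.pi * y / (2 ^ p : ℕ)) ≠ 0) :
    ‖phaseAmp p θ y‖ ^ 2 ≤
      1 / (((2 ^ p : ℕ) : ℝ) ^ 2 * Real.sin (θ - Real.pi * y / (2 ^ p : ℕ)) ^ 2) := by
  set P : ℕ := 2 ^ p with hP
  have hP0 : (0 : ℝ) < P := by rw [hP]; positivity
  set a : ℝ := 2 * (θ - Real.pi * y / P) with ha
  set w : ℂ := Complex.exp (Complex.I * (a : ℝ)) with hw
  have hPc : (P : ℂ) ≠ 0 := by exact_mod_cast hP0.ne'
  have hterm : ∀ z ∈ Finset.range P, Complex.exp (-(2 * Real.pi * Complex.I * y * z / (P : ℕ))) *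
      Complex.exp (Complex.I * ((2 * z + 1) * θ)) = Complex.exp (Complex.I * θ) * w ^ z := by
    intro z _
    rw [hw, ← Complex.exp_nat_mul, ← Complex.exp_add, ← Complex.exp_add]
    congr 1
    rw [ha]
    push_cast
    field_simp
    ring
  have hw1 : ‖w - 1‖ = 2 * |Real.sin (θ - Real.pi * y / P)| := by
    rw [hw, Complex.norm_exp_I_mul_ofReal_sub_one, Real.norm_eq_abs, abs_mul]
    rw [ha, mul_div_cancel_left₀ _ (by norm_num : (2 : ℝ) ≠ 0)]
    norm_num
  have hsabs : 0 < |Real.sin (θ - Real.pi * y / P)| := abs_pos.mpr hs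
  have hwne : w ≠ 1 := by
    intro h
    rw [h, sub_self, norm_zero] at hw1
    linarith
  have hwn : ‖w‖ = 1 := by rw [hw, mul_comm, Complex.norm_exp_ofReal_mul_I]
  have hsum : ‖∑ z ∈ Finset.range P, w ^ z‖ ≤ 1 / |Real.sin (θ - Real.pi * y / P)| := by
    rw [geom_sum_eq hwne, norm_div, hw1]
    rw [div_le_div_iff₀ (by positivity) hsabs]
    have : ‖w ^ P - 1‖ ≤ 2 := by
      calc ‖w ^ P - 1‖ ≤ ‖w ^ P‖ + ‖(1 : ℂ)‖ := norm_sub_le _ _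
        _ = 2 := by rw [norm_pow, hwn]; norm_num
    nlinarith
  unfold phaseAmp
  rw [Finset.sum_congr rfl hterm, ← Finset.mul_sum, norm_div, norm_mul,
    mul_comm Complex.I, Complex.norm_exp_ofReal_mul_I, one_mul, Complex.norm_natCast]
  rw [div_pow, ← sq_abs (Real.sin _), div_le_div_iff₀ (by positivity) (by positivity)]
  have h2 : ‖∑ z ∈ Finset.range P, w ^ z‖ * |Real.sin (θ - Real.pi * y / P)| ≤ 1 := by
    rwa [le_div_iff₀ hsabs] at hsum
  have h3 : (‖∑ z ∈ Finset.range P, w ^ z‖ * |Real.sin (θ - Real.pi * y / P)|) ^ 2 ≤ 1 :=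
    pow_le_one₀ (by positivity) h2
  nlinarith [sq_nonneg (P : ℝ)]

lemma sum_reg (p : ℕ) {M : Type} [AddCommMonoid M] (F : ℕ → M) :
    ∑ y : Reg (Fin p), F (regVal y) = ∑ j ∈ Finset.range (2 ^ p), F j := by
  rw [Finset.sum_range]
  exact Fintype.sum_equiv finFunctionFinEquiv _ _ fun y => rfl

section Phase
variable {κ : Type} [Fintype κ] [DecidableEq κ]

/-- The circuit of phase estimation. -/
def phaseCircuit (cm : CostModel) (f : Reg κ → Prop) (g p : ℕ) : Circuit (Reg κ × Reg (Fin p)) :=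
  Circuit.tensor ⟨1, 0⟩ (inverseFourier cm p) *
    (controlledPowers κ cm (groverStep κ cm f g) p *
      Circuit.tensor (walshHadamard κ) (walshHadamard (Fin p)))

/-- The controlled powers attach to the control value `z` the state after `z` Grover iterations, so
measuring the control register sees the discrete Fourier transform in `z` of the Grover amplitudes.
-/
lemma phaseCircuit_apply (cm : CostModel) (f : Reg κ → Prop) (g p : ℕ) (x : Reg κ)
    (y : Reg (Fin p)) :
    (phaseCircuit cm f g p).op.1 (x, y) (0, 0) =
      (∑ z ∈ Finset.range (2 ^ p),
        Complex.exp (-(2 * Real.pi * Complex.I * regVal y * z / (2 ^ p : ℕ))) *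
          (groverAmp κ f (groverAngle f) z x : ℂ)) / (2 ^ p : ℕ) := by
  have h1 : (phaseCircuit cm f g p).op.1 =
    Matrix.kronecker (1 : Matrix (Reg κ) (Reg κ) ℂ) (Matrix.of (fourierEntry p)) *
      ((Matrix.blockDiagonal fun y => ((groverStep κ cm f g).op ^ regVal y).1) *
        Matrix.kronecker (walshHadamard κ).op.1 (walshHadamard (Fin p)).op.1) := rfl
  have hs : ((√(2 ^ p : ℕ) : ℝ) : ℂ) * ((√(2 ^ p : ℕ) : ℝ) : ℂ) = (2 ^ p : ℕ) := by
    rw [← Complex.ofReal_mul, Real.mul_self_sqrt (by positivity)]; simp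
  have hs0 : ((√(2 ^ p : ℕ) : ℝ) : ℂ) ≠ 0 := by
    have : √((2 ^ p : ℕ) : ℝ) ≠ 0 := by positivity
    exact_mod_cast this
  have h2 : ∀ z : Reg (Fin p),
      ((Matrix.blockDiagonal fun y => ((groverStep κ cm f g).op ^ regVal y).1) *
        Matrix.kronecker (walshHadamard κ).op.1 (walshHadamard (Fin p)).op.1 :
          Matrix (Reg κ × Reg (Fin p)) (Reg κ × Reg (Fin p)) ℂ) (x, z) (0, 0) =
      (groverAmp κ f (groverAngle f) (regVal z) x : ℂ) / ((√(2 ^ p : ℕ) : ℝ) : ℂ) := by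
    intro z
    rw [Matrix.mul_apply, Fintype.sum_prod_type]
    simp only [Matrix.blockDiagonal_apply, Matrix.kronecker, Matrix.kroneckerMap_apply, ite_mul,
      zero_mul, Finset.sum_ite_eq, Finset.mem_univ, if_true]
    rw [← grover_amplitude cm f g (sin_sq_groverAngle f), Matrix.mul_apply, Finset.sum_div]
    refine Finset.sum_congr rfl fun x' _ => ?_
    rw [walshHadamard_apply_zero z]
    simp only [Fintype.card_fin]
    push_cast
    ring
  rw [h1, Matrix.mul_apply, Fintype.sum_prod_type]
  simp only [Matrix.kronecker, Matrix.kroneckerMap_apply, Matrix.one_apply, ite_mul, one_mul,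
    zero_mul, Finset.sum_ite_irrel, Finset.sum_const_zero, Finset.sum_ite_eq, Finset.mem_univ,
    if_true]
  simp only [Matrix.kronecker] at h2
  simp only [h2, Matrix.of_apply, fourierEntry]
  rw [← sum_reg p (fun z => Complex.exp (-(2 * Real.pi * Complex.I * regVal y * z / (2 ^ p : ℕ))) *
          (groverAmp κ f (groverAngle f) z x : ℂ)), Finset.sum_div]
  refine Finset.sum_congr rfl fun z _ => ?_
  rw [← hs]
  field_simp

-- Sine and cosine of `(2 z + 1) θ` are half the difference and half the sum of two exponentials.
-- Hence the marked amplitudes are proportional to `u - v` and the unmarked ones to `u + v`, and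
-- summing over `x` leaves the parallelogram law. It is only an inequality because one of the two
-- classes may be empty.
open Classical in
lemma sum_norm_phaseCircuit_le (cm : CostModel) (f : Reg κ → Prop) (g p : ℕ) (y : Reg (Fin p)) :
    ∑ x, ‖(phaseCircuit cm f g p).op.1 (x, y) (0, 0)‖ ^ 2 ≤
      (‖phaseAmp p (groverAngle f) (regVal y)‖ ^ 2 +
        ‖phaseAmp p (-groverAngle f) (regVal y)‖ ^ 2) / 2 := by
  set θ := groverAngle f
  set N : ℝ := 2 ^ Fintype.card κ with hN
  have hN0 : 0 < N := by positivity
  set u := phaseAmp p θ (regVal y) with hu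
  set v := phaseAmp p (-θ) (regVal y) with hv
  have hθ : Real.sin θ ^ 2 = markedCount f / N := sin_sq_groverAngle f
  have hc : Real.cos θ ^ 2 = (N - markedCount f) / N := by
    rw [Real.cos_sq', hθ]; field_simp
  have hamp : ∀ x, ‖(phaseCircuit cm f g p).op.1 (x, y) (0, 0)‖ ^ 2 =
      if f x then ‖u - v‖ ^ 2 / 4 / (N * Real.sin θ ^ 2)
      else ‖u + v‖ ^ 2 / 4 / (N * Real.cos θ ^ 2) := by
    intro x
    rw [phaseCircuit_apply]
    have hexp : ∀ z : ℕ, Complex.exp (Complex.I * ((2 * z + 1) * (θ : ℂ))) =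
        Complex.cos ((2 * z + 1) * θ) + Complex.sin ((2 * z + 1) * θ) * Complex.I := by
      intro z
      rw [mul_comm, Complex.exp_mul_I]
    have hexp' : ∀ z : ℕ, Complex.exp (Complex.I * ((2 * z + 1) * ((-θ : ℝ) : ℂ))) =
        Complex.cos ((2 * z + 1) * θ) - Complex.sin ((2 * z + 1) * θ) * Complex.I := by
      intro z
      rw [mul_comm, Complex.exp_mul_I]
      push_cast
      rw [mul_neg, Complex.cos_neg, Complex.sin_neg]
      ring
    split_ifs with h
    · have e : (∑ z ∈ Finset.range (2 ^ p),
          Complex.exp (-(2 * Real.pi * Complex.I * regVal y * z / (2 ^ p : ℕ))) *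
          (groverAmp κ f θ z x : ℂ)) / (2 ^ p : ℕ) =
          (u - v) / (2 * Complex.I * ((√N * Real.sin θ : ℝ) : ℂ)) := by
        rw [hu, hv]
        unfold phaseAmp
        rw [← sub_div, ← Finset.sum_sub_distrib, div_div, mul_comm (((2 ^ p : ℕ)) : ℂ),
          ← div_div]
        congr 1
        rw [Finset.sum_div]
        refine Finset.sum_congr rfl fun z _ => ?_
        rw [hexp, hexp']
        simp only [groverAmp, if_pos h]
        rw [← hN]
        generalize Complex.exp _ = E
        push_cast
        rw [← mul_sub, mul_div_assoc E]
        congr 1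
        rw [show (Complex.cos ((2 * z + 1) * θ) + Complex.sin ((2 * z + 1) * θ) * Complex.I -
          (Complex.cos ((2 * z + 1) * θ) - Complex.sin ((2 * z + 1) * θ) * Complex.I)) =
          (2 * Complex.I) * Complex.sin ((2 * z + 1) * θ) by ring]
        rw [mul_div_mul_left _ _ (by simp)]
      rw [e, norm_div, norm_mul, norm_mul, Complex.norm_I, Complex.norm_real, Real.norm_eq_abs,
        div_pow, mul_pow, sq_abs, mul_pow √N, Real.sq_sqrt hN0.le, div_div]
      norm_num
    · have e : (∑ z ∈ Finset.range (2 ^ p),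
          Complex.exp (-(2 * Real.pi * Complex.I * regVal y * z / (2 ^ p : ℕ))) *
          (groverAmp κ f θ z x : ℂ)) / (2 ^ p : ℕ) =
          (u + v) / (2 * ((√N * Real.cos θ : ℝ) : ℂ)) := by
        rw [hu, hv]
        unfold phaseAmp
        rw [← add_div, ← Finset.sum_add_distrib, div_div, mul_comm (((2 ^ p : ℕ)) : ℂ),
          ← div_div]
        congr 1
        rw [Finset.sum_div]
        refine Finset.sum_congr rfl fun z _ => ?_
        rw [hexp, hexp']
        simp only [groverAmp, if_neg h]
        rw [← hN]
        generalize Complex.exp _ = E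
        push_cast
        rw [← mul_add, mul_div_assoc E]
        congr 1
        rw [show (Complex.cos ((2 * z + 1) * θ) + Complex.sin ((2 * z + 1) * θ) * Complex.I +
          (Complex.cos ((2 * z + 1) * θ) - Complex.sin ((2 * z + 1) * θ) * Complex.I)) =
          2 * Complex.cos ((2 * z + 1) * θ) by ring]
        rw [mul_div_mul_left _ _ (by simp)]
      rw [e, norm_div, norm_mul, Complex.norm_real, Real.norm_eq_abs,
        div_pow, mul_pow, sq_abs, mul_pow √N, Real.sq_sqrt hN0.le, div_div]
      norm_num
  rw [Finset.sum_congr rfl fun x _ => hamp x, sum_ite_marked, ← hN]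
  have e1 : (markedCount f : ℝ) = N * Real.sin θ ^ 2 := by rw [hθ]; field_simp
  have e2 : (N - markedCount f : ℝ) = N * Real.cos θ ^ 2 := by rw [hc]; field_simp
  rw [e2, e1]
  have gen : ∀ a b : ℝ, 0 ≤ b → a * (b / a) ≤ b := by
    intro a b hb
    by_cases ha : a = 0
    · simp [ha, hb]
    · rw [mul_div_cancel₀ _ ha]
  have g1 := gen (N * Real.sin θ ^ 2) (‖u - v‖ ^ 2 / 4) (by positivity)
  have g2 := gen (N * Real.cos θ ^ 2) (‖u + v‖ ^ 2 / 4) (by positivity)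
  have g3 := parallelogram_law_with_norm ℝ u v
  nlinarith

/-- Based on `sin² a - sin² b = sin (a - b) * sin (a + b)`. Writing `a + b` as `(a - b) + 2 b`
bounds the second factor by `ε + 2 |sin b|`. The sign `s` covers the eigenphases `θ` and `-θ`, which
stand for the same count. -/
lemma abs_countEstimate_sub_le (f : Reg κ → Prop) (p y : ℕ) {ε : ℝ} (s : ℝ) (hs : s = 1 ∨ s = -1)
    (h : |Real.sin (s * groverAngle f - Real.pi * y / (2 ^ p : ℕ))| ≤ ε) :
    |countEstimate κ p y - markedCount f| ≤
      2 ^ Fintype.card κ * ε ^ 2 + 2 * ε * √(2 ^ Fintype.card κ * markedCount f) := by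
  set θ := groverAngle f
  set N : ℝ := 2 ^ Fintype.card κ with hN
  have hN0 : 0 < N := by positivity
  have hε : 0 ≤ ε := (abs_nonneg _).trans h
  set a : ℝ := Real.pi * y / (2 ^ p : ℕ) with ha
  have hθ : Real.sin θ = √(markedCount f / N) := sin_groverAngle f
  have hθ2 : Real.sin (s * θ) ^ 2 = markedCount f / N := by
    rw [← sin_sq_groverAngle f]
    rcases hs with rfl | rfl <;> simp [θ]
  have hab : |Real.sin (s * θ)| = √(markedCount f / N) := by
    rw [← Real.sqrt_sq_eq_abs, hθ2]
  have e1 : countEstimate κ p y - markedCount f = N * (Real.sin a ^ 2 - Real.sin (s * θ) ^ 2) := by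
    rw [hθ2]
    unfold countEstimate
    rw [ha, ← hN]
    push_cast
    field_simp
  have e2 : Real.sin a ^ 2 - Real.sin (s * θ) ^ 2 =
      -(Real.sin (s * θ - a) * (Real.sin (a - s * θ) * Real.cos (2 * (s * θ)) +
        Real.cos (a - s * θ) * Real.sin (2 * (s * θ)))) := by
    rw [← Real.sin_add, show a - s * θ + 2 * (s * θ) = s * θ + a by ring]
    rw [Real.sin_sub, Real.sin_add]
    have h1 := Real.sin_sq_add_cos_sq a
    have h2 := Real.sin_sq_add_cos_sq (s * θ)
    have h3 : Real.cos a ^ 2 = 1 - Real.sin a ^ 2 := by linarith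
    have h4 : Real.cos (s * θ) ^ 2 = 1 - Real.sin (s * θ) ^ 2 := by linarith
    linear_combination Real.sin (s * θ) ^ 2 * h3 - Real.sin a ^ 2 * h4
  have e3 : |Real.sin (a - s * θ) * Real.cos (2 * (s * θ)) +
        Real.cos (a - s * θ) * Real.sin (2 * (s * θ))| ≤ ε + 2 * √(markedCount f / N) := by
    refine (abs_add_le _ _).trans ?_
    rw [abs_mul, abs_mul]
    have b1 : |Real.sin (a - s * θ)| ≤ ε := by
      rw [← abs_neg, ← Real.sin_neg, neg_sub]; exact h
    have b2 : |Real.cos (2 * (s * θ))| ≤ 1 := Real.abs_cos_le_one _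
    have b3 : |Real.cos (a - s * θ)| ≤ 1 := Real.abs_cos_le_one _
    have b4 : |Real.sin (2 * (s * θ))| ≤ 2 * √(markedCount f / N) := by
      rw [Real.sin_two_mul, abs_mul, abs_mul, hab, abs_of_pos (by norm_num : (0 : ℝ) < 2)]
      have : |Real.cos (s * θ)| ≤ 1 := Real.abs_cos_le_one _
      nlinarith [Real.sqrt_nonneg ((markedCount f : ℝ) / N)]
    have c1 := mul_le_mul b1 b2 (abs_nonneg _) hε
    have c2 := mul_le_mul b3 b4 (abs_nonneg _) zero_le_one
    linarith
  have e4 : N * √(markedCount f / N) = √(N * markedCount f) := by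
    rw [Real.sqrt_div (by positivity), Real.sqrt_mul hN0.le, mul_div_assoc', div_eq_iff (by positivity)]
    have := Real.mul_self_sqrt hN0.le
    linear_combination (-√(markedCount f : ℝ)) * this
  rw [e1, abs_mul, abs_of_pos hN0, e2, abs_neg, abs_mul]
  calc N * (|Real.sin (s * θ - a)| * _) ≤ N * (ε * (ε + 2 * √(markedCount f / N))) := by gcongr
    _ = N * ε ^ 2 + 2 * ε * (N * √(markedCount f / N)) := by ring
    _ = _ := by rw [e4]

/-- Phase estimation with `p` qubits is accurate up to `41` units with probability `39 / 40`. -/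
lemma spec_phaseSample (cm : CostModel) (f : Reg κ → Prop) (g p : ℕ) :
    Timed.Spec (phaseSample κ cm f g p) (phaseCircuit cm f g p).gates (ENNReal.ofReal (1 / 40))
      fun y => |countEstimate κ p y - markedCount f| ≤
        2 ^ Fintype.card κ * (Real.pi * 41 / (2 ^ p : ℕ)) ^ 2 +
          2 * (Real.pi * 41 / (2 ^ p : ℕ)) * √(2 ^ Fintype.card κ * markedCount f) := by
  classical
  set Q : ℕ → Prop := fun y => |countEstimate κ p y - markedCount f| ≤
        2 ^ Fintype.card κ * (Real.pi * 41 / (2 ^ p : ℕ)) ^ 2 +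
          2 * (Real.pi * 41 / (2 ^ p : ℕ)) * √(2 ^ Fintype.card κ * markedCount f) with hQ
  set θ := groverAngle f
  intro B b hb
  have e0 : phaseSample κ cm f g p = (do
      let r ← (phaseCircuit cm f g p).run (0, 0)
      pure (regVal r.2)) := rfl
  rw [e0, Timed.loss_bind]
  unfold Circuit.run
  rw [Timed.loss_bind, Timed.loss_tick, if_pos (by omega), Timed.loss_sample, expect_fintype]
  simp only [Timed.loss_pure]
  set F : ℝ → ℕ → ℝ := fun s y => if Real.pi * 41 / (2 ^ p : ℕ) < |Real.sin (s - Real.pi * y / (2 ^ p : ℕ))| then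
      1 / (((2 ^ p : ℕ) : ℝ) ^ 2 * Real.sin (s - Real.pi * y / (2 ^ p : ℕ)) ^ 2) else 0 with hF
  have hFnn : ∀ s y, 0 ≤ F s y := fun s y => by simp only [hF]; split_ifs <;> positivity
  have hbad : ∀ y, ¬ Q y → ∀ s : ℝ, s = 1 ∨ s = -1 → ‖phaseAmp p (s * θ) y‖ ^ 2 ≤ F (s * θ) y := by
    intro y hy s hs
    have h1 : Real.pi * 41 / (2 ^ p : ℕ) < |Real.sin (s * θ - Real.pi * y / (2 ^ p : ℕ))| := by
      by_contra h
      exact hy (abs_countEstimate_sub_le f p y s hs (not_lt.mp h))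
    simp only [hF]
    rw [if_pos h1]
    apply norm_phaseAmp_sq_le
    have : 0 < |Real.sin (s * θ - Real.pi * y / (2 ^ p : ℕ))| := lt_of_le_of_lt (by positivity) h1
    exact abs_pos.mp this
  calc _ = ∑ r : Reg κ × Reg (Fin p), ENNReal.ofReal (if Q (regVal r.2) then 0 else
        ‖(phaseCircuit cm f g p).op.1 r (0, 0)‖ ^ 2) := by
        refine Finset.sum_congr rfl fun r _ => ?_
        unfold measure
        rw [PMF.ofFintype_apply]
        have hB : B ≤ b - (phaseCircuit cm f g p).gates := by omega
        by_cases h : Q (regVal r.2) <;> simp [h, hB]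
    _ = ENNReal.ofReal (∑ y : Reg (Fin p), if Q (regVal y) then 0 else
        ∑ x, ‖(phaseCircuit cm f g p).op.1 (x, y) (0, 0)‖ ^ 2) := by
        rw [← ENNReal.ofReal_sum_of_nonneg fun r _ => by split_ifs <;> positivity,
          Fintype.sum_prod_type_right]
        congr 1
        refine Finset.sum_congr rfl fun y _ => ?_
        split_ifs <;> simp
    _ ≤ ENNReal.ofReal (∑ y : Reg (Fin p), (F θ (regVal y) + F (-θ) (regVal y)) / 2) := by
        apply ENNReal.ofReal_le_ofReal
        refine Finset.sum_le_sum fun y _ => ?_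
        have n1 := hFnn θ (regVal y)
        have n2 := hFnn (-θ) (regVal y)
        split_ifs with h
        · positivity
        · refine (sum_norm_phaseCircuit_le cm f g p y).trans ?_
          have a1 := hbad _ h 1 (Or.inl rfl)
          have a2 := hbad _ h (-1) (Or.inr rfl)
          rw [one_mul] at a1
          rw [neg_one_mul] at a2
          linarith
    _ ≤ ENNReal.ofReal (1 / 40) := by
        apply ENNReal.ofReal_le_ofReal
        rw [sum_reg p fun y => (F θ y + F (-θ) y) / 2, ← Finset.sum_div, Finset.sum_add_distrib]
        have hθ0 : 0 ≤ θ := groverAngle_nonneg f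
        have hθ1 : θ ≤ Real.pi / 2 := groverAngle_le f
        have hpi := Real.pi_pos
        -- Cutoff `41` leaves a tail of `1 / (41 - 1)`. The phases `θ` and `-θ` each enter with
        -- weight one half, so the total is again `1 / 40`.
        have t1 := sum_fejer_tail_le (P := 2 ^ p) (by positivity) (θ := θ) (by linarith) hθ1
          (K := 41) (by norm_num)
        have t2 := sum_fejer_tail_le (P := 2 ^ p) (by positivity) (θ := -θ) (by linarith)
          (by linarith) (K := 41) (by norm_num)
        simp only [hF]
        norm_num at t1 t2 ⊢
        linarith

end Phase

/-! ### Quantum counting -/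

/-- The cost of phase estimation on `c` qubits with a `p`-qubit counting register. -/
def phaseCost (cm : CostModel) (c g p : ℕ) : ℕ :=
  cm.gate * p ^ 2 + ((2 ^ p - 1) * (cm.gate * (c + (cm.gate * c + (c + g)))) + (c + p))

lemma phaseCost_mono (cm : CostModel) (c g : ℕ) {p p' : ℕ} (h : p ≤ p') :
    phaseCost cm c g p ≤ phaseCost cm c g p' := by
  have : 2 ^ p ≤ 2 ^ p' := Nat.pow_le_pow_right (by norm_num) h
  unfold phaseCost
  gcongr

/-- The largest precision needed when counting `t` marked states. -/
def countPrecision (c t : ℕ) : ℕ := Nat.clog 2 ⌈2 ^ 11 * √(((t : ℝ) + 1) * 2 ^ c)⌉₊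

lemma le_two_pow_clog (x : ℝ) : x ≤ ((2 ^ Nat.clog 2 ⌈x⌉₊ : ℕ) : ℝ) :=
  (Nat.le_ceil x).trans (by exact_mod_cast Nat.le_pow_clog (by norm_num) _)

lemma two_pow_clog_le {x : ℝ} (hx : 1 ≤ x) : ((2 ^ Nat.clog 2 ⌈x⌉₊ : ℕ) : ℝ) ≤ 4 * x := by
  have h1 : (⌈x⌉₊ : ℝ) < x + 1 := Nat.ceil_lt_add_one (by linarith)
  rcases le_or_gt ⌈x⌉₊ 1 with h | h
  · rw [Nat.clog_of_right_le_one h]; norm_num; linarith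
  · have h2 := Nat.pow_pred_clog_lt_self (b := 2) (by norm_num) h
    have h3 : 0 < Nat.clog 2 ⌈x⌉₊ := Nat.clog_pos (by norm_num) (by omega)
    have h4 : 2 ^ Nat.clog 2 ⌈x⌉₊ = 2 * 2 ^ (Nat.clog 2 ⌈x⌉₊).pred := by
      rw [← pow_succ', ← Nat.succ_eq_add_one, Nat.succ_pred_eq_of_pos h3]
    have h5 : 2 ^ Nat.clog 2 ⌈x⌉₊ ≤ 2 * ⌈x⌉₊ := by rw [h4]; omega
    have h6 : ((2 ^ Nat.clog 2 ⌈x⌉₊ : ℕ) : ℝ) ≤ 2 * (⌈x⌉₊ : ℝ) := by exact_mod_cast h5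
    linarith

lemma pi_mul_le : Real.pi * 41 ≤ 128.81 := by linarith [Real.pi_lt_d4]

/-- Since `128.81 / 2 ^ 10 ≤ 0.126`, the angular error times `√N` is at most `0.126`; the two
constants bound `0.126 ^ 2` and `2 * 0.126`. The error still grows like `√t`, so this only fixes the
size of `t + 1` up to a constant factor. -/
lemma first_count_error {N t P : ℝ} (hN : 1 ≤ N) (hP : 2 ^ 10 * √N ≤ P) :
    N * (Real.pi * 41 / P) ^ 2 + 2 * (Real.pi * 41 / P) * √(N * t) ≤ 0.016 + 0.252 * √t := by
  have hN0 : 0 < N := by linarith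
  have hsN : 0 < √N := Real.sqrt_pos.mpr hN0
  have hP0 : 0 < P := by nlinarith
  have hpi := pi_mul_le
  have hpi0 := Real.pi_pos
  obtain ⟨e, he⟩ : ∃ e, e = Real.pi * 41 / P := ⟨_, rfl⟩
  rw [← he]
  have he0 : 0 ≤ e := by rw [he]; positivity
  have h1 : e * √N ≤ 0.126 := by
    rw [he, div_mul_eq_mul_div, div_le_iff₀ hP0]
    nlinarith
  have h2 : N * e ^ 2 = (e * √N) ^ 2 := by rw [mul_pow, Real.sq_sqrt hN0.le]; ring
  have h3 : (e * √N) ^ 2 ≤ 0.126 ^ 2 := pow_le_pow_left₀ (by positivity) h1 2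
  have h4 : 2 * e * √(N * t) = 2 * (e * √N) * √t := by rw [Real.sqrt_mul hN0.le]; ring
  have h5 : 2 * (e * √N) * √t ≤ 2 * 0.126 * √t := by gcongr
  rw [h2, h4]
  norm_num at h3 h5 ⊢
  linarith

/-- Once the precision is adapted to the first estimate, the error no longer depends on `t`, and
`0.3 < 1 / 2` makes rounding exact. The constants come from `0.926 ^ 2 ≤ 0.858`, `128.81 / (2 ^ 10 *
0.926) ≤ 0.136` and `0.136 ^ 2 + 2 * 0.136 ≤ 0.3`. -/
lemma second_count_error {N t t₁ P : ℝ} (hN : 1 ≤ N) (ht : 0 ≤ t) (h₁ : 0.858 * (t + 1) ≤ t₁ + 1)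
    (hP : 2 ^ 10 * √((t₁ + 1) * N) ≤ P) :
    N * (Real.pi * 41 / P) ^ 2 + 2 * (Real.pi * 41 / P) * √(N * t) ≤ 0.3 := by
  have hN0 : 0 < N := by linarith
  have hpi := pi_mul_le
  have hpi0 := Real.pi_pos
  obtain ⟨S, hS⟩ : ∃ S, S = √((t + 1) * N) := ⟨_, rfl⟩
  have hS0 : 0 < S := by rw [hS]; exact Real.sqrt_pos.mpr (by positivity)
  have hS2 : S ^ 2 = (t + 1) * N := by rw [hS]; exact Real.sq_sqrt (by positivity)
  have h0 : 0.926 * S ≤ √((t₁ + 1) * N) := by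
    apply Real.le_sqrt_of_sq_le
    rw [mul_pow, hS2]
    have : 0.858 * (t + 1) * N ≤ (t₁ + 1) * N := by gcongr
    have h4 : 0 ≤ (t + 1) * N := by positivity
    norm_num at this ⊢
    linarith
  have hP0 : 0 < P := by linarith
  obtain ⟨e, he⟩ : ∃ e, e = Real.pi * 41 / P := ⟨_, rfl⟩
  rw [← he]
  have he0 : 0 ≤ e := by rw [he]; positivity
  have h1 : e * S ≤ 0.136 := by
    rw [he, div_mul_eq_mul_div, div_le_iff₀ hP0]
    have : Real.pi * 41 * S ≤ 128.81 * S := by gcongr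
    linarith
  have h2 : N * e ^ 2 ≤ (e * S) ^ 2 := by
    rw [mul_pow, hS2]
    have : 0 ≤ e ^ 2 * N * t := by positivity
    linarith
  have h3 : (e * S) ^ 2 ≤ 0.136 ^ 2 := pow_le_pow_left₀ (by positivity) h1 2
  have h4 : √(N * t) ≤ S := by rw [hS]; exact Real.sqrt_le_sqrt (by linarith)
  have h5 : 2 * e * √(N * t) ≤ 2 * e * S := by gcongr
  norm_num at h3 ⊢
  linarith

section Count
variable {κ : Type} [Fintype κ] [DecidableEq κ]

lemma phaseCircuit_gates (cm : CostModel) (f : Reg κ → Prop) (g p : ℕ) :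
    (phaseCircuit cm f g p).gates = phaseCost cm (Fintype.card κ) g p := by
  have : (phaseCircuit cm f g p).gates = (0 + cm.gate * p ^ 2) +
    ((2 ^ p - 1) * (cm.gate * (Fintype.card κ + (cm.gate * Fintype.card κ + (Fintype.card κ + g)))) +
      (Fintype.card κ + Fintype.card (Fin p))) := rfl
  rw [this, phaseCost, Fintype.card_fin, zero_add]

/-- Quantum counting is exact with probability at least `19 / 20`. -/
lemma spec_quantumCount (cm : CostModel) (f : Reg κ → Prop) (g : ℕ) :
    Timed.Spec (quantumCount κ cm f g)
      (2 * phaseCost cm (Fintype.card κ) g (countPrecision (Fintype.card κ) (markedCount f)) +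
        cm.step)
      (ENNReal.ofReal (1 / 20)) fun k => k = markedCount f := by
  set c := Fintype.card κ with hc
  set t := markedCount f with ht
  set N : ℝ := 2 ^ c with hN
  have hN1 : 1 ≤ N := one_le_pow₀ (by norm_num)
  have hN0 : 0 < N := by linarith
  have ht0 : (0 : ℝ) ≤ t := by positivity
  have hst : √(t : ℝ) * √(t : ℝ) = t := Real.mul_self_sqrt ht0
  have hst0 : 0 ≤ √(t : ℝ) := Real.sqrt_nonneg _
  have hst1 : √(t : ℝ) ≤ (t + 1) / 2 := by nlinarith [sq_nonneg (√(t : ℝ) - 1)]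
  set p₁ := Nat.clog 2 ⌈2 ^ 10 * √N⌉₊ with hp₁
  set S : ℝ := √(((t : ℝ) + 1) * N) with hS
  have hS0 : 0 < S := Real.sqrt_pos.mpr (by positivity)
  have hS2 : S * S = ((t : ℝ) + 1) * N := Real.mul_self_sqrt (by positivity)
  have hNS : √N ≤ S := Real.sqrt_le_sqrt (by nlinarith)
  have hrewrite : quantumCount κ cm f g = (do
      let y₁ ← phaseSample κ cm f g p₁
      let y₂ ← phaseSample κ cm f g (Nat.clog 2 ⌈2 ^ 10 * √((countEstimate κ p₁ y₁ + 1) * N)⌉₊)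
      Timed.tick cm.step
      pure ⌊countEstimate κ (Nat.clog 2 ⌈2 ^ 10 * √((countEstimate κ p₁ y₁ + 1) * N)⌉₊) y₂
        + 1 / 2⌋₊) := rfl
  rw [hrewrite]
  have s1 := spec_phaseSample cm f g p₁
  rw [phaseCircuit_gates, ← hc] at s1
  have hp₁le : p₁ ≤ countPrecision c t := by
    apply Nat.clog_mono_right
    apply Nat.ceil_le_ceil
    have : (2 : ℝ) ^ 10 * √N ≤ 2 ^ 11 * S := by nlinarith
    exact this
  refine ((s1.mono (phaseCost_mono cm _ _ hp₁le) le_rfl fun y hy => hy).bind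
    (T₂ := phaseCost cm c g (countPrecision c t) + cm.step) (ε₂ := ENNReal.ofReal (1 / 40))
    (Q₂ := fun k => k = t) ?_).mono (by omega) ?_ (fun _ h => h)
  swap
  · rw [← ENNReal.ofReal_add (by norm_num) (by norm_num)]
    apply ENNReal.ofReal_le_ofReal; norm_num
  intro y₁ hy₁
  set t₁ := countEstimate κ p₁ y₁ with ht₁
  have hP₁ : 2 ^ 10 * √N ≤ ((2 ^ p₁ : ℕ) : ℝ) := le_two_pow_clog _
  have ha : |t₁ - t| ≤ 0.016 + 0.252 * √(t : ℝ) := hy₁.trans (first_count_error hN1 hP₁)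
  rw [abs_le] at ha
  -- Both bounds use `√t ≤ (t + 1) / 2`. The lower one makes the second run precise enough; the
  -- factor `4` in the upper one, under a root, is what turns `2 ^ 10` into the `2 ^ 11` of
  -- `countPrecision`.
  have hlow : 0.858 * ((t : ℝ) + 1) ≤ t₁ + 1 := by linarith
  have hup : t₁ + 1 ≤ 4 * ((t : ℝ) + 1) := by linarith
  set p₂ := Nat.clog 2 ⌈2 ^ 10 * √((t₁ + 1) * N)⌉₊ with hp₂
  have hp₂le : p₂ ≤ countPrecision c t := by
    apply Nat.clog_mono_right
    apply Nat.ceil_le_ceil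
    have h1 : √((t₁ + 1) * N) ≤ 2 * S := by
      rw [Real.sqrt_le_left (by positivity)]
      nlinarith
    have : (2 : ℝ) ^ 10 * √((t₁ + 1) * N) ≤ 2 ^ 11 * S := by nlinarith
    exact this
  have s2 := spec_phaseSample cm f g p₂
  rw [phaseCircuit_gates, ← hc] at s2
  have s3 := s2.bind (T₂ := cm.step) (ε₂ := 0) (Q₂ := fun k => k = t)
    (f := fun y₂ => (do
      Timed.tick cm.step
      pure ⌊countEstimate κ p₂ y₂ + 1 / 2⌋₊ : Timed ℕ)) ?_
  · rw [add_zero] at s3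
    exact s3.mono (by have := phaseCost_mono cm c g hp₂le; omega) le_rfl fun _ h => h
  intro y₂ hy₂
  have hround : ⌊countEstimate κ p₂ y₂ + 1 / 2⌋₊ = t := by
    have hP₂ : 2 ^ 10 * √((t₁ + 1) * N) ≤ ((2 ^ p₂ : ℕ) : ℝ) := le_two_pow_clog _
    have h4 : |countEstimate κ p₂ y₂ - t| ≤ 0.3 :=
      hy₂.trans (second_count_error hN1 ht0 hlow hP₂)
    rw [abs_le] at h4
    rw [Nat.floor_eq_iff (by linarith)]
    constructor <;> linarith
  simp only [hround]
  exact (Timed.spec_tick cm.step).bind_zero_left (T₂ := 0) fun _ _ => Timed.spec_pure t rfl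

end Count

/-! ### The potential of quantum minimum finding -/

/-- Squares of sines become cosines in arithmetic progression, which telescope after multiplication
by `sin (2θ)`. Not dividing by this factor keeps the formula valid when it vanishes. -/
lemma sum_sin_sq_odd (θ : ℝ) (m : ℕ) :
    4 * Real.sin (2 * θ) * ∑ j ∈ Finset.range m, Real.sin ((2 * j + 1) * θ) ^ 2 =
      2 * m * Real.sin (2 * θ) - Real.sin (4 * m * θ) := by
  induction m with
  | zero => simp
  | succ m ih =>
    rw [Finset.sum_range_succ, mul_add, ih]
    push_cast
    have h1 : 4 * ((m : ℝ) + 1) * θ = 2 * ((2 * m + 1) * θ) + 2 * θ := by ring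
    have h2 : 4 * (m : ℝ) * θ = 2 * ((2 * m + 1) * θ) - 2 * θ := by ring
    rw [h1, h2, Real.sin_add, Real.sin_sub, Real.cos_two_mul' ((2 * (m : ℝ) + 1) * θ)]
    have h3 := Real.sin_sq_add_cos_sq ((2 * (m : ℝ) + 1) * θ)
    linear_combination (2 * Real.sin (2 * θ)) * h3

/-- From this number of iterations on, exponential searching for one of `t` out of `N` items
succeeds with probability at least `1 / 4`. -/
def criticalBound (N : ℝ) (t : ℕ) : ℝ := √(N / t) / 2 + 1 / 2

/-- By `sum_sin_sq_odd` it suffices that `sin (4 m θ) ≤ m sin (2θ)`. For `θ ≤ π / 4` the critical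
bound even gives `m sin (2θ) ≥ 1`. For `π / 4 ≤ θ < π / 2`, if `m sin (2θ) < 1`, then `2 m (π - 2θ)
< π`, so `4 m θ` lies at most `π` below a multiple of `2π` and its sine is nonpositive. At `π / 2`
every summand is `1`. -/
lemma sum_sin_sq_ge {N θ : ℝ} {t m : ℕ} (hN : 0 < N) (ht : 0 < t) (hθ0 : 0 ≤ θ)
    (hθ1 : θ ≤ Real.pi / 2) (hθ : Real.sin θ ^ 2 = t / N) (hm : criticalBound N t ≤ m) :
    (m : ℝ) / 4 ≤ ∑ j ∈ Finset.range m, Real.sin ((2 * j + 1) * θ) ^ 2 := by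
  have hpi := Real.pi_pos
  have ht' : (0 : ℝ) < t := by exact_mod_cast ht
  have hsq : 0 < Real.sin θ ^ 2 := by rw [hθ]; positivity
  have hs0 : 0 < Real.sin θ := by
    have h1 : 0 ≤ Real.sin θ := Real.sin_nonneg_of_nonneg_of_le_pi hθ0 (by linarith)
    rcases h1.lt_or_eq with h | h
    · exact h
    · rw [← h] at hsq; simp at hsq
  have hθp : 0 < θ := by
    rcases hθ0.lt_or_eq with h | h
    · exact h
    · rw [← h] at hs0; simp at hs0
  have hm0 : (0 : ℝ) < m := lt_of_lt_of_le (by unfold criticalBound; positivity) hm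
  have hm1 : (1 : ℝ) ≤ m := by
    have : 0 < m := by exact_mod_cast hm0
    exact_mod_cast this
  have hid := sum_sin_sq_odd θ m
  have hsin1 := Real.sin_le_one (4 * m * θ)
  have main : 0 < Real.sin (2 * θ) → 1 ≤ m * Real.sin (2 * θ) →
      (m : ℝ) / 4 ≤ ∑ j ∈ Finset.range m, Real.sin ((2 * j + 1) * θ) ^ 2 := by
    intro h2 h3
    by_contra hlt
    push Not at hlt
    have : 4 * Real.sin (2 * θ) * ∑ j ∈ Finset.range m, Real.sin ((2 * j + 1) * θ) ^ 2 <
        4 * Real.sin (2 * θ) * (m / 4) := by gcongr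
    nlinarith
  rcases le_total θ (Real.pi / 4) with hc | hc
  · have h2 : 0 < Real.sin (2 * θ) := Real.sin_pos_of_pos_of_lt_pi (by linarith) (by linarith)
    refine main h2 ?_
    have hcos : 0 < Real.cos θ := Real.cos_pos_of_mem_Ioo ⟨by linarith, by linarith⟩
    have hhalf : Real.sin θ ^ 2 ≤ 1 / 2 := by
      have : 0 ≤ Real.cos (2 * θ) := Real.cos_nonneg_of_mem_Icc ⟨by linarith, by linarith⟩
      rw [Real.cos_two_mul, Real.cos_sq'] at this
      linarith
    have hroot : √(N / t) = 1 / Real.sin θ := by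
      rw [Real.sqrt_eq_iff_mul_self_eq (by positivity) (by positivity)]
      rw [div_mul_div_comm, one_mul, ← sq, hθ]; field_simp
    -- With `x = sin² θ` the square is `(1 - x) (1 + x)² = 1 + x (1 - x - x²)`, and the bracket is
    -- nonnegative for `x ≤ 1 / 2`.
    have hkey : 1 ≤ Real.cos θ * (1 + Real.sin θ ^ 2) := by
      have h5 : 1 ≤ (Real.cos θ * (1 + Real.sin θ ^ 2)) ^ 2 := by
        rw [mul_pow, Real.cos_sq']
        generalize Real.sin θ ^ 2 = x at hsq hhalf
        have : 0 ≤ x * (1 - x - x ^ 2) := mul_nonneg hsq.le (by nlinarith)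
        linarith
      by_contra h
      push Not at h
      have : (Real.cos θ * (1 + Real.sin θ ^ 2)) ^ 2 < 1 := by
        apply pow_lt_one₀ (by positivity) h (by norm_num)
      linarith
    have hmm : (1 / Real.sin θ + Real.sin θ) / 2 ≤ m := by
      refine le_trans ?_ hm
      unfold criticalBound
      rw [hroot]
      have := Real.sin_le_one θ
      linarith
    calc 1 ≤ Real.cos θ * (1 + Real.sin θ ^ 2) := hkey
      _ = (1 / Real.sin θ + Real.sin θ) / 2 * Real.sin (2 * θ) := by
        rw [Real.sin_two_mul]; field_simp
      _ ≤ _ := by gcongr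
  · rcases hθ1.lt_or_eq with hlt | heq
    · have h2 : 0 < Real.sin (2 * θ) := Real.sin_pos_of_pos_of_lt_pi (by linarith) (by linarith)
      by_cases h3 : 1 ≤ m * Real.sin (2 * θ)
      · exact main h2 h3
      · push Not at h3
        have h4 : 2 / Real.pi * (Real.pi - 2 * θ) ≤ Real.sin (2 * θ) := by
          rw [← Real.sin_pi_sub]
          exact Real.mul_le_sin (by linarith) (by linarith)
        have h5 : 2 * m * (Real.pi - 2 * θ) < Real.pi := by
          have : m * (2 / Real.pi * (Real.pi - 2 * θ)) < 1 :=
            lt_of_le_of_lt (by gcongr) h3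
          have h6 : m * (2 / Real.pi * (Real.pi - 2 * θ)) = 2 * m * (Real.pi - 2 * θ) / Real.pi := by
            field_simp
          rw [h6, div_lt_one hpi] at this
          exact this
        have h6 : Real.sin (4 * m * θ) ≤ 0 := by
          have e : 4 * (m : ℝ) * θ = m * (2 * Real.pi) - 2 * m * (Real.pi - 2 * θ) := by ring
          rw [e, Real.sin_nat_mul_two_pi_sub, neg_nonpos]
          refine Real.sin_nonneg_of_nonneg_of_le_pi ?_ h5.le
          have : 0 ≤ Real.pi - 2 * θ := by linarith
          positivity
        by_contra hlt'
        push Not at hlt'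
        have : 4 * Real.sin (2 * θ) * ∑ j ∈ Finset.range m, Real.sin ((2 * j + 1) * θ) ^ 2 <
            4 * Real.sin (2 * θ) * (m / 4) := by gcongr
        nlinarith
    · have h1 : ∀ j : ℕ, Real.sin ((2 * j + 1) * θ) ^ 2 = 1 := by
        intro j
        have : Real.cos ((2 * j + 1) * θ) = 0 := by
          rw [heq, Real.cos_eq_zero_iff]
          exact ⟨j, by push_cast; ring⟩
        rw [Real.sin_sq, this]; norm_num
      simp only [h1, Finset.sum_const, Finset.card_range, nsmul_eq_mul, mul_one]
      linarith

/-- A bound on the expected number of oracle calls of exponential searching with current bound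
`b`. -/
def searchPotential (N : ℝ) (t : ℕ) (b : ℝ) : ℝ :=
  if criticalBound N t ≤ b then 5 * b + 4
  else 9 * criticalBound N t + 5 - 5 / 2 * b + Real.log (criticalBound N t / b) / Real.log (6 / 5)

lemma criticalBound_le {N : ℝ} {t : ℕ} (hN : 1 ≤ N) (ht : 0 < t) : criticalBound N t ≤ √N := by
  unfold criticalBound
  have h1 : (1 : ℝ) ≤ t := by exact_mod_cast ht
  have h2 : √(N / t) ≤ √N := Real.sqrt_le_sqrt (div_le_self (by linarith) h1)
  have h3 : 1 ≤ √N := Real.one_le_sqrt.mpr hN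
  linarith

lemma log_six_fifths_pos : 0 < Real.log (6 / 5) := Real.log_pos (by norm_num)

lemma searchPotential_nonneg {N b : ℝ} {t : ℕ} (hb : 0 < b) : 0 ≤ searchPotential N t b := by
  unfold searchPotential
  split_ifs with h
  · linarith
  · push Not at h
    have : 0 ≤ Real.log (criticalBound N t / b) :=
      Real.log_nonneg (by rw [le_div_iff₀ hb]; linarith)
    have := div_nonneg this log_six_fifths_pos.le
    linarith

/-- Here `b / 2 + 1` bounds the mean number of calls of a round and `P` is its success probability.
Above the critical bound, `b / 2 + 1 + 3 / 4 * (5 * (6 / 5 * b) + 4)` is exactly `5 * b + 4`. Below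
it success is ignored: the term `-5 / 2 * b` pays for `b / 2` when `b` grows by `6 / 5`, and the
logarithm, which counts the remaining growth steps, pays for `1`. The coefficient `9` is what the
crossing round needs. -/
lemma searchPotential_step {N b P : ℝ} {t : ℕ} (hN : 1 ≤ N) (ht : 0 < t) (hb : 1 ≤ b)
    (hbN : b ≤ √N) (hP0 : 0 ≤ P) (hP : criticalBound N t ≤ b → 1 / 4 ≤ P) :
    b / 2 + 1 + (1 - P) * searchPotential N t (min (6 / 5 * b) √N) ≤ searchPotential N t b := by
  have hcrit := criticalBound_le hN ht
  have hmin : 0 < min (6 / 5 * b) √N := lt_min (by linarith) (by linarith)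
  by_cases h : criticalBound N t ≤ b
  · have h2 : criticalBound N t ≤ min (6 / 5 * b) √N := le_min (by linarith) hcrit
    unfold searchPotential
    rw [if_pos h, if_pos h2]
    have h3 : min (6 / 5 * b) √N ≤ 6 / 5 * b := min_le_left _ _
    have h4 := hP h
    have h5 : (1 - P) * (5 * min (6 / 5 * b) √N + 4) ≤ (3 / 4) * (5 * (6 / 5 * b) + 4) := by
      apply mul_le_mul (by linarith) (by linarith) (by linarith) (by norm_num)
    linarith
  · have hle : (1 - P) * searchPotential N t (min (6 / 5 * b) √N) ≤
        searchPotential N t (min (6 / 5 * b) √N) := by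
      have := searchPotential_nonneg (N := N) (t := t) hmin
      nlinarith
    have hgoal : b / 2 + 1 + searchPotential N t (min (6 / 5 * b) √N) ≤ searchPotential N t b := by
      have hlog0 : 0 ≤ Real.log (criticalBound N t / b) / Real.log (6 / 5) := by
        apply div_nonneg _ log_six_fifths_pos.le
        exact Real.log_nonneg (by rw [le_div_iff₀ (by linarith)]; linarith)
      by_cases h2 : criticalBound N t ≤ min (6 / 5 * b) √N
      · unfold searchPotential
        rw [if_neg h, if_pos h2]
        push Not at h
        have h3 : min (6 / 5 * b) √N ≤ 6 / 5 * b := min_le_left _ _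
        linarith
      · have h3 : min (6 / 5 * b) √N = 6 / 5 * b := by
          apply min_eq_left
          by_contra hc
          push Not at hc
          rw [min_eq_right hc.le] at h2
          exact h2 hcrit
        rw [h3] at h2 ⊢
        unfold searchPotential
        rw [if_neg h, if_neg h2]
        push Not at h h2
        have e : Real.log (criticalBound N t / b) / Real.log (6 / 5) =
            Real.log (criticalBound N t / (6 / 5 * b)) / Real.log (6 / 5) + 1 := by
          have h0 : 0 < criticalBound N t := by linarith
          rw [Real.log_div h0.ne' (by positivity), Real.log_div h0.ne' (by positivity),
            Real.log_mul (by norm_num) (by positivity)]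
          have := log_six_fifths_pos.ne'
          field_simp
          ring
        rw [e]
        linarith
    linarith

/-- The average potential after a better item has been found among `t` marked ones. -/
def restPotential (N : ℝ) (t : ℕ) : ℝ :=
  ∑ r ∈ Finset.range t, if r = 0 then 0 else searchPotential N r 1 / (r + 1)

/-- A bound on the expected number of oracle calls of minimum finding when `t` items are better
than the current one. -/
def minPotential (N : ℝ) (b : ℝ) (t : ℕ) : ℝ :=
  if t = 0 then 0 else searchPotential N t b + restPotential N t

lemma restPotential_nonneg (N : ℝ) (t : ℕ) : 0 ≤ restPotential N t := by
  refine Finset.sum_nonneg fun r _ => ?_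
  split_ifs
  · exact le_rfl
  · exact div_nonneg (searchPotential_nonneg one_pos) (by positivity)

lemma minPotential_nonneg {N b : ℝ} (hb : 0 < b) (t : ℕ) : 0 ≤ minPotential N b t := by
  unfold minPotential
  split_ifs
  · exact le_rfl
  · exact add_nonneg (searchPotential_nonneg hb) (restPotential_nonneg N t)

/-- The next threshold is uniform among the `t` better items, so its number of better items is
uniform below `t`. The identity says that averaging the whole potential yields `restPotential`; its
weights `1 / (r + 1)` are the probabilities that the process ever stops at the item with `r` better
ones. -/
lemma sum_minPotential (N : ℝ) (t : ℕ) :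
    ∑ r ∈ Finset.range t, minPotential N 1 r = t * restPotential N t := by
  induction t with
  | zero => simp
  | succ t ih =>
    rw [Finset.sum_range_succ, ih, restPotential, restPotential, Finset.sum_range_succ,
      minPotential, restPotential]
    have h : (t : ℝ) + 1 ≠ 0 := by positivity
    split_ifs with h0
    · subst h0; simp
    · push_cast
      field_simp
      ring

/-- The logarithmic term is at most `3 log N`, because the critical bound is at most `√N` and `log
(6 / 5) ≥ 1 / 6`. -/
lemma searchPotential_one_le {N : ℝ} {t : ℕ} (hN : 1 ≤ N) (ht : 0 < t) :
    searchPotential N t 1 ≤ 9 / 2 * (√N / √t) + (10 + 3 * Real.log N) := by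
  have hcrit := criticalBound_le hN ht
  have hlogN : 0 ≤ Real.log N := Real.log_nonneg hN
  have e : criticalBound N t = √N / √t / 2 + 1 / 2 := by
    unfold criticalBound; rw [Real.sqrt_div (by linarith)]
  have hq : 0 ≤ √N / √t := by positivity
  unfold searchPotential
  split_ifs with h
  · linarith
  · push Not at h
    have h1 : Real.log (criticalBound N t / 1) ≤ 1 / 2 * Real.log N := by
      rw [div_one, ← Real.log_sqrt (by linarith) |>.trans (by ring : Real.log N / 2 = 1 / 2 * Real.log N)]
      exact Real.log_le_log (by linarith) hcrit
    have h2 : 1 / 6 ≤ Real.log (6 / 5) := by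
      have := Real.one_sub_inv_le_log_of_pos (show (0 : ℝ) < 6 / 5 by norm_num)
      norm_num at this ⊢
      linarith
    have h3 : Real.log (criticalBound N t / 1) / Real.log (6 / 5) ≤ 3 * Real.log N := by
      rw [div_le_iff₀ log_six_fifths_pos]
      nlinarith
    rw [e] at h3 ⊢
    linarith

/-- Both parts of `searchPotential_one_le` are summed by telescoping: `1 / (√u (u + 1)) ≤ 2 (1 / √u
- 1 / √(u + 1))` and `1 / (u + 1) ≤ log (u + 1) - log u`. Keeping the negative term `-1 / √(t + 1)`
lets it absorb the cost of the current search in `minPotential_le`. -/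
lemma restPotential_le {N : ℝ} (hN : 1 ≤ N) (t : ℕ) :
    restPotential N (t + 1) ≤ 9 * √N * (1 - 1 / √((t : ℝ) + 1)) +
      (10 + 3 * Real.log N) * Real.log ((t : ℝ) + 1) := by
  have hlogN : 0 ≤ Real.log N := Real.log_nonneg hN
  induction t with
  | zero => simp [restPotential]
  | succ t ih =>
    have hrec : restPotential N (t + 1 + 1) = restPotential N (t + 1) +
        searchPotential N (t + 1) 1 / ((t + 1 : ℕ) + 1) := by
      rw [restPotential, Finset.sum_range_succ, if_neg (by omega)]; rfl
    rw [hrec]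
    have hs := searchPotential_one_le hN (Nat.succ_pos t)
    set u : ℝ := (t : ℝ) + 1 with hu
    have hu1 : 1 ≤ u := by rw [hu]; linarith [(Nat.cast_nonneg t : (0 : ℝ) ≤ t)]
    have hcast : ((t + 1 : ℕ) : ℝ) = u := by push_cast; rfl
    rw [hcast]
    simp only [Nat.succ_eq_add_one, hcast] at hs
    set D : ℝ := 10 + 3 * Real.log N with hD
    have hD0 : 0 ≤ D := by positivity
    have hdiv : searchPotential N (t + 1) 1 / (u + 1) ≤
        (9 / 2 * (√N / √u) + D) / (u + 1) := by gcongr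
    have hlog : 1 / (u + 1) ≤ Real.log (u + 1) - Real.log u := by
      rw [← Real.log_div (by positivity) (by positivity)]
      have := Real.one_sub_inv_le_log_of_pos (show (0 : ℝ) < (u + 1) / u by positivity)
      refine le_trans (le_of_eq ?_) this
      field_simp
      ring
    have hsq : 1 / (√u * (u + 1)) ≤ 2 * (1 / √u - 1 / √(u + 1)) := by
      set a := √u with ha
      set c := √(u + 1) with hc
      have ha0 : 0 < a := Real.sqrt_pos.mpr (by linarith)
      have hac : a ≤ c := Real.sqrt_le_sqrt (by linarith)
      have hc0 : 0 < c := by linarith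
      have ha2 : a ^ 2 = u := Real.sq_sqrt (by linarith)
      have hc2 : c ^ 2 = u + 1 := Real.sq_sqrt (by linarith)
      rw [← hc2, div_sub_div _ _ ha0.ne' hc0.ne', mul_div_assoc', div_le_div_iff₀ (by positivity) (by positivity)]
      have hd : (c - a) * (c + a) = 1 := by nlinarith
      have h5 : 1 ≤ 2 * (c - a) * c := by nlinarith
      have h6 : 0 ≤ a * c := by positivity
      nlinarith [mul_le_mul_of_nonneg_left h5 h6]
    have e1 : (9 / 2 * (√N / √u) + D) / (u + 1) =
        9 / 2 * √N * (1 / (√u * (u + 1))) + D * (1 / (u + 1)) := by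
      have : √u ≠ 0 := by positivity
      field_simp
    have m1 : 9 / 2 * √N * (1 / (√u * (u + 1))) ≤ 9 / 2 * √N * (2 * (1 / √u - 1 / √(u + 1))) := by
      gcongr
    have m2 : D * (1 / (u + 1)) ≤ D * (Real.log (u + 1) - Real.log u) := by gcongr
    rw [e1] at hdiv
    linarith

/-- For large `N`, half of the allowed number of oracle calls suffices on average. -/
lemma minPotential_le {N : ℝ} (hN : 136 ^ 4 ≤ N) {t : ℕ} (ht : (t : ℝ) ≤ N) :
    minPotential N 1 t ≤ 45 / 4 * √N := by
  have hN1 : 1 ≤ N := by linarith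
  unfold minPotential
  split_ifs with h0
  · positivity
  obtain ⟨s, rfl⟩ : ∃ s, t = s + 1 := ⟨t - 1, by omega⟩
  have h1 := searchPotential_one_le hN1 (Nat.succ_pos s)
  have h2 := restPotential_le hN1 s
  simp only [Nat.succ_eq_add_one] at h1
  push_cast at h1 ht
  set u : ℝ := (s : ℝ) + 1
  have hu1 : 1 ≤ u := by linarith [(Nat.cast_nonneg s : (0 : ℝ) ≤ s)]
  -- The leading terms add up to at most `9 √N`, which leaves `9 / 4 * √N` for the logarithms. In
  -- terms of `z`, `log N ≤ 8 z` bounds them by `(34 z) (9 z) = 306 z²` while `√N = z⁴`, so `z² ≥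
  -- 306 / (9 / 4) = 136` is needed; this is the origin of `136 ^ 4`.
  set z : ℝ := N ^ (1 / 8 : ℝ) with hz
  have hz8 : z ^ 8 = N := by
    rw [hz, ← Real.rpow_natCast, ← Real.rpow_mul (by linarith)]; norm_num
  have hz0 : 0 < z := Real.rpow_pos_of_pos (by linarith) _
  have hz2 : 136 ≤ z ^ 2 := by
    have : (136 : ℝ) ^ 4 ≤ (z ^ 2) ^ 4 := by rw [← pow_mul]; norm_num [hz8] at hN ⊢; linarith
    exact le_of_pow_le_pow_left₀ (by norm_num) (by positivity) this
  have hz1 : 1 ≤ z := by nlinarith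
  have hlog : Real.log N ≤ 8 * z := by
    rw [← hz8, Real.log_pow]
    have := Real.log_le_sub_one_of_pos hz0
    push_cast
    linarith
  have hlogN : 0 ≤ Real.log N := Real.log_nonneg hN1
  have hsqrt : √N = z ^ 4 := by
    rw [← hz8, Real.sqrt_eq_iff_mul_self_eq (by positivity) (by positivity)]; ring
  have hlogu : Real.log u ≤ Real.log N := Real.log_le_log (by linarith) ht
  have hlogu0 : 0 ≤ Real.log u := Real.log_nonneg hu1
  have hsu : 0 < √u := Real.sqrt_pos.mpr (by linarith)
  have hquot : √N / √u = √N * (1 / √u) := by ring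
  have hr0 : 0 ≤ √N * (1 / √u) := by positivity
  have hD : (10 + 3 * Real.log N) * (1 + Real.log u) ≤ 306 * z ^ 2 := by
    calc _ ≤ (34 * z) * (9 * z) := by gcongr <;> linarith
      _ = _ := by ring
  have hfin : 306 * z ^ 2 ≤ 9 / 4 * √N := by rw [hsqrt]; nlinarith [sq_nonneg z]
  rw [hquot] at h1
  linarith

/-! ### The order of the hits in quantum minimum finding -/

section Better
variable {χ : ℕ → Option ℝ} {chiMax : ℝ} {used : List ℕ}

/-- The best hit so far, if any, is an unused one below the threshold. -/
def ValidBest (χ : ℕ → Option ℝ) (chiMax : ℝ) (used : List ℕ) (best : Option ℕ) : Prop :=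
  ∀ i, best = some i → Better χ chiMax used none i

/-- The best unused hit below the threshold, or nothing if there is none. -/
def IsOptimal (χ : ℕ → Option ℝ) (chiMax : ℝ) (used : List ℕ) (best : Option ℕ) : Prop :=
  ValidBest χ chiMax used best ∧ ∀ j, ¬ Better χ chiMax used best j

lemma validBest_none : ValidBest χ chiMax used none := fun i h => by simp at h

lemma Better.trans {best : Option ℕ} {i j : ℕ} (hi : Better χ chiMax used best i)
    (hj : Better χ chiMax used (some i) j) : Better χ chiMax used best j := by
  obtain ⟨hju, x, hx, y, hy, hxy⟩ := hj
  obtain ⟨hiu, y', hy', hm⟩ := hi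
  rw [hy] at hy'
  obtain rfl : y = y' := by simpa using hy'
  refine ⟨hju, x, hx, ?_⟩
  cases best with
  | none =>
    change y < chiMax at hm
    change x < chiMax
    rcases hxy with h | ⟨h, _⟩ <;> linarith
  | some k =>
    obtain ⟨z, hz, hyz⟩ := hm
    refine ⟨z, hz, ?_⟩
    rcases hxy with h | ⟨h, h'⟩ <;> rcases hyz with h1 | ⟨h1, h1'⟩
    · left; linarith
    · left; linarith
    · left; linarith
    · right; exact ⟨by linarith, by omega⟩

lemma Better.of_valid {best : Option ℕ} {j : ℕ} (hb : ValidBest χ chiMax used best)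
    (hj : Better χ chiMax used best j) : Better χ chiMax used none j := by
  cases best with
  | none => exact hj
  | some i => exact (hb i rfl).trans hj

lemma Better.validBest_some {j : ℕ} (hj : Better χ chiMax used none j) :
    ValidBest χ chiMax used (some j) := fun i h => by
  obtain rfl : j = i := by simpa using h
  exact hj

lemma not_better_self (j : ℕ) : ¬ Better χ chiMax used (some j) j := by
  rintro ⟨_, x, hx, y, hy, h⟩
  rw [hx] at hy
  obtain rfl : x = y := by simpa using hy
  rcases h with h | ⟨_, h⟩
  · exact lt_irrefl _ h
  · exact lt_irrefl _ h

lemma Better.total {i j : ℕ} (hi : Better χ chiMax used none i) (hj : Better χ chiMax used none j)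
    (hij : i ≠ j) : Better χ chiMax used (some j) i ∨ Better χ chiMax used (some i) j := by
  obtain ⟨hiu, x, hx, _⟩ := hi
  obtain ⟨hju, y, hy, _⟩ := hj
  rcases lt_trichotomy x y with h | h | h
  · exact Or.inl ⟨hiu, x, hx, y, hy, Or.inl h⟩
  · rcases Nat.lt_or_gt_of_ne hij with h' | h'
    · exact Or.inl ⟨hiu, x, hx, y, hy, Or.inr ⟨h, h'⟩⟩
    · exact Or.inr ⟨hju, y, hy, x, hx, Or.inr ⟨h.symm, h'⟩⟩
  · exact Or.inr ⟨hju, y, hy, x, hx, Or.inl h⟩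

lemma IsOptimal.better_of_ne {best o : Option ℕ} (ho : IsOptimal χ chiMax used o)
    (hb : ValidBest χ chiMax used best) (hne : best ≠ o) :
    ∃ j, o = some j ∧ Better χ chiMax used best j := by
  cases o with
  | none =>
    cases best with
    | none => exact absurd rfl hne
    | some i => exact absurd (hb i rfl) (ho.2 i)
  | some j =>
    refine ⟨j, rfl, ?_⟩
    cases best with
    | none => exact ho.1 j rfl
    | some i =>
      rcases (hb i rfl).total (ho.1 j rfl) (fun h => hne (by rw [h])) with h | h
      · exact absurd h (ho.2 i)
      · exact h

lemma IsOptimal.unique {o o' : Option ℕ} (ho : IsOptimal χ chiMax used o)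
    (ho' : IsOptimal χ chiMax used o') : o = o' := by
  by_contra hne
  obtain ⟨j, _, h⟩ := ho'.better_of_ne ho.1 hne
  exact ho.2 j h

variable {q : ℕ}

lemma regVal_injective (q : ℕ) : Function.Injective (regVal : Reg (Fin q) → ℕ) := fun _ _ h =>
  finFunctionFinEquiv.injective (Fin.ext h)

lemma exists_regVal {j : ℕ} (hj : j < 2 ^ q) : ∃ x : Reg (Fin q), regVal x = j :=
  ⟨finFunctionFinEquiv.symm ⟨j, hj⟩, by simp [regVal]⟩

/-- The number of labels of `q` bits that are better than the best one so far. -/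
def betterCount (χ : ℕ → Option ℝ) (chiMax : ℝ) (used : List ℕ) (q : ℕ) (best : Option ℕ) : ℕ :=
  markedCount fun x : Reg (Fin q) => Better χ chiMax used best (regVal x)

lemma betterCount_lt {best : Option ℕ} {x : Reg (Fin q)}
    (hx : Better χ chiMax used best (regVal x)) :
    betterCount χ chiMax used q (some (regVal x)) < betterCount χ chiMax used q best := by
  classical
  apply Finset.card_lt_card
  refine ⟨fun y hy => ?_, fun hs => ?_⟩
  · simp only [Finset.mem_filter, Finset.mem_univ, true_and] at hy ⊢
    exact hx.trans hy
  · have := hs (show x ∈ _ by simpa using hx)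
    simp only [Finset.mem_filter, Finset.mem_univ, true_and] at this
    exact not_better_self _ this

lemma betterCount_eq_zero (hχ : ∀ j x, χ j = some x → j < 2 ^ q) {best : Option ℕ} :
    betterCount χ chiMax used q best = 0 ↔ ∀ j, ¬ Better χ chiMax used best j := by
  classical
  unfold betterCount markedCount
  rw [Finset.card_eq_zero, Finset.filter_eq_empty_iff]
  constructor
  · intro h j hj
    obtain ⟨_, x, hx, _⟩ := id hj
    obtain ⟨r, rfl⟩ := exists_regVal (hχ j x hx)
    exact h (Finset.mem_univ r) hj
  · exact fun h x _ => h _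

-- Sending a marked label to the number of labels better than it is a bijection onto the numbers
-- below the count: the order is strict and total on valid labels, which gives injectivity, and the
-- cardinalities agree.
open Classical in
lemma sum_betterCount {best : Option ℕ} (hb : ValidBest χ chiMax used best) (h : ℕ → ℝ) :
    ∑ x ∈ Finset.univ.filter (fun x : Reg (Fin q) => Better χ chiMax used best (regVal x)),
      h (betterCount χ chiMax used q (some (regVal x))) =
    ∑ r ∈ Finset.range (betterCount χ chiMax used q best), h r := by
  set S := Finset.univ.filter (fun x : Reg (Fin q) => Better χ chiMax used best (regVal x)) with hS
  have hinj : Set.InjOn (fun x : Reg (Fin q) => betterCount χ chiMax used q (some (regVal x))) S := by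
    intro x hx y hy hxy
    by_contra hne
    have hx' : Better χ chiMax used best (regVal x) := by simpa [hS] using hx
    have hy' : Better χ chiMax used best (regVal y) := by simpa [hS] using hy
    rcases (hx'.of_valid hb).total (hy'.of_valid hb) (fun h => hne (regVal_injective q h)) with h | h
    · have := betterCount_lt h; simp only at hxy; omega
    · have := betterCount_lt h; simp only at hxy; omega
  rw [← Finset.sum_image (f := h) hinj]
  congr 1
  apply Finset.eq_of_subset_of_card_le
  · intro r hr
    obtain ⟨x, hx, rfl⟩ := Finset.mem_image.mp hr
    exact Finset.mem_range.mpr (betterCount_lt (by simpa [hS] using hx))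
  · rw [Finset.card_image_of_injOn hinj, Finset.card_range]
    exact le_of_eq rfl

/-- Descent on `betterCount`: replacing the current label by a better one strictly decreases the
number of better labels, all of which fit into `q` bits. -/
lemma exists_isOptimal (hχ : ∀ j x, χ j = some x → j < 2 ^ q) :
    ∃ o, IsOptimal χ chiMax used o := by
  have key : ∀ k best, betterCount χ chiMax used q best = k → ValidBest χ chiMax used best →
      ∃ o, IsOptimal χ chiMax used o := by
    intro k
    induction k using Nat.strong_induction_on with
    | _ k ih =>
      intro best hk hb
      by_cases h : ∃ j, Better χ chiMax used best j
      · obtain ⟨j, hj⟩ := h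
        obtain ⟨_, x, hx, _⟩ := id hj
        obtain ⟨r, rfl⟩ := exists_regVal (hχ j x hx)
        exact ih _ (hk ▸ betterCount_lt hj) _ rfl (hj.of_valid hb).validBest_some
      · exact ⟨best, hb, not_exists.mp h⟩
  exact key _ none rfl validBest_none

end Better

/-! ### Quantum minimum finding -/

lemma expect_uniformBelow {m : ℕ} (hm : 0 < m) (F : ℕ → ℝ≥0∞) :
    expect (uniformBelow m) F = ∑ j ∈ Finset.range m, (m : ℝ≥0∞)⁻¹ * F j := by
  obtain ⟨m, rfl⟩ : ∃ k, m = k + 1 := ⟨m - 1, by omega⟩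
  unfold uniformBelow
  rw [expect_map, expect_fintype, Finset.sum_range]
  simp

section MinFinding
variable {L n : ℕ} (cfg : Config) (cm : CostModel) (ev : EventRecord L n)

/-- The state of quantum minimum finding after a round with `j` Grover iterations and outcome
`x`. -/
def nextMinState (marked : Option ℕ → ℕ → Prop) (rootN : ℝ) (s : MinState) (j x : ℕ) : MinState :=
  open Classical in
  if marked s.best x then ⟨s.calls + j + 1, 1, some x⟩
  else ⟨s.calls + j + 1, min (6 / 5 * s.bound) rootN, s.best⟩

/-- Cost of one oracle call in minimum finding, including its share of all other operations. -/
def findCallCost (n : ℕ) : ℕ :=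
  1 + (labelBits n + (cm.gate * labelBits n + (labelBits n + findOracleGates cfg cm n))) +
    labelBits n + findOracleGates cfg cm n

/-- Bound on the number of oracle calls in minimum finding. -/
def findCalls (n : ℕ) : ℕ := ⌈24.5 * √((2 : ℝ) ^ labelBits n)⌉₊

/-- The loop of quantum minimum finding for an arbitrary potential `θ`. -/
lemma spec_quantumMinimumFinding_of_potential (l : ℕ) (t : Candidate) (used : List ℕ)
    (Q : Option ℕ → Prop) (θ : MinState → ℝ≥0∞)
    (hend : ∀ s, ValidBest (chiOf cfg ev l t) cfg.chiMax used s.best → 1 ≤ s.bound →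
      22.5 * √((2 : ℝ) ^ labelBits n) ≤ s.calls → ¬ Q s.best → 1 ≤ θ s)
    (hstep : ∀ s, ValidBest (chiOf cfg ev l t) cfg.chiMax used s.best → 1 ≤ s.bound →
      s.bound ≤ √((2 : ℝ) ^ labelBits n) →
      ∑ j ∈ Finset.range ⌈s.bound⌉₊, (⌈s.bound⌉₊ : ℝ≥0∞)⁻¹ * ∑ x : Reg (Fin (labelBits n)),
        ENNReal.ofReal (groverAmp _ (fun x => Better (chiOf cfg ev l t) cfg.chiMax used s.best
          (regVal x)) (groverAngle fun x : Reg (Fin (labelBits n)) =>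
            Better (chiOf cfg ev l t) cfg.chiMax used s.best (regVal x)) j x ^ 2) *
        θ (nextMinState (Better (chiOf cfg ev l t) cfg.chiMax used) (√((2 : ℝ) ^ labelBits n)) s j
          (regVal x)) ≤ θ s) :
    Timed.Spec (quantumMinimumFinding cfg cm ev l t used) (findCallCost cfg cm n * findCalls n)
      (θ ⟨0, 1, none⟩) Q := by
  classical
  set q := labelBits n with hq
  set rootN : ℝ := √((2 : ℝ) ^ q) with hroot
  have hroot1 : 1 ≤ rootN := Real.one_le_sqrt.mpr (one_le_pow₀ (by norm_num))
  set marked := Better (chiOf cfg ev l t) cfg.chiMax used with hmarked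
  set g := findOracleGates cfg cm n with hg
  set G := findCallCost cfg cm n with hG
  set M := findCalls n with hM
  intro B b hb
  set body : MinState → Timed MinState := fun s => (do
    let j ← Timed.sample (uniformBelow ⌈s.bound⌉₊)
    let x ← groverSample (Fin q) cm (fun x => marked s.best (regVal x)) g j
    Timed.tick g
    if marked s.best (regVal x) then pure ⟨s.calls + j + 1, 1, some (regVal x)⟩
    else pure ⟨s.calls + j + 1, min (6 / 5 * s.bound) rootN, s.best⟩) with hbody
  have hrw : quantumMinimumFinding cfg cm ev l t used = (do
      let final ← Timed.whileLoop (fun s : MinState => (s.calls : ℝ) < 22.5 * rootN) body ⟨0, 1, none⟩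
      pure final.best) := rfl
  rw [hrw, Timed.loss_bind]
  simp only [Timed.loss_pure]
  set Inv : MinState → Prop := fun s => ValidBest (chiOf cfg ev l t) cfg.chiMax used s.best ∧
    1 ≤ s.bound ∧ s.bound ≤ rootN ∧ s.calls ≤ M with hInv
  -- The potential is raised to `1` as soon as the invariant fails or the unused time no longer
  -- covers `G` for each oracle call up to `M`. The step below shows that a round preserves both
  -- conditions, so that only `θ` matters.
  set Θ : MinState → ℕ → ℝ≥0∞ := fun s b =>
    if Inv s ∧ B + G * (M - s.calls) ≤ b then min (θ s) 1 else 1 with hΘ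
  have hΘ1 : ∀ s b, Θ s b ≤ 1 := fun s b => by
    simp only [hΘ]; split_ifs
    · exact min_le_right _ _
    · exact le_rfl
  have hMreal : 24.5 * rootN ≤ M := Nat.le_ceil _
  have hbodyrw : ∀ s, body s = (do
      let j ← Timed.sample (uniformBelow ⌈s.bound⌉₊)
      let x ← groverSample (Fin q) cm (fun x => marked s.best (regVal x)) g j
      Timed.tick g
      pure (nextMinState marked rootN s j (regVal x))) := by
    intro s
    simp only [hbody, nextMinState]
    congr 1; funext j; congr 1; funext x; congr 1; funext _
    split_ifs <;> rfl
  refine (Timed.loss_whileLoop_le (Θ := Θ) ?_ ?_ ?_ ?_ _ _).trans ?_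
  · intro s
    rw [hbodyrw]
    refine (Timed.nonInc_sample _).bind fun j => Timed.NonInc.bind ?_ fun x =>
      (Timed.nonInc_tick _).bind fun _ => Timed.nonInc_pure _
    exact (Timed.nonInc_tick _).bind fun _ => Timed.nonInc_sample _
  · intro s b hs
    push Not at hs
    by_cases h : Inv s ∧ B + G * (M - s.calls) ≤ b
    · simp only [hΘ, if_pos h]
      by_cases hQ : Q s.best ∧ B ≤ b
      · rw [if_pos hQ]; exact zero_le
      · rw [if_neg hQ]
        have hQ' : ¬ Q s.best := fun h' => hQ ⟨h', by have := h.2; omega⟩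
        exact le_min (hend s h.1.1 h.1.2.1 hs hQ') le_rfl
    · simp only [hΘ, if_neg h]
      split_ifs <;> simp
  · intro s hs
    have hlt : s.calls < M := by
      have : (s.calls : ℝ) < M := by linarith
      exact_mod_cast this
    have hGpos : 0 < G := by rw [hG]; unfold findCallCost; omega
    have : 0 < G * (M - s.calls) := Nat.mul_pos hGpos (by omega)
    simp only [hΘ]
    rw [if_neg (by rintro ⟨_, h⟩; omega)]
  · intro s b hs
    by_cases h : Inv s ∧ B + G * (M - s.calls) ≤ b + 1
    swap
    · simp only [hΘ, if_neg h]
      exact Timed.loss_le_one _ _ hΘ1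
    obtain ⟨⟨hv, hb1, hb2, hcalls⟩, hbud⟩ := id h
    simp only [hΘ, if_pos h]
    refine le_min ?_ (Timed.loss_le_one _ _ hΘ1)
    refine le_trans ?_ (hstep s hv hb1 hb2)
    have hceil : 0 < ⌈s.bound⌉₊ := Nat.ceil_pos.mpr (by linarith)
    rw [hbodyrw, Timed.loss_bind, Timed.loss_sample, expect_uniformBelow hceil]
    refine Finset.sum_le_sum fun j hj => ?_
    gcongr
    have hj' : j < ⌈s.bound⌉₊ := Finset.mem_range.mp hj
    have hjr : (j : ℝ) < s.bound := Nat.lt_ceil.mp hj'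
    -- The last round may overshoot: it starts below `22.5 √N` calls and adds fewer than `√N + 1 ≤ 2
    -- √N`, whence the `24.5` in `findCalls`.
    have hnewcalls : s.calls + j + 1 ≤ M := by
      have : ((s.calls + j + 1 : ℕ) : ℝ) < M := by push_cast; linarith
      exact_mod_cast this.le
    have hcost : B + G * (M - (s.calls + j + 1)) + groverGates (Fin q) cm g j + g ≤ b := by
      have e : M - s.calls = (M - (s.calls + j + 1)) + (j + 1) := by omega
      rw [e, mul_add] at hbud
      have : 1 + groverGates (Fin q) cm g j + g ≤ G * (j + 1) := by
        rw [hG]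
        unfold findCallCost groverGates
        rw [← hq, ← hg, Fintype.card_fin]
        nlinarith [Nat.zero_le j, Nat.zero_le q, Nat.zero_le g, Nat.zero_le (j * q), Nat.zero_le (j * g)]
      omega
    rw [Timed.loss_bind, loss_groverSample, if_pos (by omega)]
    refine Finset.sum_le_sum fun x _ => ?_
    gcongr
    rw [Timed.loss_bind, Timed.loss_tick, if_pos (by omega), Timed.loss_pure]
    have hinv : Inv (nextMinState marked rootN s j (regVal x)) ∧
        (nextMinState marked rootN s j (regVal x)).calls = s.calls + j + 1 := by
      unfold nextMinState
      split_ifs with hm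
      · exact ⟨⟨(hm.of_valid hv).validBest_some, le_rfl, hroot1, hnewcalls⟩, rfl⟩
      · exact ⟨⟨hv, le_min (by linarith) hroot1, min_le_right _ _, hnewcalls⟩, rfl⟩
    rw [if_pos ⟨hinv.1, by rw [hinv.2]; omega⟩]
    exact min_le_left _ _
  · simp only [hΘ]
    rw [if_pos ⟨⟨validBest_none, le_rfl, hroot1, Nat.zero_le _⟩, by simpa using hb⟩]
    exact min_le_left _ _

/-- With the zero potential only the invariant and the time account remain: an invalid result or an
overrun of the budget has probability zero, not merely a small one. -/
lemma spec_quantumMinimumFinding_valid (l : ℕ) (t : Candidate) (used : List ℕ) :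
    Timed.Spec (quantumMinimumFinding cfg cm ev l t used) (findCallCost cfg cm n * findCalls n) 0
      (ValidBest (chiOf cfg ev l t) cfg.chiMax used) :=
  spec_quantumMinimumFinding_of_potential cfg cm ev l t used _ (fun _ => 0)
    (fun s hv _ _ hn => absurd hv hn) (fun s _ _ _ => by simp)

lemma EventRecord.lt_of_load {ev : EventRecord L n} {l j : ℕ} {h : Hit}
    (hl : ev.load l j = some h) : j < n := by
  unfold EventRecord.load at hl
  split_ifs at hl with hc
  · exact hc.2

lemma lt_of_chiOf {l : ℕ} {t : Candidate} {j : ℕ} {x : ℝ} (h : chiOf cfg ev l t j = some x) :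
    j < n := by
  unfold chiOf at h
  rw [Option.map_eq_some_iff] at h
  obtain ⟨_, h, _⟩ := h
  exact EventRecord.lt_of_load h

lemma le_two_pow_labelBits (n : ℕ) : n ≤ 2 ^ labelBits n := Nat.le_pow_clog (by norm_num) n

lemma chiOf_label_lt (l : ℕ) (t : Candidate) (j : ℕ) (x : ℝ) (h : chiOf cfg ev l t j = some x) :
    j < 2 ^ labelBits n := (lt_of_chiOf cfg ev h).trans_le (le_two_pow_labelBits n)

/-- Quantum minimum finding succeeds with probability at least `1 / 2`. -/
lemma spec_quantumMinimumFinding (hn : 136 ^ 4 ≤ n) (l : ℕ) (t : Candidate) (used : List ℕ) :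
    Timed.Spec (quantumMinimumFinding cfg cm ev l t used) (findCallCost cfg cm n * findCalls n)
      (ENNReal.ofReal (1 / 2)) (IsOptimal (chiOf cfg ev l t) cfg.chiMax used) := by
  classical
  set χ := chiOf cfg ev l t with hχ
  set q := labelBits n with hq
  set N : ℝ := (2 : ℝ) ^ q with hN
  set R : ℝ := 22.5 * √N with hR
  have hNn : (n : ℝ) ≤ N := by rw [hN]; exact_mod_cast le_two_pow_labelBits n
  have hNbig : 136 ^ 4 ≤ N := le_trans (by exact_mod_cast hn) hNn
  have hN1 : 1 ≤ N := by linarith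
  have hsN : 1 ≤ √N := Real.one_le_sqrt.mpr hN1
  have hR0 : 0 < R := by rw [hR]; positivity
  have hlab : ∀ j x, χ j = some x → j < 2 ^ q := chiOf_label_lt cfg ev l t
  set cnt : Option ℕ → ℕ := betterCount χ cfg.chiMax used q with hcnt
  -- Markov's inequality as a potential: calls made plus expected calls to come, relative to the
  -- limit `R`. A run stopped without the optimum has value at least `1`, while the start has value
  -- at most `(45 / 4) / 22.5 = 1 / 2`.
  set θ : MinState → ℝ≥0∞ := fun s => if cnt s.best = 0 then 0 else
    ENNReal.ofReal ((s.calls + minPotential N s.bound (cnt s.best)) / R) with hθ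
  have hcntle : ∀ o, (cnt o : ℝ) ≤ N := fun o => by
    have := markedCount_le fun x : Reg (Fin q) => Better χ cfg.chiMax used o (regVal x)
    rw [Fintype.card_fin] at this
    rw [hN]; exact_mod_cast this
  refine (spec_quantumMinimumFinding_of_potential cfg cm ev l t used _ θ ?_ ?_).mono le_rfl ?_
    fun _ h => h
  · intro s hv hb1 hcalls hnot
    have h0 : cnt s.best ≠ 0 := fun h => hnot ⟨hv, (betterCount_eq_zero hlab).mp h⟩
    simp only [hθ, if_neg h0]
    rw [ENNReal.one_le_ofReal, one_le_div hR0]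
    have := minPotential_nonneg (N := N) (show 0 < s.bound by linarith) (cnt s.best)
    linarith
  · intro s hv hb1 hb2
    set f : Reg (Fin q) → Prop := fun x => Better χ cfg.chiMax used s.best (regVal x) with hf
    set m := ⌈s.bound⌉₊ with hm
    have hm0 : 0 < m := Nat.ceil_pos.mpr (by linarith)
    have hmR : (0 : ℝ) < m := by exact_mod_cast hm0
    have hmb : (m : ℝ) < s.bound + 1 := Nat.ceil_lt_add_one (by linarith)
    have hbm : s.bound ≤ m := Nat.le_ceil _
    by_cases h0 : cnt s.best = 0
    · have hz : ∀ j x, θ (nextMinState (Better χ cfg.chiMax used) √N s j x) = 0 := by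
        intro j x
        have hno := (betterCount_eq_zero hlab).mp h0
        simp only [hθ, nextMinState, if_neg (hno x), if_pos h0]
      refine le_trans (le_of_eq (Finset.sum_eq_zero fun j _ => ?_)) zero_le
      rw [Finset.sum_eq_zero fun x _ => mul_eq_zero_of_right _ (hz j (regVal x)), mul_zero]
    have htpos : 0 < cnt s.best := Nat.pos_of_ne_zero h0
    set T := cnt s.best with hT
    have hTmark : markedCount f = T := rfl
    have hTR : (0 : ℝ) < T := by exact_mod_cast htpos
    set bd := min (6 / 5 * s.bound) √N with hbd
    have hbd0 : 0 < bd := lt_min (by linarith) (by linarith)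
    set val : ℕ → Reg (Fin q) → ℝ := fun j x =>
      (s.calls + j + 1 + if f x then minPotential N 1 (cnt (some (regVal x)))
        else minPotential N bd T) / R with hval
    have hvalnn : ∀ j x, 0 ≤ val j x := by
      intro j x
      apply div_nonneg _ hR0.le
      split_ifs
      · have := minPotential_nonneg (N := N) one_pos (cnt (some (regVal x))); positivity
      · have := minPotential_nonneg (N := N) hbd0 T; positivity
    have hθle : ∀ j x, θ (nextMinState (Better χ cfg.chiMax used) √N s j (regVal x)) ≤
        ENNReal.ofReal (val j x) := by
      intro j x
      by_cases hx : f x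
      · have e : nextMinState (Better χ cfg.chiMax used) √N s j (regVal x) =
            ⟨s.calls + j + 1, 1, some (regVal x)⟩ := if_pos hx
        rw [e]
        simp only [hθ, hval, if_pos hx]
        split_ifs
        · exact zero_le
        · push_cast; exact le_rfl
      · have e : nextMinState (Better χ cfg.chiMax used) √N s j (regVal x) =
            ⟨s.calls + j + 1, bd, s.best⟩ := if_neg hx
        rw [e]
        simp only [hθ, hval, if_neg hx, ← hT, if_neg h0]
        push_cast; exact le_rfl
    have hsum : ∀ j : ℕ, ∑ x : Reg (Fin q), groverAmp _ f (groverAngle f) j x ^ 2 * val j x =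
        (s.calls + j + 1 + restPotential N T +
          (1 - Real.sin ((2 * j + 1) * groverAngle f) ^ 2) * searchPotential N T bd) / R := by
      intro j
      rw [sum_groverAmp_sq f j (val j) ((s.calls + j + 1 + minPotential N bd T) / R)
        (fun x hx => by simp only [hval, if_neg hx]), hTmark]
      -- Measured marked labels are uniformly distributed, so the new count runs through `0, …, T -
      -- 1` and `sum_minPotential` applies.
      have e1 : ∑ x ∈ Finset.univ.filter f, val j x =
          (T * (s.calls + j + 1) + T * restPotential N T) / R := by
        rw [← sum_minPotential]
        rw [hT, ← sum_betterCount hv (minPotential N 1)]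
        have : ∀ x ∈ Finset.univ.filter f, val j x = (s.calls + j + 1) / R +
            minPotential N 1 (betterCount χ cfg.chiMax used q (some (regVal x))) / R := by
          intro x hx
          have hx' : f x := by simpa using hx
          simp only [hval, if_pos hx', hcnt]
          rw [add_div]
        rw [Finset.sum_congr rfl this, Finset.sum_add_distrib, Finset.sum_const, nsmul_eq_mul,
          ← Finset.sum_div, ← mul_div_assoc, ← add_div]
        rfl
      rw [e1, Real.cos_sq']
      have e2 : minPotential N bd T = searchPotential N T bd + restPotential N T := by
        unfold minPotential; rw [if_neg h0]
      rw [e2]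
      field_simp
      ring
    calc _ ≤ ∑ j ∈ Finset.range m, (m : ℝ≥0∞)⁻¹ * ∑ x : Reg (Fin q),
          ENNReal.ofReal (groverAmp _ f (groverAngle f) j x ^ 2) * ENNReal.ofReal (val j x) := by
          gcongr with j _ x _
          exact hθle j x
      _ = ENNReal.ofReal (∑ j ∈ Finset.range m, (m : ℝ)⁻¹ * ∑ x : Reg (Fin q),
          groverAmp _ f (groverAngle f) j x ^ 2 * val j x) := by
          rw [ENNReal.ofReal_sum_of_nonneg]
          · refine Finset.sum_congr rfl fun j _ => ?_
            rw [ENNReal.ofReal_mul (by positivity), ENNReal.ofReal_inv_of_pos hmR,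
              ENNReal.ofReal_natCast, ENNReal.ofReal_sum_of_nonneg]
            · congr 1
              refine Finset.sum_congr rfl fun x _ => ?_
              rw [ENNReal.ofReal_mul (by positivity)]
            · intro x _
              exact mul_nonneg (by positivity) (hvalnn j x)
          · intro j _
            exact mul_nonneg (by positivity) (Finset.sum_nonneg fun x _ =>
              mul_nonneg (by positivity) (hvalnn j x))
      _ ≤ θ s := by
          simp only [hθ]
          rw [← hT, if_neg h0]
          apply ENNReal.ofReal_le_ofReal
          rw [← Finset.mul_sum, Finset.sum_congr rfl fun j _ => hsum j, ← Finset.sum_div,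
            mul_div_assoc']
          gcongr
          set P : ℝ := (∑ j ∈ Finset.range m, Real.sin ((2 * j + 1) * groverAngle f) ^ 2) / m with hP
          -- With the test of the outcome included, a round makes `j + 1` calls, on average `(m + 1)
          -- / 2`, which is below `b / 2 + 1` as `m` is the ceiling of the bound `b`.
          have hgauss : ∑ j ∈ Finset.range m, (j : ℝ) = m * (m - 1) / 2 := by
            have : ∀ k : ℕ, ∑ j ∈ Finset.range k, (j : ℝ) = k * (k - 1) / 2 := by
              intro k
              induction k with
              | zero => simp
              | succ k ih => rw [Finset.sum_range_succ, ih]; push_cast; ring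
            exact this m
          have e1 : (m : ℝ)⁻¹ * ∑ j ∈ Finset.range m, ((s.calls : ℝ) + j + 1 + restPotential N T +
              (1 - Real.sin ((2 * j + 1) * groverAngle f) ^ 2) * searchPotential N T bd) =
              s.calls + (m + 1) / 2 + restPotential N T + (1 - P) * searchPotential N T bd := by
            rw [Finset.sum_add_distrib, Finset.sum_add_distrib, Finset.sum_add_distrib,
              Finset.sum_add_distrib, ← Finset.sum_mul, Finset.sum_sub_distrib, hgauss, hP]
            simp only [Finset.sum_const, Finset.card_range, nsmul_eq_mul]
            generalize ∑ j ∈ Finset.range m, Real.sin ((2 * (j : ℝ) + 1) * groverAngle f) ^ 2 = S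
            field_simp
            ring
          rw [e1]
          have e2 : minPotential N s.bound T = searchPotential N T s.bound + restPotential N T := by
            unfold minPotential; rw [if_neg h0]
          rw [e2]
          have hP0 : 0 ≤ P := div_nonneg (Finset.sum_nonneg fun _ _ => by positivity) hmR.le
          have hPq : criticalBound N T ≤ s.bound → 1 / 4 ≤ P := by
            intro hc
            rw [hP, le_div_iff₀ hmR]
            have := sum_sin_sq_ge (N := N) (θ := groverAngle f) (t := T) (m := m) (by linarith)
              htpos (groverAngle_nonneg f) (groverAngle_le f)
              (by rw [sin_sq_groverAngle, hTmark, Fintype.card_fin]) (hc.trans hbm)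
            linarith
          have := searchPotential_step hN1 htpos hb1 hb2 hP0 hPq
          linarith
  · simp only [hθ]
    split_ifs
    · simp
    · apply ENNReal.ofReal_le_ofReal
      rw [div_le_iff₀ hR0]
      have := minPotential_le hNbig (hcntle none)
      push_cast
      rw [hR]
      linarith

end MinFinding

/-! ### Repetition of minimum finding -/

namespace Timed
variable {α β : Type}

lemma spec_of_one_le (x : Timed α) (T : ℕ) {ε : ℝ≥0∞} (hε : 1 ≤ ε) (Q : α → Prop) :
    Spec x T ε Q := fun B b _ =>
  (loss_le_one _ _ fun _ _ => by split_ifs <;> simp).trans hε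

lemma spec_foldlM_fixed (F : β → α → Timed β) (opt : β) (T : ℕ)
    (h : ∀ a, Spec (F opt a) T 0 fun s => s = opt) (l : List α) :
    Spec (l.foldlM F opt) (l.length * T) 0 fun s => s = opt := by
  have := spec_foldlM F (fun _ s => s = opt) T 0 l 0 opt rfl fun j _ s hs => by
    subst hs; exact h _
  simpa using this

/-- Repeating a computation that reaches a stable optimum with probability `1 - δ`. -/
lemma spec_foldlM_amplify (F : β → α → Timed β) (opt : β) (I : β → Prop) (T : ℕ) (δ : ℝ≥0∞)
    (hI : ∀ s a, I s → Spec (F s a) T 0 I)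
    (hδ : ∀ s a, I s → Spec (F s a) T δ fun s' => s' = opt)
    (hfix : ∀ a, Spec (F opt a) T 0 fun s' => s' = opt) (l : List α) (s : β) (hs : I s) :
    Spec (l.foldlM F s) (l.length * T) (δ ^ l.length) fun s' => s' = opt := by
  classical
  induction l generalizing s with
  | nil => exact spec_of_one_le _ _ (by simp) _
  | cons a l ih =>
    intro B b hb
    rw [List.length_cons, add_mul, one_mul] at hb
    rw [List.foldlM_cons, loss_bind]
    -- If this step reaches the optimum, `hfix` keeps it there for the rest of the list at no risk.
    -- If it misses, with weight `δ`, the remaining steps still fail only with probability `δ ^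
    -- l.length`.
    refine (loss_le_add_mul (F s a) b
      (Θ₁ := fun s' b' => if I s' ∧ B + l.length * T ≤ b' then 0 else 1)
      (Θ₂ := fun s' b' => if s' = opt ∧ B + l.length * T ≤ b' then 0 else 1)
      (δ ^ l.length) fun s' b' => ?_).trans ?_
    · by_cases h1 : I s' ∧ B + l.length * T ≤ b'
      · rw [if_pos h1, zero_add]
        by_cases h2 : s' = opt
        · subst h2
          rw [if_pos ⟨rfl, h1.2⟩, mul_zero]
          exact spec_foldlM_fixed F s' T hfix l B b' h1.2
        · rw [if_neg (fun h => h2 h.1), mul_one]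
          exact ih s' h1.1 B b' h1.2
      · rw [if_neg h1]
        exact (loss_le_one _ _ fun _ _ => by split_ifs <;> simp).trans le_self_add
    · have e1 := hI s a hs (B + l.length * T) b (by omega)
      have e2 := hδ s a hs (B + l.length * T) b (by omega)
      rw [List.length_cons, pow_succ]
      calc _ ≤ 0 + δ ^ l.length * δ := by gcongr
        _ = _ := zero_add _

lemma spec_forEach (l : List α) (f : α → Timed (List β)) (g : α → List β) (T : ℕ) (ε : ℝ≥0∞)
    (h : ∀ a ∈ l, Spec (f a) T ε fun r => r = g a) :
    Spec (forEach l f) (l.length * T) (l.length * ε) fun r => r = l.flatMap g := by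
  have := spec_foldlM (fun acc a => (do
    let r ← f a
    pure (acc ++ r) : Timed (List β))) (fun i acc => acc = (l.take i).flatMap g) T ε l 0 [] (by simp)
    fun j hj acc hacc => by
      rw [zero_add] at hacc ⊢
      refine ((h l[j] (List.getElem_mem hj)).bind (T₂ := 0) (ε₂ := 0) (fun r hr => spec_pure _ ?_)).mono
        (by simp) (by simp) (fun _ h => h)
      rw [hacc, hr, List.take_add_one, List.getElem?_eq_getElem hj, List.flatMap_append]
      simp
  rw [zero_add, List.take_length] at this
  exact this

end Timed

section Repeat
variable {L n : ℕ} (cfg : Config) (cm : CostModel) (ev : EventRecord L n)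

/-- Samples are always valid, so the running best stays valid; the optimum replaces any other valid
label and is never replaced. Hence failure means that all `r` independent runs missed the optimum.
-/
lemma spec_repeatedMinimumFinding (hn : 136 ^ 4 ≤ n) (l : ℕ) (t : Candidate) (used : List ℕ)
    (r : ℕ) :
    Timed.Spec (repeatedMinimumFinding cfg cm ev l t used r)
      (r * (findCallCost cfg cm n * findCalls n + cm.step)) (ENNReal.ofReal (1 / 2) ^ r)
      (IsOptimal (chiOf cfg ev l t) cfg.chiMax used) := by
  classical
  obtain ⟨opt, hopt⟩ := exists_isOptimal (χ := chiOf cfg ev l t) (chiMax := cfg.chiMax)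
    (used := used) (chiOf_label_lt cfg ev l t)
  set V := ValidBest (chiOf cfg ev l t) cfg.chiMax used with hV
  set W := Better (chiOf cfg ev l t) cfg.chiMax used with hW
  set comb : Option ℕ → Option ℕ → Option ℕ := fun best o =>
    match o with
    | none => best
    | some j => if W best j then some j else best with hcomb
  set F : Option ℕ → ℕ → Timed (Option ℕ) := fun best _ => (do
    let o ← quantumMinimumFinding cfg cm ev l t used
    Timed.tick cm.step
    pure (comb best o)) with hF
  have hrw : repeatedMinimumFinding cfg cm ev l t used r = (List.range r).foldlM F none := by
    unfold repeatedMinimumFinding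
    congr 1
    funext best _
    simp only [hF]
    congr 1
    funext o
    congr 1
    funext _
    cases o <;> rfl
  have hcombV : ∀ best o, V best → V o → V (comb best o) := by
    intro best o hb ho
    cases o with
    | none => exact hb
    | some j =>
      simp only [hcomb]
      split_ifs with h
      · exact ho
      · exact hb
  have hcombOpt : ∀ best, V best → comb best opt = opt := by
    intro best hb
    by_cases hne : best = opt
    · subst hne
      cases best with
      | none => rfl
      | some j => simp [hcomb]
    · obtain ⟨j, hj, hbet⟩ := hopt.better_of_ne hb hne
      rw [hj]
      simp only [hcomb]
      rw [if_pos hbet]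
  have hcombFix : ∀ o, comb opt o = opt := by
    intro o
    cases o with
    | none => rfl
    | some j =>
      simp only [hcomb]
      rw [if_neg (hopt.2 j)]
  have htail : ∀ (Q : Option ℕ → Prop) x, Q x →
      Timed.Spec (do Timed.tick cm.step; pure x) cm.step 0 Q := fun Q x hx =>
    (Timed.spec_tick cm.step).bind_zero_left (T₂ := 0) fun _ _ => Timed.spec_pure _ hx
  rw [hrw]
  have hval := spec_quantumMinimumFinding_valid cfg cm ev l t used
  have hsucc := spec_quantumMinimumFinding cfg cm ev hn l t used
  have := Timed.spec_foldlM_amplify F opt V (findCallCost cfg cm n * findCalls n + cm.step)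
    (ENNReal.ofReal (1 / 2))
    (fun best _ hb => hval.bind_zero_left fun o ho => htail _ _ (hcombV best o hb ho))
    (fun best _ hb => by
      have := hsucc.bind (ε₂ := 0) (f := fun o => (do
        Timed.tick cm.step
        pure (comb best o) : Timed (Option ℕ))) (Q₂ := fun s' => s' = opt) fun o ho => htail _ _ (by
          rw [ho.unique hopt]; exact hcombOpt best hb)
      simpa using this)
    (fun _ => hval.bind_zero_left fun o _ => htail _ _ (hcombFix o))
    (List.range r) none validBest_none
  rw [List.length_range] at this
  exact this.mono le_rfl le_rfl fun o ho => ho ▸ hopt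

/-! ### Greedy choice of hits -/

open Classical in
/-- The best unused hit below the threshold. -/
def bestHit (χ : ℕ → Option ℝ) (chiMax : ℝ) (used : List ℕ) : Option ℕ :=
  if h : ∃ o, IsOptimal χ chiMax used o then h.choose else none

/-- The `i` best hits below the threshold, in order. -/
def greedyHits (χ : ℕ → Option ℝ) (chiMax : ℝ) : ℕ → List ℕ
  | 0 => []
  | i + 1 => match bestHit χ chiMax (greedyHits χ chiMax i) with
    | none => greedyHits χ chiMax i
    | some j => greedyHits χ chiMax i ++ [j]

lemma bestHit_optimal (l : ℕ) (t : Candidate) (used : List ℕ) :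
    IsOptimal (chiOf cfg ev l t) cfg.chiMax used (bestHit (chiOf cfg ev l t) cfg.chiMax used) := by
  have h := exists_isOptimal (χ := chiOf cfg ev l t) (chiMax := cfg.chiMax)
    (used := used) (chiOf_label_lt cfg ev l t)
  unfold bestHit
  rw [dif_pos h]
  exact h.choose_spec

/-- The result that quantum filtering aims at. -/
def greedyFilter (l : ℕ) (t : Candidate) : List Candidate :=
  orGhost cfg l t ((greedyHits (chiOf cfg ev l t) cfg.chiMax cfg.lam).map (extend cfg ev l t))

/-- The number of repetitions of minimum finding. -/
def findRepetitions (L n : ℕ) : ℕ := Nat.clog 2 (3 * L * cfg.lam ^ 2 * n ^ 3)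

/-- The cost of quantum filtering. -/
def filterCost (L n : ℕ) : ℕ :=
  2 * cm.step + cfg.lam * (findRepetitions cfg L n *
    (findCallCost cfg cm n * findCalls n + cm.step) + cm.step)

lemma spec_quantumFilter (hn : 136 ^ 4 ≤ n) (l : ℕ) (t : Candidate) :
    Timed.Spec (quantumFilter cfg cm ev l t) (filterCost cfg cm L n)
      (cfg.lam * ENNReal.ofReal (1 / 2) ^ findRepetitions cfg L n)
      fun r => r = greedyFilter cfg ev l t := by
  set r := findRepetitions cfg L n with hr
  set F : List ℕ → ℕ → Timed (List ℕ) := fun used _ => (do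
    let o ← repeatedMinimumFinding cfg cm ev l t used r
    match o with
    | none => pure used
    | some j => do
      Timed.tick cm.step
      pure (used ++ [j])) with hF
  have hrw : quantumFilter cfg cm ev l t = (do
      Timed.tick cm.step
      let used ← (List.range cfg.lam).foldlM F []
      Timed.tick cm.step
      pure (orGhost cfg l t (used.map (extend cfg ev l t)))) := rfl
  rw [hrw]
  have hfold := Timed.spec_foldlM F
    (fun i used => used = greedyHits (chiOf cfg ev l t) cfg.chiMax i)
    (r * (findCallCost cfg cm n * findCalls n + cm.step) + cm.step) (ENNReal.ofReal (1 / 2) ^ r)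
    (List.range cfg.lam) 0 [] rfl fun i _ used hused => by
      rw [zero_add] at hused ⊢
      have := (spec_repeatedMinimumFinding cfg cm ev hn l t used r).bind (T₂ := cm.step) (ε₂ := 0)
        (f := fun o => (match o with
          | none => pure used
          | some j => do
            Timed.tick cm.step
            pure (used ++ [j]) : Timed (List ℕ)))
        (Q₂ := fun used' => used' = greedyHits (chiOf cfg ev l t) cfg.chiMax (i + 1)) fun o ho => by
          have ho' : o = bestHit (chiOf cfg ev l t) cfg.chiMax
              (greedyHits (chiOf cfg ev l t) cfg.chiMax i) := by
            rw [← hused]; exact ho.unique (bestHit_optimal cfg ev l t used)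
          cases o with
          | none =>
            refine (Timed.spec_pure used ?_).mono (Nat.zero_le _) le_rfl fun _ h => h
            rw [greedyHits, ← ho', hused]
          | some j =>
            refine (Timed.spec_tick cm.step).bind_zero_left (T₂ := 0) fun _ _ =>
              Timed.spec_pure _ ?_
            rw [greedyHits, ← ho', hused]
      simpa using this
  rw [List.length_range, zero_add] at hfold
  have := (Timed.spec_tick cm.step).bind_zero_left fun _ _ =>
    hfold.bind (T₂ := cm.step) (ε₂ := 0) (f := fun used => (do
      Timed.tick cm.step
      pure (orGhost cfg l t (used.map (extend cfg ev l t))) : Timed (List Candidate)))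
      (Q₂ := fun r => r = greedyFilter cfg ev l t) fun used hused =>
        (Timed.spec_tick cm.step).bind_zero_left (T₂ := 0) fun _ _ =>
          Timed.spec_pure _ (by rw [hused, greedyFilter])
  refine this.mono (by unfold filterCost; rw [← hr]; omega) (by simp) fun _ h => h

end Repeat

/-! ### Counted computations -/

namespace Counted
variable {α β : Type}

lemma val_pure (a : α) : (pure a : Counted α).val = a := rfl
lemma cost_pure (a : α) : (pure a : Counted α).cost = 0 := rfl
lemma val_bind (x : Counted α) (f : α → Counted β) : (x >>= f).val = (f x.val).val := rfl
lemma cost_bind (x : Counted α) (f : α → Counted β) :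
    (x >>= f).cost = x.cost + (f x.val).cost := rfl
lemma cost_tick (c : ℕ) : (tick c).cost = c := rfl

lemma val_foldlM (f : β → α → Counted β) (l : List α) (s : β) :
    (l.foldlM f s).val = l.foldl (fun s a => (f s a).val) s := by
  induction l generalizing s with
  | nil => rfl
  | cons a l ih => rw [List.foldlM_cons, val_bind, ih]; rfl

/-- The cost of a loop, for an invariant `I`. -/
lemma cost_foldlM_le (f : β → α → Counted β) (I : ℕ → β → Prop) (c : ℕ) (l : List α)
    (i : ℕ) (s : β) (h0 : I i s)
    (h : ∀ j (hj : j < l.length) s, I (i + j) s →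
      (f s l[j]).cost ≤ c ∧ I (i + j + 1) (f s l[j]).val) :
    (l.foldlM f s).cost ≤ l.length * c ∧ I (i + l.length) (l.foldlM f s).val := by
  induction l generalizing i s with
  | nil => exact ⟨Nat.zero_le _, h0⟩
  | cons a l ih =>
    rw [List.foldlM_cons, cost_bind, val_bind]
    have h1 := h 0 (by simp) s h0
    have h2 := ih (i + 1) (f s a).val h1.2 fun j hj s hs => by
      have := h (j + 1) (by simpa using hj) s (by rwa [show i + (j + 1) = i + 1 + j by ring])
      rwa [show i + (j + 1) + 1 = i + 1 + j + 1 by ring] at this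
    refine ⟨?_, ?_⟩
    · rw [List.length_cons, add_mul, one_mul]
      have := h1.1
      simp only [List.getElem_cons_zero] at this
      omega
    · have := h2.2
      rwa [show i + 1 + l.length = i + (l.length + 1) by ring] at this

lemma forEach_eq (l : List α) (f : α → Counted (List β)) :
    (forEach l f).val = l.flatMap (fun a => (f a).val) ∧
      (forEach l f).cost = (l.map fun a => (f a).cost).sum := by
  have key : ∀ (l : List α) acc, (l.foldlM (fun acc a => (do
      let r ← f a
      pure (acc ++ r) : Counted (List β))) acc).val = acc ++ l.flatMap (fun a => (f a).val) ∧
      (l.foldlM (fun acc a => (do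
      let r ← f a
      pure (acc ++ r) : Counted (List β))) acc).cost = (l.map fun a => (f a).cost).sum := by
    intro l
    induction l with
    | nil => intro acc; exact ⟨by simp [val_pure], rfl⟩
    | cons a l ih =>
      intro acc
      rw [List.foldlM_cons, val_bind, cost_bind]
      obtain ⟨h1, h2⟩ := ih (acc ++ (f a).val)
      refine ⟨?_, ?_⟩
      · refine Eq.trans h1 ?_
        simp
      · refine Eq.trans (congrArg _ h2) ?_
        simp [cost_bind, cost_pure]
  have := key l []
  rw [List.nil_append] at this
  exact this

lemma val_forEach (l : List α) (f : α → Counted (List β)) :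
    (forEach l f).val = l.flatMap (fun a => (f a).val) := (forEach_eq l f).1

lemma cost_forEach (l : List α) (f : α → Counted (List β)) :
    (forEach l f).cost = (l.map fun a => (f a).cost).sum := (forEach_eq l f).2

lemma cost_forEach_le (l : List α) (f : α → Counted (List β)) (c : ℕ)
    (h : ∀ a ∈ l, (f a).cost ≤ c) : (forEach l f).cost ≤ l.length * c := by
  rw [cost_forEach]
  have := List.sum_le_card_nsmul (l.map fun a => (f a).cost) c (by simpa using h)
  simpa using this

lemma le_cost_forEach (l : List α) (f : α → Counted (List β)) (c : ℕ)
    (h : ∀ a ∈ l, c ≤ (f a).cost) : l.length * c ≤ (forEach l f).cost := by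
  rw [cost_forEach]
  have := List.card_nsmul_le_sum (l.map fun a => (f a).cost) c (by simpa using h)
  simpa using this

end Counted

/-! ### Selection of the best candidates -/

section Select
variable (cfg : Config)

/-- One step of the selection of the best candidates. -/
def selectStep (l : ℕ) (best : List Candidate) (t : Candidate) : List Candidate :=
  (insertByQuality cfg l t best).take cfg.lam

lemma val_selectBest (cm : CostModel) (l : ℕ) (ts : List Candidate) :
    (selectBest cfg cm l ts).val = ts.foldl (selectStep cfg l) [] := by
  unfold selectBest
  rw [Counted.val_foldlM]
  rfl

/-- What lies behind position `k` before an insertion cannot come forward. Truncation can therefore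
be postponed, and the selection can be studied through untruncated insertions. -/
lemma take_insertByQuality (l : ℕ) (t : Candidate) (k : ℕ) (us : List Candidate) :
    (insertByQuality cfg l t (us.take k)).take k = (insertByQuality cfg l t us).take k := by
  induction us generalizing k with
  | nil => simp
  | cons u us ih =>
    cases k with
    | zero => simp
    | succ k =>
      rw [List.take_succ_cons, insertByQuality, insertByQuality]
      split_ifs
      · rw [List.take_succ_cons, List.take_succ_cons]
        congr 1
        cases k with
        | zero => simp
        | succ k => rw [List.take_succ_cons, List.take_succ_cons, List.take_take]; simp
      · rw [List.take_succ_cons, List.take_succ_cons, ih]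

/-- The order of insertion matters only between candidates of equal quality, where the earlier one
stays in front. -/
lemma insertByQuality_comm (l : ℕ) {t u : Candidate} (h : quality cfg l t ≠ quality cfg l u)
    (us : List Candidate) :
    insertByQuality cfg l u (insertByQuality cfg l t us) =
      insertByQuality cfg l t (insertByQuality cfg l u us) := by
  induction us with
  | nil =>
    simp only [insertByQuality]
    rcases lt_or_gt_of_ne h with h | h
    · rw [if_pos h, if_neg h.not_gt]
    · rw [if_neg h.not_gt, if_pos h]
  | cons a us ih =>
    by_cases h1 : quality cfg l a < quality cfg l t <;>
      by_cases h2 : quality cfg l a < quality cfg l u <;>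
      rcases lt_or_gt_of_ne h with h3 | h3
    · simp [insertByQuality, h1, h2, h3, h3.not_gt]
    · simp [insertByQuality, h1, h2, h3, h3.not_gt]
    · exact absurd (h1.trans h3) h2
    · simp [insertByQuality, h1, h2, h3.not_gt]
    · simp [insertByQuality, h1, h2, h3.not_gt]
    · exact absurd (h2.trans h3) h1
    · simp [insertByQuality, h1, h2, ih]
    · simp [insertByQuality, h1, h2, ih]

lemma selectStep_comm (l : ℕ) {t u : Candidate} (h : quality cfg l t ≠ quality cfg l u)
    (us : List Candidate) :
    selectStep cfg l (selectStep cfg l us t) u = selectStep cfg l (selectStep cfg l us u) t := by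
  unfold selectStep
  rw [take_insertByQuality, take_insertByQuality, insertByQuality_comm cfg l h]

lemma foldl_selectStep_move (l : ℕ) (t : Candidate) (c₁ c₂ acc : List Candidate)
    (h : ∀ c ∈ c₁, quality cfg l c ≠ quality cfg l t) :
    (c₁ ++ t :: c₂).foldl (selectStep cfg l) acc = (t :: (c₁ ++ c₂)).foldl (selectStep cfg l) acc := by
  induction c₁ generalizing acc with
  | nil => rfl
  | cons c c₁ ih =>
    rw [List.cons_append, List.foldl_cons, ih _ fun c' hc' => h c' (List.mem_cons_of_mem _ hc')]
    simp only [List.cons_append, List.foldl_cons]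
    rw [selectStep_comm cfg l (h c List.mem_cons_self)]

lemma insertByQuality_eq_append (l : ℕ) (t : Candidate) (us : List Candidate)
    (h : ∀ u ∈ us, quality cfg l t ≤ quality cfg l u) : insertByQuality cfg l t us = us ++ [t] := by
  induction us with
  | nil => rfl
  | cons u us ih =>
    rw [insertByQuality, if_neg (h u List.mem_cons_self).not_gt,
      ih fun v hv => h v (List.mem_cons_of_mem _ hv)]
    rfl

/-- Inserting a candidate of quality at least `v` prolongs the initial segment of such
candidates. -/
lemma exists_prefix_insertByQuality (l : ℕ) (v : ℝ) (t : Candidate) (ht : v ≤ quality cfg l t)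
    (good rest : List Candidate) (hg : ∀ u ∈ good, v ≤ quality cfg l u) :
    ∃ good' rest', insertByQuality cfg l t (good ++ rest) = good' ++ rest' ∧
      good'.length = good.length + 1 ∧ ∀ u ∈ good', v ≤ quality cfg l u := by
  induction good with
  | nil =>
    cases rest with
    | nil => exact ⟨[t], [], rfl, rfl, by simpa using ht⟩
    | cons a rest =>
      rw [List.nil_append, insertByQuality]
      split_ifs with h
      · exact ⟨[t], a :: rest, rfl, rfl, by simpa using ht⟩
      · exact ⟨[a], insertByQuality cfg l t rest, rfl, rfl, by simp; linarith⟩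
  | cons a good ih =>
    rw [List.cons_append, insertByQuality]
    split_ifs with h
    · refine ⟨t :: a :: good, rest, rfl, rfl, ?_⟩
      intro u hu
      rcases List.mem_cons.mp hu with rfl | hu
      · exact ht
      · exact hg u hu
    · obtain ⟨g', r', e, hl, hg'⟩ := ih fun u hu => hg u (List.mem_cons_of_mem _ hu)
      refine ⟨a :: g', r', by rw [e]; rfl, by simp [hl], ?_⟩
      intro u hu
      rcases List.mem_cons.mp hu with rfl | hu
      · exact hg _ List.mem_cons_self
      · exact hg' u hu

/-- The candidates of quality at least `v` form an initial segment growing by one per insertion, and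
truncation cannot cut into it as long as it has at most `lam` elements. After `lam` such insertions
it is the whole list. -/
lemma exists_prefix_foldl_selectStep (l : ℕ) (v : ℝ) (ts : List Candidate)
    (hts : ∀ t ∈ ts, v ≤ quality cfg l t) (good rest : List Candidate)
    (hg : ∀ u ∈ good, v ≤ quality cfg l u) (hlen : good.length + ts.length ≤ cfg.lam) :
    ∃ good' rest', ts.foldl (selectStep cfg l) (good ++ rest) = good' ++ rest' ∧
      good'.length = good.length + ts.length ∧ ∀ u ∈ good', v ≤ quality cfg l u := by
  induction ts generalizing good rest with
  | nil => exact ⟨good, rest, rfl, by simp, hg⟩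
  | cons t ts ih =>
    obtain ⟨g', r', e, hl, hg'⟩ := exists_prefix_insertByQuality cfg l v t
      (hts t List.mem_cons_self) good rest hg
    rw [List.length_cons] at hlen
    obtain ⟨g'', r'', e', hl', hg''⟩ := ih (fun u hu => hts u (List.mem_cons_of_mem _ hu)) g'
      (r'.take (cfg.lam - g'.length)) hg' (by omega)
    refine ⟨g'', r'', ?_, by rw [hl', hl, List.length_cons]; omega, hg''⟩
    rw [← e', List.foldl_cons, selectStep, e, List.take_append, List.take_of_length_le (by omega)]

lemma length_selectStep_le (l : ℕ) (us : List Candidate) (t : Candidate) :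
    (selectStep cfg l us t).length ≤ cfg.lam := List.length_take_le _ _

lemma length_foldl_selectStep_le (l : ℕ) (ts acc : List Candidate) (h : acc.length ≤ cfg.lam) :
    (ts.foldl (selectStep cfg l) acc).length ≤ cfg.lam := by
  induction ts generalizing acc with
  | nil => exact h
  | cons t ts ih => exact ih _ (length_selectStep_le cfg l _ _)

/-- After `lam` candidates have been inserted, worse ones do not change the selection. -/
lemma foldl_selectStep_drop (l : ℕ) (ts ds acc : List Candidate) (hlen : ts.length = cfg.lam)
    (hacc : acc.length ≤ cfg.lam)
    (h : ∀ d ∈ ds, ∀ t ∈ ts, quality cfg l d ≤ quality cfg l t) :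
    ds.foldl (selectStep cfg l) (ts.foldl (selectStep cfg l) acc) =
      ts.foldl (selectStep cfg l) acc := by
  set r := ts.foldl (selectStep cfg l) acc with hr
  have hrlen : r.length ≤ cfg.lam := length_foldl_selectStep_le cfg l ts acc hacc
  have hstep : ∀ d ∈ ds, selectStep cfg l r d = r := by
    intro d hd
    obtain ⟨g, s, e, hl, hg⟩ := exists_prefix_foldl_selectStep cfg l (quality cfg l d) ts (h d hd)
      [] acc (by simp) (by simp [hlen])
    rw [List.nil_append, ← hr] at e
    simp only [List.length_nil, zero_add] at hl
    have hs : s = [] := by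
      have : r.length = g.length + s.length := by rw [e, List.length_append]
      exact List.length_eq_zero_iff.mp (by omega)
    rw [hs, List.append_nil] at e
    unfold selectStep
    rw [insertByQuality_eq_append cfg l d r (by rw [e]; exact hg),
      List.take_append_of_le_length (by rw [e]; omega), List.take_of_length_le hrlen]
  clear_value r
  induction ds with
  | nil => rfl
  | cons d ds ih =>
    rw [List.foldl_cons, hstep d List.mem_cons_self]
    exact ih (fun d hd => h d (List.mem_cons_of_mem _ hd)) fun d hd =>
      hstep d (List.mem_cons_of_mem _ hd)

end Select

/-! ### Filtering by all hits compared with filtering by the best `lam` hits -/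

section Greedy
variable {L n : ℕ} (cfg : Config) (cm : CostModel) (ev : EventRecord L n)

open Classical in
/-- The unused hits below the threshold, in the order of their labels. -/
def remainingHits (l : ℕ) (t : Candidate) (used : List ℕ) : List ℕ :=
  (List.range n).filter fun j => Better (chiOf cfg ev l t) cfg.chiMax used none j

lemma mem_remainingHits {l : ℕ} {t : Candidate} {used : List ℕ} {j : ℕ} :
    j ∈ remainingHits cfg ev l t used ↔ Better (chiOf cfg ev l t) cfg.chiMax used none j := by
  classical
  unfold remainingHits
  rw [List.mem_filter, List.mem_range, decide_eq_true_iff]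
  refine ⟨fun h => h.2, fun h => ⟨?_, h⟩⟩
  obtain ⟨_, x, hx, _⟩ := h
  exact lt_of_chiOf cfg ev hx

lemma quality_extend {l : ℕ} {t : Candidate} {j : ℕ} {x : ℝ} (h : chiOf cfg ev l t j = some x) :
    quality cfg l (extend cfg ev l t j) = l - t.ghosts - cfg.weight * (t.chi + x) := by
  unfold chiOf at h
  rw [Option.map_eq_some_iff] at h
  obtain ⟨m, hm, rfl⟩ := h
  simp [quality, extend, hm]

lemma val_classicalFilter (l : ℕ) (t : Candidate) :
    (classicalFilter cfg cm ev l t).val =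
      orGhost cfg l t ((remainingHits cfg ev l t []).map (extend cfg ev l t)) := by
  classical
  unfold classicalFilter
  simp only [Counted.val_bind, Counted.val_forEach, Counted.val_pure]
  congr 1
  unfold remainingHits
  rw [← List.flatMap_singleton' ((List.filter _ _).map _), List.flatMap_map]
  generalize List.range n = js
  induction js with
  | nil => rfl
  | cons j js ih =>
    rw [List.flatMap_cons, ih, List.filter_cons]
    have hiff : (∃ x, chiOf cfg ev l t j = some x ∧ x < cfg.chiMax) ↔
        Better (chiOf cfg ev l t) cfg.chiMax [] none j := by
      simp [Better]
    by_cases hc : ∃ x, chiOf cfg ev l t j = some x ∧ x < cfg.chiMax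
    · rw [if_pos hc, if_pos (by simpa using hiff.mp hc), List.flatMap_cons]
      rfl
    · rw [if_neg hc, if_neg (by simpa using fun h => hc (hiff.mpr h))]
      rfl

lemma remainingHits_split {l : ℕ} {t : Candidate} {used : List ℕ} {j : ℕ}
    (hj : Better (chiOf cfg ev l t) cfg.chiMax used none j) :
    ∃ c₁ c₂, remainingHits cfg ev l t used = c₁ ++ j :: c₂ ∧
      remainingHits cfg ev l t (used ++ [j]) = c₁ ++ c₂ ∧ j ∉ c₁ ∧ ∀ c ∈ c₁, c < j := by
  classical
  have hsorted : (remainingHits cfg ev l t used).Pairwise (· < ·) :=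
    List.Pairwise.filter _ List.pairwise_lt_range
  obtain ⟨c₁, c₂, e⟩ := List.append_of_mem ((mem_remainingHits cfg ev).mpr hj)
  rw [e, List.pairwise_append] at hsorted
  have hlt : ∀ c ∈ c₁, c < j := fun c hc => hsorted.2.2 c hc j List.mem_cons_self
  have hgt : ∀ c ∈ c₂, j < c := (List.pairwise_cons.mp hsorted.2.1).1
  refine ⟨c₁, c₂, e, ?_, fun h => lt_irrefl _ (hlt j h), hlt⟩
  have hfil : remainingHits cfg ev l t (used ++ [j]) =
      (remainingHits cfg ev l t used).filter fun c => c ≠ j := by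
    unfold remainingHits
    rw [List.filter_filter]
    apply List.filter_congr
    intro c _
    simp [Better, and_comm, and_assoc]
  rw [hfil, e, List.filter_append, List.filter_cons_of_neg (by simp)]
  congr 1
  · exact List.filter_eq_self.mpr fun c hc => by simpa using (hlt c hc).ne
  · exact List.filter_eq_self.mpr fun c hc => by simpa using ne_of_gt (hgt c hc)

/-- Choosing the `i` best hits first does not change the selection. -/
lemma foldl_selectStep_greedyHits (l : ℕ) (t : Candidate) (acc : List Candidate) (i : ℕ) :
    ((remainingHits cfg ev l t []).map (extend cfg ev l t)).foldl (selectStep cfg l) acc =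
      ((remainingHits cfg ev l t (greedyHits (chiOf cfg ev l t) cfg.chiMax i)).map
        (extend cfg ev l t)).foldl (selectStep cfg l)
        (((greedyHits (chiOf cfg ev l t) cfg.chiMax i).map (extend cfg ev l t)).foldl
          (selectStep cfg l) acc) := by
  induction i with
  | zero => rfl
  | succ i ih =>
    rw [ih, greedyHits]
    have hopt := bestHit_optimal cfg ev l t (greedyHits (chiOf cfg ev l t) cfg.chiMax i)
    revert hopt
    generalize bestHit (chiOf cfg ev l t) cfg.chiMax
      (greedyHits (chiOf cfg ev l t) cfg.chiMax i) = o
    intro hopt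
    cases o with
    | none => rfl
    | some j =>
      simp only
      obtain ⟨c₁, c₂, e₁, e₂, hj, hlt⟩ := remainingHits_split cfg ev (hopt.1 j rfl)
      rw [e₁, e₂, List.map_append, List.map_cons, foldl_selectStep_move, List.map_append,
        List.map_append, List.map_singleton, List.foldl_append (l := List.map _ _) (l' := [_])]
      · rfl
      · intro c hc
        obtain ⟨a, ha, rfl⟩ := List.mem_map.mp hc
        have ha' : a ∈ remainingHits cfg ev l t (greedyHits (chiOf cfg ev l t) cfg.chiMax i) := by
          rw [e₁]; exact List.mem_append_left _ ha
        obtain ⟨hau, x, hx, hxm⟩ := (mem_remainingHits cfg ev).mp ha'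
        obtain ⟨hju, y, hy, hym⟩ := hopt.1 j rfl
        rw [quality_extend cfg ev hx, quality_extend cfg ev hy]
        intro heq
        -- Equal quality forces equal `χ²` because the weight is positive. But `a` has the smaller
        -- label, so it would beat `j` in the tie-break, contradicting the optimality of `j`. Hence
        -- `j` may be moved in front of the hits with smaller labels.
        have hxy : x = y := by
          have hw := cfg.weight_pos
          have : cfg.weight * x = cfg.weight * y := by linarith
          exact mul_left_cancel₀ hw.ne' this
        exact hopt.2 a ⟨hau, x, hx, y, hy, Or.inr ⟨hxy, hlt a ha⟩⟩

lemma greedyHits_length_or (l : ℕ) (t : Candidate) (i : ℕ) :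
    (greedyHits (chiOf cfg ev l t) cfg.chiMax i).length = i ∨
      remainingHits cfg ev l t (greedyHits (chiOf cfg ev l t) cfg.chiMax i) = [] := by
  induction i with
  | zero => exact Or.inl rfl
  | succ i ih =>
    rw [greedyHits]
    have hopt := bestHit_optimal cfg ev l t (greedyHits (chiOf cfg ev l t) cfg.chiMax i)
    revert hopt
    generalize bestHit (chiOf cfg ev l t) cfg.chiMax
      (greedyHits (chiOf cfg ev l t) cfg.chiMax i) = o
    intro hopt
    cases o with
    | none =>
      right
      exact List.eq_nil_iff_forall_not_mem.mpr fun j hj =>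
        hopt.2 j ((mem_remainingHits cfg ev).mp hj)
    | some j =>
      rcases ih with h | h
      · left; simp [h]
      · exact absurd ((mem_remainingHits cfg ev).mpr (hopt.1 j rfl)) (by rw [h]; simp)

lemma quality_greedyHits_ge (l : ℕ) (t : Candidate) (i : ℕ) :
    ∀ d ∈ remainingHits cfg ev l t (greedyHits (chiOf cfg ev l t) cfg.chiMax i),
      ∀ u ∈ greedyHits (chiOf cfg ev l t) cfg.chiMax i,
        quality cfg l (extend cfg ev l t d) ≤ quality cfg l (extend cfg ev l t u) := by
  induction i with
  | zero => intro d _ u hu; simp [greedyHits] at hu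
  | succ i ih =>
    rw [greedyHits]
    have hopt := bestHit_optimal cfg ev l t (greedyHits (chiOf cfg ev l t) cfg.chiMax i)
    revert hopt
    generalize bestHit (chiOf cfg ev l t) cfg.chiMax
      (greedyHits (chiOf cfg ev l t) cfg.chiMax i) = o
    intro hopt
    cases o with
    | none => exact ih
    | some j =>
      intro d hd u hu
      obtain ⟨hdu, x, hx, hxm⟩ := (mem_remainingHits cfg ev).mp hd
      have hdu' : d ∉ greedyHits (chiOf cfg ev l t) cfg.chiMax i := fun h =>
        hdu (List.mem_append_left _ h)
      rcases List.mem_append.mp hu with hu | hu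
      · exact ih d ((mem_remainingHits cfg ev).mpr ⟨hdu', x, hx, hxm⟩) u hu
      · obtain rfl : u = j := by simpa using hu
        obtain ⟨hju, y, hy, hym⟩ := hopt.1 u rfl
        rw [quality_extend cfg ev hx, quality_extend cfg ev hy]
        have hxy : y ≤ x := by
          by_contra hlt
          push Not at hlt
          exact hopt.2 d ⟨hdu', x, hx, y, hy, Or.inl hlt⟩
        have hw := cfg.weight_pos
        nlinarith

/-- Ensures that both filters resort to a ghost hit for the same candidates; `0 < i` is needed,
since otherwise nothing is searched for. -/
lemma greedyHits_eq_nil_iff (l : ℕ) (t : Candidate) {i : ℕ} (hi : 0 < i) :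
    greedyHits (chiOf cfg ev l t) cfg.chiMax i = [] ↔ remainingHits cfg ev l t [] = [] := by
  constructor
  · intro h
    have := greedyHits_length_or cfg ev l t i
    rw [h] at this
    rcases this with h' | h'
    · simp at h'; omega
    · exact h'
  · intro h
    have key : ∀ i, greedyHits (chiOf cfg ev l t) cfg.chiMax i = [] := by
      intro i
      induction i with
      | zero => rfl
      | succ i ih =>
        rw [greedyHits, ih]
        have hopt := bestHit_optimal cfg ev l t []
        revert hopt
        generalize bestHit (chiOf cfg ev l t) cfg.chiMax [] = o
        intro hopt
        cases o with
        | none => rfl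
        | some j => exact absurd ((mem_remainingHits cfg ev).mpr (hopt.1 j rfl)) (by rw [h]; simp)
    exact key i

/-- Classical and greedy filtering lead to the same selection. -/
lemma foldl_selectStep_filter (l : ℕ) (t : Candidate) (acc : List Candidate)
    (hacc : acc.length ≤ cfg.lam) :
    (classicalFilter cfg cm ev l t).val.foldl (selectStep cfg l) acc =
      (greedyFilter cfg ev l t).foldl (selectStep cfg l) acc := by
  rw [val_classicalFilter, greedyFilter]
  set gh := greedyHits (chiOf cfg ev l t) cfg.chiMax cfg.lam with hgh
  have hnil : gh = [] ↔ remainingHits cfg ev l t [] = [] :=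
    greedyHits_eq_nil_iff cfg ev l t cfg.lam_pos
  by_cases h : gh = []
  · rw [h, hnil.mp h]
  · have hor : ∀ js : List ℕ, js ≠ [] → orGhost cfg l t (js.map (extend cfg ev l t)) =
        js.map (extend cfg ev l t) := by
      intro js hjs
      cases js with
      | nil => exact absurd rfl hjs
      | cons a as => rfl
    rw [hor gh h, hor _ fun h' => h (hnil.mpr h'),
      foldl_selectStep_greedyHits cfg ev l t acc cfg.lam, ← hgh]
    rcases greedyHits_length_or cfg ev l t cfg.lam with hlen | hemp
    · apply foldl_selectStep_drop cfg l _ _ _ (by simpa using hlen) hacc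
      intro d hd u hu
      obtain ⟨d', hd', rfl⟩ := List.mem_map.mp hd
      obtain ⟨u', hu', rfl⟩ := List.mem_map.mp hu
      exact quality_greedyHits_ge cfg ev l t cfg.lam d' hd' u' hu'
    · rw [← hgh] at hemp
      rw [hemp]
      rfl

/-- The two filters produce different lists; they agree only after selection. The comparison is made
candidate by candidate from an arbitrary accumulator of length at most `lam`, so that the results of
several candidates can be concatenated. -/
lemma selectBest_filter (l : ℕ) (ts : List Candidate) :
    (selectBest cfg cm l (ts.flatMap (greedyFilter cfg ev l))).val =
      (selectBest cfg cm l (ts.flatMap fun t => (classicalFilter cfg cm ev l t).val)).val := by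
  rw [val_selectBest, val_selectBest]
  have key : ∀ acc : List Candidate, acc.length ≤ cfg.lam →
      (ts.flatMap (greedyFilter cfg ev l)).foldl (selectStep cfg l) acc =
      (ts.flatMap fun t => (classicalFilter cfg cm ev l t).val).foldl (selectStep cfg l) acc := by
    induction ts with
    | nil => intro acc _; rfl
    | cons t ts ih =>
      intro acc hacc
      rw [List.flatMap_cons, List.flatMap_cons, List.foldl_append, List.foldl_append,
        foldl_selectStep_filter cfg cm ev l t acc hacc]
      exact ih _ (length_foldl_selectStep_le cfg l _ _ hacc)
  exact key [] (Nat.zero_le _)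

end Greedy

/-! ### Track finding -/

section Tracks
variable {L n : ℕ} (cfg : Config) (cm : CostModel) (ev : EventRecord L n)

/-- The candidates after the classical treatment of layer `l`. -/
def layerTracks (ts : List Candidate) (l : ℕ) : List Candidate :=
  (selectBest cfg cm l (ts.flatMap fun t => (classicalFilter cfg cm ev l t).val)).val

/-- The candidates found from a seed. -/
def seedTracks (s : Seed) : List Candidate :=
  (List.range' 3 (L - 3)).foldl (layerTracks cfg cm ev) [seedCandidate cfg ev s]

lemma length_layerTracks_le (ts : List Candidate) (l : ℕ) :
    (layerTracks cfg cm ev ts l).length ≤ cfg.lam := by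
  unfold layerTracks
  rw [val_selectBest]
  exact length_foldl_selectStep_le cfg l _ _ (Nat.zero_le _)

lemma length_foldl_layerTracks_le (ls : List ℕ) (ts : List Candidate) (h : ts.length ≤ cfg.lam) :
    (ls.foldl (layerTracks cfg cm ev) ts).length ≤ cfg.lam := by
  induction ls generalizing ts with
  | nil => exact h
  | cons l ls ih => exact ih _ (length_layerTracks_le cfg cm ev ts l)

lemma length_seedTracks_le (s : Seed) : (seedTracks cfg cm ev s).length ≤ cfg.lam :=
  length_foldl_layerTracks_le cfg cm ev _ _ cfg.lam_pos

lemma cost_selectBest (l : ℕ) (ts : List Candidate) :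
    (selectBest cfg cm l ts).cost = ts.length * ((cfg.lam + 1) * cm.step) := by
  have key : ∀ best, (ts.foldlM (fun best t => (do
      Counted.tick ((cfg.lam + 1) * cm.step)
      pure ((insertByQuality cfg l t best).take cfg.lam) : Counted (List Candidate))) best).cost =
      ts.length * ((cfg.lam + 1) * cm.step) := by
    induction ts with
    | nil => intro best; simp [Counted.cost_pure]
    | cons t ts ih =>
      intro best
      rw [List.foldlM_cons, Counted.cost_bind, ih, Counted.cost_bind, Counted.cost_tick,
        Counted.cost_pure, List.length_cons]
      ring
  exact key []

lemma length_orGhost_le (l : ℕ) (t : Candidate) (new : List Candidate) :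
    (orGhost cfg l t new).length ≤ max new.length 1 := by
  cases new <;> simp [orGhost]

lemma length_greedyHits_le (χ : ℕ → Option ℝ) (chiMax : ℝ) (i : ℕ) :
    (greedyHits χ chiMax i).length ≤ i := by
  induction i with
  | zero => rfl
  | succ i ih =>
    rw [greedyHits]
    cases bestHit χ chiMax (greedyHits χ chiMax i) with
    | none => simp only; omega
    | some j => simp only [List.length_append, List.length_singleton]; omega

lemma length_greedyFilter_le (l : ℕ) (t : Candidate) :
    (greedyFilter cfg ev l t).length ≤ cfg.lam := by
  refine (length_orGhost_le cfg l t _).trans (max_le ?_ cfg.lam_pos)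
  rw [List.length_map]
  exact length_greedyHits_le _ _ _

lemma length_flatMap_le {α β : Type} (l : List α) (g : α → List β) (c : ℕ)
    (h : ∀ a ∈ l, (g a).length ≤ c) : (l.flatMap g).length ≤ l.length * c := by
  rw [List.length_flatMap]
  have := List.sum_le_card_nsmul (l.map fun a => (g a).length) c (by simpa using h)
  simpa using this

/-- The cost of quantum track finding for one seed. -/
def seedTrackCost (L n : ℕ) : ℕ :=
  cm.step + (L - 3) * (cfg.lam * filterCost cfg cm L n +
    cfg.lam * cfg.lam * ((cfg.lam + 1) * cm.step))

lemma val_trackFinding (seeds : List Seed) :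
    (trackFinding cfg cm ev seeds).val = seeds.flatMap (seedTracks cfg cm ev) := by
  unfold trackFinding findTracks
  rw [Counted.val_forEach]
  congr 1
  funext s
  change (List.foldlM _ _ _ : Counted (List Candidate)).val = _
  rw [Counted.val_foldlM]
  unfold seedTracks
  congr 1
  funext ts l
  change (selectBest cfg cm l (forEach ts (classicalFilter cfg cm ev l)).val).val = _
  rw [Counted.val_forEach]
  rfl

/-- Layer by layer, the selected list equals the classical one by `selectBest_filter`. It has at
most `lam` candidates, which bounds both the time and the number of calls of repeated minimum
finding: `lam * lam` per layer and seed. -/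
lemma spec_quantumTrackFinding (hn : 136 ^ 4 ≤ n) (seeds : List Seed) :
    Timed.Spec (quantumTrackFinding cfg cm ev seeds) (seeds.length * seedTrackCost cfg cm L n)
      (seeds.length * ((L - 3 : ℕ) * (cfg.lam * (cfg.lam *
        ENNReal.ofReal (1 / 2) ^ findRepetitions cfg L n))))
      fun r => r = (trackFinding cfg cm ev seeds).val := by
  rw [val_trackFinding]
  unfold quantumTrackFinding findTracks
  refine Timed.spec_forEach seeds _ (seedTracks cfg cm ev) _ _ fun s _ => ?_
  have htick : Timed.Spec (liftM (Counted.tick cm.step) : Timed Unit) cm.step 0 fun _ => True :=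
    (Timed.spec_ofCounted (Counted.tick cm.step)).mono le_rfl le_rfl fun _ _ => trivial
  refine htick.bind_zero_left fun _ _ => ?_
  set ls := List.range' 3 (L - 3) with hls
  have hlen : ls.length = L - 3 := by simp [hls]
  set F : List Candidate → ℕ → Timed (List Candidate) := fun ts l => (do
    let new ← forEach ts (quantumFilter cfg cm ev l)
    liftM (selectBest cfg cm l new)) with hF
  have h := Timed.spec_foldlM F
    (fun i ts => ts = (ls.take i).foldl (layerTracks cfg cm ev) [seedCandidate cfg ev s])
    (cfg.lam * filterCost cfg cm L n + cfg.lam * cfg.lam * ((cfg.lam + 1) * cm.step))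
    (cfg.lam * (cfg.lam * ENNReal.ofReal (1 / 2) ^ findRepetitions cfg L n))
    ls 0 [seedCandidate cfg ev s] rfl fun j hj ts hts => by
      rw [zero_add] at hts ⊢
      have htslen : ts.length ≤ cfg.lam := by
        rw [hts]; exact length_foldl_layerTracks_le cfg cm ev _ _ cfg.lam_pos
      have h1 := Timed.spec_forEach ts (quantumFilter cfg cm ev ls[j]) (greedyFilter cfg ev ls[j])
        _ _ fun t _ => spec_quantumFilter cfg cm ev hn ls[j] t
      refine ((h1.bind (T₂ := cfg.lam * cfg.lam * ((cfg.lam + 1) * cm.step)) (ε₂ := 0)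
        (f := fun new => (liftM (selectBest cfg cm ls[j] new) : Timed (List Candidate)))
        fun new hnew => ?_).mono ?_ ?_ fun _ h => h)
      · refine (Timed.spec_ofCounted (selectBest cfg cm ls[j] new)).mono ?_ le_rfl ?_
        · rw [cost_selectBest]
          apply Nat.mul_le_mul_right
          rw [hnew]
          exact (length_flatMap_le ts _ _ fun t _ => length_greedyFilter_le cfg ev _ t).trans
            (Nat.mul_le_mul_right _ htslen)
        · intro r hr
          rw [hr, hnew, selectBest_filter, List.take_add_one, List.getElem?_eq_getElem hj,
            List.foldl_append, ← hts]
          rfl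
      · gcongr
      · rw [add_zero]
        gcongr
  rw [zero_add, List.take_length, hlen] at h
  exact h

lemma mem_insertByQuality {l : ℕ} {t u : Candidate} {us : List Candidate}
    (h : u ∈ insertByQuality cfg l t us) : u = t ∨ u ∈ us := by
  induction us with
  | nil => left; simpa [insertByQuality] using h
  | cons a us ih =>
    rw [insertByQuality] at h
    split_ifs at h
    · simpa using h
    · rcases List.mem_cons.mp h with rfl | h
      · right; exact List.mem_cons_self
      · rcases ih h with h | h
        · exact Or.inl h
        · exact Or.inr (List.mem_cons_of_mem _ h)

lemma mem_of_mem_selectBest {l : ℕ} {ts : List Candidate} {u : Candidate}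
    (h : u ∈ (selectBest cfg cm l ts).val) : u ∈ ts := by
  rw [val_selectBest] at h
  have key : ∀ acc, u ∈ ts.foldl (selectStep cfg l) acc → u ∈ acc ∨ u ∈ ts := by
    clear h
    induction ts with
    | nil => intro acc h; exact Or.inl h
    | cons t ts ih =>
      intro acc h
      rcases ih _ h with h | h
      · rcases mem_insertByQuality cfg (List.mem_of_mem_take h) with rfl | h
        · exact Or.inr List.mem_cons_self
        · exact Or.inl h
      · exact Or.inr (List.mem_cons_of_mem _ h)
  rcases key [] h with h | h
  · simp at h
  · exact h

lemma length_hits_classicalFilter {l : ℕ} {t u : Candidate}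
    (h : u ∈ (classicalFilter cfg cm ev l t).val) : u.hits.length ≤ t.hits.length + 1 := by
  rw [val_classicalFilter] at h
  have hor : ∀ new : List Candidate, u ∈ orGhost cfg l t new → u = extendGhost cfg l t ∨ u ∈ new := by
    intro new h
    cases new with
    | nil => left; simpa [orGhost] using h
    | cons a as => right; exact h
  rcases hor _ h with rfl | h
  · simp [extendGhost]
  · obtain ⟨j, _, rfl⟩ := List.mem_map.mp h
    simp [extend]

lemma length_hits_seedTracks (hL : 3 ≤ L) {s : Seed} {u : Candidate}
    (h : u ∈ seedTracks cfg cm ev s) : u.hits.length ≤ L := by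
  have key : ∀ (ls : List ℕ) (ts : List Candidate) (c : ℕ), (∀ t ∈ ts, t.hits.length ≤ c) →
      ∀ u ∈ ls.foldl (layerTracks cfg cm ev) ts, u.hits.length ≤ c + ls.length := by
    intro ls
    induction ls with
    | nil => intro ts c h u hu; exact h u hu
    | cons l ls ih =>
      intro ts c h u hu
      have := ih (layerTracks cfg cm ev ts l) (c + 1) (fun t ht => by
        have := mem_of_mem_selectBest cfg cm ht
        obtain ⟨t', ht', htt⟩ := List.mem_flatMap.mp this
        have := length_hits_classicalFilter cfg cm ev htt
        have := h t' ht'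
        omega) u hu
      rw [List.length_cons]
      omega
  have := key (List.range' 3 (L - 3)) [seedCandidate cfg ev s] 3 (by simp [seedCandidate]) u h
  rw [List.length_range'] at this
  omega

lemma cost_classicalFilter_le (l : ℕ) (t : Candidate) :
    (classicalFilter cfg cm ev l t).cost ≤ (2 * n + 2) * cm.step := by
  classical
  unfold classicalFilter
  simp only [Counted.cost_bind, Counted.cost_tick, Counted.cost_pure]
  have := Counted.cost_forEach_le (List.range n) (fun j => (do
    Counted.tick cm.step
    if ∃ x, chiOf cfg ev l t j = some x ∧ x < cfg.chiMax then do
      Counted.tick cm.step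
      pure [extend cfg ev l t j]
    else pure [] : Counted (List Candidate))) (2 * cm.step) (by
      intro j _
      rw [Counted.cost_bind, Counted.cost_tick]
      split_ifs
      · rw [Counted.cost_bind, Counted.cost_tick, Counted.cost_pure]; omega
      · rw [Counted.cost_pure]; omega)
  rw [List.length_range] at this
  refine (Nat.add_le_add_left (Nat.add_le_add_right this _) _).trans (le_of_eq ?_)
  ring

lemma le_cost_classicalFilter (l : ℕ) (t : Candidate) :
    n * cm.step ≤ (classicalFilter cfg cm ev l t).cost := by
  classical
  unfold classicalFilter
  simp only [Counted.cost_bind, Counted.cost_tick, Counted.cost_pure]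
  have := Counted.le_cost_forEach (List.range n) (fun j => (do
    Counted.tick cm.step
    if ∃ x, chiOf cfg ev l t j = some x ∧ x < cfg.chiMax then do
      Counted.tick cm.step
      pure [extend cfg ev l t j]
    else pure [] : Counted (List Candidate))) cm.step (by
      intro j _
      rw [Counted.cost_bind, Counted.cost_tick]
      omega)
  rw [List.length_range] at this
  refine this.trans ?_
  exact (Nat.le_add_right _ _).trans (Nat.le_add_left _ _)

lemma length_classicalFilter_le (l : ℕ) (t : Candidate) :
    (classicalFilter cfg cm ev l t).val.length ≤ n + 1 := by
  rw [val_classicalFilter]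
  refine (length_orGhost_le cfg l t _).trans (max_le ?_ (by omega))
  rw [List.length_map]
  unfold remainingHits
  have := List.length_filter_le (fun j => @decide (Better (chiOf cfg ev l t) cfg.chiMax [] none j)
    (Classical.propDecidable _)) (List.range n)
  rw [List.length_range] at this
  omega

/-- The cost of classical track finding for one seed. -/
def classicalSeedTrackCost (L n : ℕ) : ℕ :=
  cm.step + (L - 3) * (cfg.lam * ((2 * n + 2) * cm.step) +
    cfg.lam * (n + 1) * ((cfg.lam + 1) * cm.step))

lemma cost_trackFinding_le (seeds : List Seed) :
    (trackFinding cfg cm ev seeds).cost ≤ seeds.length * classicalSeedTrackCost cfg cm L n := by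
  unfold trackFinding findTracks
  refine Counted.cost_forEach_le _ _ _ fun s _ => ?_
  rw [Counted.cost_bind]
  apply Nat.add_le_add
  · exact le_rfl
  have h := (Counted.cost_foldlM_le (fun ts l => (do
      let new ← forEach ts (classicalFilter cfg cm ev l)
      selectBest cfg cm l new : Counted (List Candidate))) (fun _ ts => ts.length ≤ cfg.lam)
      (cfg.lam * ((2 * n + 2) * cm.step) + cfg.lam * (n + 1) * ((cfg.lam + 1) * cm.step))
      (List.range' 3 (L - 3)) 0 [seedCandidate cfg ev s] cfg.lam_pos (fun j hj ts hts => by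
        rw [Counted.cost_bind, Counted.val_bind]
        refine ⟨Nat.add_le_add ?_ ?_, ?_⟩
        · exact (Counted.cost_forEach_le _ _ _ fun t _ =>
            cost_classicalFilter_le cfg cm ev _ t).trans (Nat.mul_le_mul_right _ hts)
        · rw [cost_selectBest]
          apply Nat.mul_le_mul_right
          rw [Counted.val_forEach]
          exact (length_flatMap_le ts _ _ fun t _ => length_classicalFilter_le cfg cm ev _ t).trans
            (Nat.mul_le_mul_right _ hts)
        · rw [val_selectBest]
          exact length_foldl_selectStep_le cfg _ _ _ (Nat.zero_le _))).1
  rw [List.length_range'] at h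
  exact h

/-- Only the scan of layer `3` for the initial candidate of each seed is counted; this layer exists
exactly when `4 ≤ L`. -/
lemma le_cost_trackFinding (hL : 4 ≤ L) (seeds : List Seed) :
    seeds.length * (n * cm.step) ≤ (trackFinding cfg cm ev seeds).cost := by
  unfold trackFinding findTracks
  refine Counted.le_cost_forEach _ _ _ fun s _ => ?_
  rw [Counted.cost_bind]
  refine le_trans ?_ (Nat.le_add_left _ _)
  obtain ⟨k, hk⟩ : ∃ k, L - 3 = k + 1 := ⟨L - 4, by omega⟩
  rw [hk, List.range'_succ, List.foldlM_cons, Counted.cost_bind]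
  refine le_trans ?_ (Nat.le_add_right _ _)
  rw [Counted.cost_bind]
  refine le_trans ?_ (Nat.le_add_right _ _)
  have := Counted.le_cost_forEach [seedCandidate cfg ev s] (classicalFilter cfg cm ev 3)
    (n * cm.step) fun t _ => le_cost_classicalFilter cfg cm ev 3 t
  simpa using this

lemma length_trackFinding_le (seeds : List Seed) :
    (trackFinding cfg cm ev seeds).val.length ≤ seeds.length * cfg.lam := by
  rw [val_trackFinding]
  exact length_flatMap_le _ _ _ fun s _ => length_seedTracks_le cfg cm ev s

lemma length_hits_trackFinding (hL : 3 ≤ L) (seeds : List Seed) :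
    ∀ t ∈ (trackFinding cfg cm ev seeds).val, t.hits.length ≤ L := by
  intro t ht
  rw [val_trackFinding] at ht
  obtain ⟨s, _, hs⟩ := List.mem_flatMap.mp ht
  exact length_hits_seedTracks cfg cm ev hL hs

end Tracks

/-! ### Balanced search trees -/

section Trees
variable {α : Type} [LinearOrder α]

/-- The balance factor `3` of `Ordnode` means that passing to a child multiplies the size plus one
by at most `3 / 4`. The exceptional trees with at most one node below the root satisfy this too. -/
lemma child_size_le {l r : ℕ} (h : Ordnode.BalancedSz l r) : 4 * (l + 1) ≤ 3 * (l + r + 1 + 1) := by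
  unfold Ordnode.BalancedSz Ordnode.delta at h
  omega

/-- A path of length `p` needs about `(4 / 3) ^ p` nodes, by iterating `child_size_le`. Powers of
`3` and `4` are kept apart to stay in the natural numbers. -/
lemma four_pow_searchPath_le (x : α) : ∀ {t : Ordnode α}, t.Sized → t.Balanced →
    3 * 4 ^ searchPath x t ≤ 4 * 3 ^ searchPath x t * (t.size + 1)
  | .nil, _, _ => by simp [searchPath, Ordnode.size]
  | .node s l y r, hs, hb => by
    have hsz : s = l.size + r.size + 1 := hs.1
    have hsize : (Ordnode.node s l y r).size = s := rfl
    rw [hsize, searchPath]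
    cases cmpLE x y with
    | lt =>
      have ih := four_pow_searchPath_le x hs.2.1 hb.2.1
      have hc := child_size_le hb.1
      simp only [pow_add, pow_one]
      calc 3 * (4 * 4 ^ searchPath x l) = 4 * (3 * 4 ^ searchPath x l) := by ring
        _ ≤ 4 * (4 * 3 ^ searchPath x l * (l.size + 1)) := by gcongr
        _ = 4 * 3 ^ searchPath x l * (4 * (l.size + 1)) := by ring
        _ ≤ 4 * 3 ^ searchPath x l * (3 * (l.size + r.size + 1 + 1)) := by gcongr
        _ = 4 * (3 * 3 ^ searchPath x l) * (s + 1) := by rw [hsz]; ring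
    | eq => simp only [add_zero, pow_one]; omega
    | gt =>
      have ih := four_pow_searchPath_le x hs.2.2 hb.2.2
      have hc := child_size_le hb.1.symm
      simp only [pow_add, pow_one]
      calc 3 * (4 * 4 ^ searchPath x r) = 4 * (3 * 4 ^ searchPath x r) := by ring
        _ ≤ 4 * (4 * 3 ^ searchPath x r * (r.size + 1)) := by gcongr
        _ = 4 * 3 ^ searchPath x r * (4 * (r.size + 1)) := by ring
        _ ≤ 4 * 3 ^ searchPath x r * (3 * (r.size + l.size + 1 + 1)) := by gcongr
        _ = 4 * (3 * 3 ^ searchPath x r) * (s + 1) := by rw [hsz]; ring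

/-- Three levels gain a factor `64 / 27 > 2`, so the depth is at most three times the binary
logarithm. -/
lemma searchPath_le (x : α) {t : Ordnode α} (ht : t.Valid) {e : ℕ} (he : t.size + 1 ≤ 2 ^ e) :
    searchPath x t ≤ 3 * e + 1 := by
  by_contra! hlt
  obtain ⟨j, hj⟩ := Nat.exists_eq_add_of_le hlt
  have h := four_pow_searchPath_le x ht.sz ht.bal
  rw [hj] at h
  have h1 : 3 * 4 ^ (3 * e + 1 + 1 + j) ≤ 4 * 3 ^ (3 * e + 1 + 1 + j) * 2 ^ e :=
    h.trans (Nat.mul_le_mul_left _ he)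
  simp only [pow_add, pow_mul, pow_one] at h1
  norm_num at h1
  have h2 : (27 : ℕ) ^ e * 2 ^ e ≤ 64 ^ e := by
    rw [← mul_pow]; exact Nat.pow_le_pow_left (by norm_num) e
  have h3 : (3 : ℕ) ^ j ≤ 4 ^ j := Nat.pow_le_pow_left (by norm_num) j
  have h4 : 0 < (64 : ℕ) ^ e * 4 ^ j := by positivity
  have h5 : (27 : ℕ) ^ e * 2 ^ e * 3 ^ j ≤ 64 ^ e * 4 ^ j := Nat.mul_le_mul h2 h3
  nlinarith

/-- Membership is tracked through the rotations by quantifying over predicates, for which the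
balancing operations have lemmas. The bounds are carried along because the recursion needs the
validity of the subtrees. -/
lemma all_insert {P : α → Prop} (x : α) : ∀ {t : Ordnode α} {o₁ : WithBot α} {o₂ : WithTop α},
    Ordnode.Valid' o₁ t o₂ → Ordnode.Bounded .nil o₁ x → Ordnode.Bounded .nil x o₂ →
    ((Ordnode.insertWith (fun _ => x) x t).All P ↔ P x ∧ t.All P)
  | .nil, _, _, _, _, _ => by
    simp [Ordnode.insertWith, Ordnode.singleton, Ordnode.All]
  | .node sz l y r, o₁, o₂, h, bl, br => by
    have hf : ∀ y : α, x ≤ y ∧ y ≤ x → x ≤ (fun _ : α => x) y ∧ (fun _ : α => x) y ≤ x :=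
      fun _ _ => ⟨le_rfl, le_rfl⟩
    rw [Ordnode.insertWith, cmpLE]
    split_ifs with h₁ h₂ <;> dsimp only
    · rw [le_antisymm h₁ h₂]
      simp only [Ordnode.All]
      tauto
    · have hxy : x < y := lt_of_le_not_ge h₁ h₂
      rcases Ordnode.insertWith.valid_aux (fun _ => x) x hf h.left bl hxy with ⟨vl, e⟩
      rw [Ordnode.all_balanceL vl.3 h.3.2.2 vl.2 h.2.2.2 (Or.inl ⟨_, e, h.3.1⟩),
        all_insert x h.left bl hxy]
      simp only [Ordnode.All]
      tauto
    · have hyx : y < x := not_le.1 h₁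
      rcases Ordnode.insertWith.valid_aux (fun _ => x) x hf h.right hyx br with ⟨vr, e⟩
      rw [Ordnode.all_balanceR h.3.2.1 vr.3 h.2.2.1 vr.2 (Or.inr ⟨_, e, h.3.1⟩),
        all_insert x h.right hyx br]
      simp only [Ordnode.All]
      tauto

/-- Both directions specialise the statement about all predicates: to being `x` or an old element,
and to membership in the new tree. -/
lemma mem_toList_insert (x : α) {t : Ordnode α} (ht : t.Valid) (y : α) :
    y ∈ (Ordnode.insert x t).toList ↔ y = x ∨ y ∈ t.toList := by
  have h (P : α → Prop) : (∀ z ∈ (Ordnode.insert x t).toList, P z) ↔ P x ∧ ∀ z ∈ t.toList, P z := by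
    have := all_insert (P := P) x ht trivial trivial
    rw [← Ordnode.insert_eq_insertWith, Ordnode.all_iff_forall, Ordnode.all_iff_forall] at this
    simpa only [Ordnode.emem_iff_mem_toList] using this
  constructor
  · intro hy
    exact (h fun z => z = x ∨ z ∈ t.toList).2 ⟨Or.inl rfl, fun z hz => Or.inr hz⟩ y hy
  · intro hy
    have := (h fun z => z ∈ (Ordnode.insert x t).toList).1 fun z hz => hz
    rcases hy with rfl | hy
    · exact this.1
    · exact this.2 y hy

lemma pairwise_toList : ∀ {t : Ordnode α} {o₁ : WithBot α} {o₂ : WithTop α},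
    t.Bounded o₁ o₂ → t.toList.Pairwise (· < ·)
  | .nil, _, _, _ => by simp
  | .node s l y r, o₁, o₂, h => by
    have hl := Ordnode.all_iff_forall.1 h.1.mem_lt
    have hr := Ordnode.all_iff_forall.1 h.2.mem_gt
    simp only [Ordnode.emem_iff_mem_toList] at hl hr
    rw [Ordnode.toList_node, List.pairwise_append]
    refine ⟨pairwise_toList h.1, List.pairwise_cons.2 ⟨fun z hz => hr z hz, pairwise_toList h.2⟩, ?_⟩
    intro a ha b hb
    rcases List.mem_cons.1 hb with rfl | hb
    · exact hl a ha
    · exact (hl a ha).trans (hr b hb)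

/-- The elements of a search tree. -/
def treeSet (t : Ordnode α) : Finset α := t.toList.toFinset

@[simp] lemma treeSet_nil : treeSet (.nil : Ordnode α) = ∅ := by simp [treeSet]

lemma card_treeSet {t : Ordnode α} (ht : t.Valid) : (treeSet t).card = t.size := by
  rw [treeSet, List.toFinset_card_of_nodup, Ordnode.length_toList ht.sz]
  exact (pairwise_toList ht.ord).imp fun h => h.ne

lemma treeSet_insert (x : α) {t : Ordnode α} (ht : t.Valid) :
    treeSet (Ordnode.insert x t) = insert x (treeSet t) := by
  ext y
  simp [treeSet, mem_toList_insert x ht]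

lemma size_insert_le (x : α) {t : Ordnode α} (ht : t.Valid) :
    (Ordnode.insert x t).size ≤ t.size + 1 := by
  rw [← card_treeSet (Ordnode.insert.valid x ht), ← card_treeSet ht, treeSet_insert x ht]
  exact Finset.card_insert_le _ _

/-- A strictly increasing list is determined by its elements. Thus the random order in which seeds
are found leaves no trace in the list that is passed on. -/
lemma toList_eq_of_mem_iff {t : Ordnode α} (ht : t.Valid) {l : List α} (hl : l.Pairwise (· < ·))
    (h : ∀ x, x ∈ t.toList ↔ x ∈ l) : t.toList = l := by
  have h1 := pairwise_toList ht.ord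
  exact ((List.perm_ext_iff_of_nodup (h1.imp fun h => h.ne) (hl.imp fun h => h.ne)).2 h).eq_of_pairwise
    (fun a b _ _ hab hba => absurd hba (lt_asymm hab)) h1 hl

end Trees

/-! ### Seed generation -/

section Seeds
variable {L n : ℕ} (cfg : Config) (cm : CostModel) (ev : EventRecord L n)

lemma cost_seedGeneration : (seedGeneration cfg cm ev).cost = n * (n * (n * cm.step)) := by
  unfold seedGeneration
  simp [Counted.cost_forEach, Counted.cost_bind, Counted.cost_tick, Counted.cost_pure]

lemma mem_seedGeneration (s : Seed) : s ∈ (seedGeneration cfg cm ev).val ↔ IsGoodSeed cfg ev s := by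
  unfold seedGeneration
  simp only [Counted.val_forEach, Counted.val_bind, Counted.val_pure, List.mem_flatMap,
    List.mem_range]
  constructor
  · rintro ⟨j₀, _, j₁, _, j₂, _, h⟩
    split_ifs at h with hg
    · rw [List.mem_singleton] at h; rw [h]; exact hg
    · simp at h
  · intro h
    obtain ⟨h₀, h₁, h₂, e₀, e₁, e₂, _⟩ := id h
    refine ⟨_, EventRecord.lt_of_load e₀, _, EventRecord.lt_of_load e₁, _,
      EventRecord.lt_of_load e₂, ?_⟩
    rw [if_pos]
    · exact List.mem_singleton.2 rfl
    · exact h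

/-- Nested loops enumerate the triplets lexicographically, which is the order of `Seed`. This also
gives the absence of duplicates used for counting. -/
lemma pairwise_seedGeneration : (seedGeneration cfg cm ev).val.Pairwise (· < ·) := by
  unfold seedGeneration
  simp only [Counted.val_forEach, Counted.val_bind, Counted.val_pure]
  have hr : (List.range n).Pairwise (· < ·) := List.pairwise_lt_range
  refine List.pairwise_flatMap.2 ⟨fun j₀ _ => List.pairwise_flatMap.2 ⟨fun j₁ _ =>
    List.pairwise_flatMap.2 ⟨fun j₂ _ => ?_, hr.imp ?_⟩, hr.imp ?_⟩, hr.imp ?_⟩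
  · split_ifs <;> simp
  · intro a b hab x hx y hy
    split_ifs at hx hy <;> simp at hx hy
    subst hx hy
    exact Prod.Lex.toLex_lt_toLex.2 (Or.inr ⟨rfl, Prod.Lex.toLex_lt_toLex.2 (Or.inr ⟨rfl, hab⟩)⟩)
  · intro a b hab x hx y hy
    simp only [List.mem_flatMap] at hx hy
    obtain ⟨_, _, hx⟩ := hx
    obtain ⟨_, _, hy⟩ := hy
    split_ifs at hx hy <;> simp at hx hy
    subst hx hy
    exact Prod.Lex.toLex_lt_toLex.2 (Or.inr ⟨rfl, Prod.Lex.toLex_lt_toLex.2 (Or.inl hab)⟩)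
  · intro a b hab x hx y hy
    simp only [List.mem_flatMap] at hx hy
    obtain ⟨_, _, _, _, hx⟩ := hx
    obtain ⟨_, _, _, _, hy⟩ := hy
    split_ifs at hx hy <;> simp at hx hy
    subst hx hy
    exact Prod.Lex.toLex_lt_toLex.2 (Or.inl hab)

lemma length_seedGeneration : (seedGeneration cfg cm ev).val.length = kSeed cfg ev := by
  classical
  have hnd : (seedGeneration cfg cm ev).val.Nodup :=
    (pairwise_seedGeneration cfg cm ev).imp fun h => h.ne
  rw [← List.toFinset_card_of_nodup hnd, ← Nat.card_eq_finsetCard]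
  unfold kSeed
  symm
  refine Nat.card_congr (Equiv.ofBijective (fun x => ⟨_, List.mem_toFinset.2
    ((mem_seedGeneration cfg cm ev _).2 x.2)⟩) ⟨?_, ?_⟩)
  · rintro ⟨⟨a, b, c⟩, h⟩ ⟨⟨a', b', c'⟩, h'⟩ heq
    have h1 := congrArg Subtype.val heq
    have h2 := congrArg ofLex h1
    simp only [ofLex_toLex, Prod.mk.injEq] at h2
    have h3 := congrArg ofLex h2.2
    simp only [ofLex_toLex, Prod.mk.injEq] at h3
    simp only [Subtype.mk.injEq, Prod.mk.injEq]
    exact ⟨Fin.ext h2.1, Fin.ext h3.1, Fin.ext h3.2⟩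
  · rintro ⟨s, hs⟩
    have hg := (mem_seedGeneration cfg cm ev _).1 (List.mem_toFinset.1 hs)
    obtain ⟨h₀, h₁, h₂, e₀, e₁, e₂, _⟩ := id hg
    exact ⟨⟨(⟨_, EventRecord.lt_of_load e₀⟩, ⟨_, EventRecord.lt_of_load e₁⟩,
      ⟨_, EventRecord.lt_of_load e₂⟩), hg⟩, rfl⟩

lemma kSeed_le : kSeed cfg ev ≤ n ^ 3 := by
  unfold kSeed
  refine (Finite.card_subtype_le _).trans ?_
  simp [Nat.card_eq_fintype_card]
  exact (by ring : n * (n * n) = n ^ 3).le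

lemma regSeed_injective (q : ℕ) : Function.Injective (regSeed : Reg (Fin 3 × Fin q) → Seed) := by
  intro x y h
  have h2 := congrArg ofLex h
  simp only [regSeed, ofLex_toLex, Prod.mk.injEq] at h2
  have h3 := congrArg ofLex h2.2
  simp only [ofLex_toLex, Prod.mk.injEq] at h3
  have e0 := regVal_injective q h2.1
  have e1 := regVal_injective q h3.1
  have e2 := regVal_injective q h3.2
  funext ⟨i, b⟩
  fin_cases i
  · exact congrFun e0 b
  · exact congrFun e1 b
  · exact congrFun e2 b

-- The padding labels load no hit, so they are never part of a good seed, and every true label fits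
-- into the register.
open Classical in
lemma image_regSeed : (Finset.univ.filter fun x : Reg (Fin 3 × Fin (labelBits n)) =>
    IsGoodSeed cfg ev (regSeed x)).image regSeed = (seedGeneration cfg cm ev).val.toFinset := by
  ext s
  simp only [Finset.mem_image, Finset.mem_filter, Finset.mem_univ, true_and, List.mem_toFinset,
    mem_seedGeneration]
  constructor
  · rintro ⟨x, h, rfl⟩; exact h
  · intro h
    obtain ⟨h₀, h₁, h₂, e₀, e₁, e₂, _⟩ := id h
    have hlt {l j : ℕ} {h : Hit} (e : ev.load l j = some h) : j < 2 ^ labelBits n :=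
      (EventRecord.lt_of_load e).trans_le (le_two_pow_labelBits n)
    obtain ⟨x₀, hx₀⟩ := exists_regVal (hlt e₀)
    obtain ⟨x₁, hx₁⟩ := exists_regVal (hlt e₁)
    obtain ⟨x₂, hx₂⟩ := exists_regVal (hlt e₂)
    have hs : regSeed (fun p : Fin 3 × Fin (labelBits n) => ![x₀, x₁, x₂] p.1 p.2) = s := by
      unfold regSeed
      simp only [Matrix.cons_val_zero, Matrix.cons_val_one, Matrix.cons_val]
      rw [hx₀, hx₁, hx₂]
      rfl
    exact ⟨_, hs ▸ h, hs⟩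

lemma markedCount_seeds : markedCount (fun x : Reg (Fin 3 × Fin (labelBits n)) =>
    IsGoodSeed cfg ev (regSeed x)) = kSeed cfg ev := by
  classical
  -- An arbitrary cost model: it enters only through the list of seeds, whose length is `kSeed` for
  -- any choice.
  have cm : CostModel := ⟨1, 1, 1, one_pos, one_pos, one_pos⟩
  rw [← length_seedGeneration cfg cm ev, ← List.toFinset_card_of_nodup
    ((pairwise_seedGeneration cfg cm ev).imp fun h => h.ne), ← image_regSeed cfg cm ev,
    Finset.card_image_of_injective _ (regSeed_injective _)]
  unfold markedCount
  congr!

end Seeds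

/-! ### Collecting all marked states -/

section Collect

/-- The number of Grover iterations used when `k` of `2 ^ c` states are marked. -/
def groverIterations (c k : ℕ) : ℕ := ⌊Real.pi / (4 * Real.arcsin √((k : ℝ) / 2 ^ c))⌋₊

variable {κ : Type} [Fintype κ] [DecidableEq κ]

/-- The rotated angle `(2 m + 1) θ` lies between `π / 4` and `3π / 4`. For `m ≥ 1` one has `θ ≤ π /
4`, and the floor is off from `π / 2` by at most `θ`; for `m = 0` already `θ > π / 4`, so measuring
the uniform superposition is good enough. -/
lemma half_le_sin_sq (f : Reg κ → Prop) (hf : 0 < markedCount f) :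
    1 / 2 ≤ Real.sin ((2 * (groverIterations (Fintype.card κ) (markedCount f) : ℝ) + 1) *
      groverAngle f) ^ 2 := by
  have hdef : groverIterations (Fintype.card κ) (markedCount f) =
    ⌊Real.pi / (4 * groverAngle f)⌋₊ := rfl
  rw [hdef]
  have hθ0 : 0 < groverAngle f := by
    unfold groverAngle
    rw [Real.arcsin_pos]
    exact Real.sqrt_pos.mpr (by positivity)
  have hθ1 := groverAngle_le f
  have hpi := Real.pi_pos
  set θ := groverAngle f
  have key : ∀ φ : ℝ, Real.pi / 4 ≤ φ → φ ≤ 3 * (Real.pi / 4) → 1 / 2 ≤ Real.sin φ ^ 2 := by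
    intro φ h1 h2
    rw [Real.sin_sq_eq_half_sub]
    have h3 : Real.cos (2 * φ) ≤ 0 :=
      Real.cos_nonpos_of_pi_div_two_le_of_le (by linarith) (by linarith)
    linarith
  set m := ⌊Real.pi / (4 * θ)⌋₊ with hm
  have h1 : (m : ℝ) ≤ Real.pi / (4 * θ) := Nat.floor_le (by positivity)
  have h2 : Real.pi / (4 * θ) < m + 1 := Nat.lt_floor_add_one _
  rw [le_div_iff₀ (by positivity)] at h1
  rw [div_lt_iff₀ (by positivity)] at h2
  rcases Nat.eq_zero_or_pos m with h0 | h0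
  · rw [h0] at h2 ⊢
    norm_num at h2 ⊢
    have := key θ (by linarith) (by linarith)
    linarith
  · have h3 : (1 : ℝ) ≤ m := by exact_mod_cast h0
    have h4 : 4 * θ ≤ m * (4 * θ) := le_mul_of_one_le_left (by positivity) h3
    apply key <;> nlinarith

/-- The angle is at least its sine `√(k / 2 ^ c)`, and `π / 4 ≤ 1`. -/
lemma groverIterations_le {c k : ℕ} (hk : 0 < k) (hkc : k ≤ 2 ^ c) :
    (groverIterations c k : ℝ) ≤ √(2 ^ c / k) := by
  have hk' : (0 : ℝ) < k := by exact_mod_cast hk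
  have hfrac : (k : ℝ) / 2 ^ c ≤ 1 := by
    rw [div_le_one (by positivity)]; exact_mod_cast hkc
  have hs0 : 0 < √((k : ℝ) / 2 ^ c) := Real.sqrt_pos.mpr (by positivity)
  have hle : √((k : ℝ) / 2 ^ c) ≤ Real.arcsin √((k : ℝ) / 2 ^ c) := by
    have h1 := Real.sin_arcsin (x := √((k : ℝ) / 2 ^ c)) (by linarith) (Real.sqrt_le_one.mpr hfrac)
    calc _ = _ := h1.symm
      _ ≤ _ := Real.sin_le (Real.arcsin_nonneg.mpr hs0.le)
  refine (Nat.floor_le (by positivity [Real.arcsin_nonneg.mpr hs0.le])).trans ?_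
  have e : √((2 : ℝ) ^ c / k) = 1 / √((k : ℝ) / 2 ^ c) := by
    rw [← Real.sqrt_one, ← Real.sqrt_div (by norm_num), one_div_div]
  rw [e, div_le_div_iff₀ (by linarith) hs0]
  nlinarith [Real.pi_le_four]

/-- The harmonic number. -/
def harmonicSum (k : ℕ) : ℝ := ∑ i ∈ Finset.range k, 1 / ((i : ℝ) + 1)

lemma harmonicSum_le {k e : ℕ} (h : k ≤ 2 ^ e) : harmonicSum k ≤ e + 1 := by
  have h1 := harmonic_le_one_add_log k
  have h2 : ((harmonic k : ℚ) : ℝ) = harmonicSum k := by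
    unfold harmonic harmonicSum
    push_cast
    simp
  rw [h2] at h1
  rcases Nat.eq_zero_or_pos k with rfl | hk
  · simp at h1; have : (0 : ℝ) ≤ e := by positivity
    linarith
  have h3 : Real.log k ≤ e := by
    calc Real.log k ≤ Real.log (2 ^ e) := by
          apply Real.log_le_log (by exact_mod_cast hk); exact_mod_cast h
      _ = e * Real.log 2 := Real.log_pow _ _
      _ ≤ e * 1 := by gcongr; linarith [Real.log_two_lt_d9]
      _ = e := mul_one _
  linarith

lemma harmonicSum_nonneg (k : ℕ) : 0 ≤ harmonicSum k :=
  Finset.sum_nonneg fun _ _ => by positivity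

lemma one_le_harmonicSum {k : ℕ} (h : 0 < k) : 1 ≤ harmonicSum k := by
  obtain ⟨j, rfl⟩ := Nat.exists_eq_add_of_lt h
  unfold harmonicSum
  rw [Finset.sum_range_succ']
  have : 0 ≤ ∑ i ∈ Finset.range (0 + j), 1 / (((i + 1 : ℕ) : ℝ) + 1) :=
    Finset.sum_nonneg fun _ _ => by positivity
  simp only [Nat.cast_zero, zero_add] at this ⊢
  norm_num
  simpa using this

end Collect

section CollectLoop
variable {κ : Type} [Fintype κ] [DecidableEq κ] {α : Type} [LinearOrder α]

/-- A bound on the cost of one sample and its insertion into a tree of less than `2 ^ e` nodes. -/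
def collectRoundCost (κ : Type) [Fintype κ] (cm : CostModel) (g m e : ℕ) : ℕ :=
  1 + groverGates κ cm g m + cm.step + (3 * e + 1) * cm.step

open Classical in
/-- One round of sampling. -/
def collectRound (cm : CostModel) (f : Reg κ → Prop) (g m : ℕ) (φ : Reg κ → α) (t : Ordnode α) :
    Timed (Ordnode α) := do
  let x ← groverSample κ cm f g m
  Timed.tick cm.step
  if f x then Timed.ofCounted (treeInsert cm (φ x) t) else pure t

open Classical in
/-- The expected loss after one round of sampling, when the loss is at most `h x` after having
measured `x`. -/
lemma loss_collectRound_le (cm : CostModel) (f : Reg κ → Prop) (g m e : ℕ) (φ : Reg κ → α)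
    {t : Ordnode α} (ht : t.Valid) (he : t.size + 1 ≤ 2 ^ e) {b : ℕ}
    (hb : collectRoundCost κ cm g m e ≤ b + 1) (Θ : Ordnode α → ℕ → ℝ≥0∞) (h : Reg κ → ℝ) (v : ℝ)
    (h0 : ∀ x, 0 ≤ h x) (hv : ∀ x, ¬ f x → h x = v)
    (hΘ : ∀ x b', b' ≤ b → b + 1 ≤ b' + collectRoundCost κ cm g m e →
      Θ (if f x then Ordnode.insert (φ x) t else t) b' ≤ ENNReal.ofReal (h x)) :
    Timed.loss (collectRound cm f g m φ t) b Θ ≤ ENNReal.ofReal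
      (Real.sin ((2 * m + 1) * groverAngle f) ^ 2 *
        ((∑ x ∈ Finset.univ.filter f, h x) / markedCount f) +
      Real.cos ((2 * m + 1) * groverAngle f) ^ 2 * v) := by
  unfold collectRoundCost at hb hΘ
  unfold collectRound
  rw [Timed.loss_bind, loss_groverSample, if_pos (by omega), ← sum_groverAmp_sq f m h v hv,
    ENNReal.ofReal_sum_of_nonneg fun x _ => mul_nonneg (by positivity) (h0 x)]
  refine Finset.sum_le_sum fun x _ => ?_
  rw [ENNReal.ofReal_mul (by positivity)]
  gcongr
  have hp := Nat.mul_le_mul_right cm.step (searchPath_le (φ x) ht he)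
  rw [Timed.loss_bind, Timed.loss_tick, if_pos (by omega)]
  have hx := hΘ x
  split_ifs at hx ⊢ with hfx
  · rw [Timed.loss_ofCounted]
    have e1 : (treeInsert cm (φ x) t).cost = searchPath (φ x) t * cm.step := rfl
    rw [e1, if_pos (by omega)]
    exact hx _ (by omega) (by omega)
  · rw [Timed.loss_pure]
    exact hx _ (by omega) (by omega)

lemma nonInc_groverSample (cm : CostModel) (f : Reg κ → Prop) (g m : ℕ) :
    Timed.NonInc (groverSample κ cm f g m) :=
  (Timed.nonInc_tick _).bind fun _ => Timed.nonInc_sample _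

lemma nonInc_collectRound (cm : CostModel) (f : Reg κ → Prop) (g m : ℕ) (φ : Reg κ → α)
    (t : Ordnode α) : Timed.NonInc (collectRound cm f g m φ t) := by
  classical
  refine (nonInc_groverSample cm f g m).bind fun x => (Timed.nonInc_tick _).bind fun _ => ?_
  split_ifs
  · exact Timed.nonInc_ofCounted _
  · exact Timed.nonInc_pure _

open Classical in
/-- Sampling until all marked states have been found. -/
lemma spec_collect (cm : CostModel) (f : Reg κ → Prop) (g m e : ℕ) (φ : Reg κ → α)
    (hφ : Function.Injective φ) (he : markedCount f + 1 ≤ 2 ^ e)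
    (hm : 0 < markedCount f → 1 / 2 ≤ Real.sin ((2 * m + 1) * groverAngle f) ^ 2) :
    Timed.Spec (Timed.whileLoop (fun t : Ordnode α => t.size < markedCount f)
      (collectRound cm f g m φ) .nil)
      (40 * (collectRoundCost κ cm g m e * (markedCount f * (e + 1)))) (ENNReal.ofReal (1 / 20))
      fun t => t.Valid ∧ treeSet t = (Finset.univ.filter f).image φ := by
  intro B b₀ hb₀
  set k := markedCount f with hk
  set c := collectRoundCost κ cm g m e with hc
  set T := 40 * (c * (k * (e + 1))) with hT
  set G := (Finset.univ.filter f).image φ with hG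
  have hGcard : G.card = k := by
    rw [hG, Finset.card_image_of_injective _ hφ, hk]; unfold markedCount; congr!
  have hc1 : 1 ≤ c := by rw [hc]; unfold collectRoundCost; omega
  have hc1' : (1 : ℝ) ≤ c := by exact_mod_cast hc1
  have hTb : (B : ℝ) + T ≤ b₀ := by exact_mod_cast hb₀
  set Inv : Ordnode α → Prop := fun t => t.Valid ∧ treeSet t ⊆ G with hInv
  have hsize : ∀ t, Inv t → t.size ≤ k := fun t h => by
    rw [← card_treeSet h.1, ← hGcard]; exact Finset.card_le_card h.2
  -- Coupon collector: a bound on the expected time still needed plus the time already used,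
  -- relative to `T + 1`. The summand `1` reflects that a failure leaves less than `B`, so at least
  -- `T + 1` units have been spent. The factor `2` accounts for the success probability `1 / 2` of a
  -- sample.
  set pot : Ordnode α → ℝ → ℝ := fun t b =>
    (2 * c * k * harmonicSum (k - t.size) + b₀ - b) / (T + 1) with hpot
  set Θ : Ordnode α → ℕ → ℝ≥0∞ := fun t b =>
    if Inv t ∧ b ≤ b₀ then min 1 (ENNReal.ofReal (pot t b)) else 1 with hΘ
  have hΘ1 : ∀ t b, Θ t b ≤ 1 := fun t b => by
    simp only [hΘ]; split_ifs
    · exact min_le_left _ _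
    · exact le_rfl
  have hT0 : (0 : ℝ) < T + 1 := by positivity
  have hH0 := harmonicSum_nonneg
  have hterm : ∀ j, 0 ≤ 2 * (c : ℝ) * k * harmonicSum j := fun j =>
    mul_nonneg (by positivity) (hH0 j)
  have hcond : ∀ t : Ordnode α, t.size < k → 2 * (c : ℝ) ≤ 2 * c * k * harmonicSum (k - t.size) := by
    intro t ht
    have h1 : 1 ≤ harmonicSum (k - t.size) := one_le_harmonicSum (by omega)
    have h2 : (1 : ℝ) ≤ k := by exact_mod_cast (by omega : 1 ≤ k)
    have h3 : 1 ≤ (k : ℝ) * harmonicSum (k - t.size) := by nlinarith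
    nlinarith
  -- A budget that does not cover a whole round already counts as failure: the outstanding term is
  -- at least `2 * c`, which outweighs the unused time.
  have hlarge : ∀ t b, t.size < k → b + 1 ≤ c → (1 : ℝ≥0∞) ≤ Θ t (b + 1) := by
    intro t b ht hb
    simp only [hΘ]
    split_ifs
    · refine le_min le_rfl ?_
      rw [ENNReal.one_le_ofReal, hpot, one_le_div hT0]
      have h1 := hcond t ht
      have h2 : (b : ℝ) + 1 ≤ c := by exact_mod_cast hb
      push_cast
      have h3 : (0 : ℝ) ≤ B := by positivity
      linarith
    · exact le_rfl
  refine (Timed.loss_whileLoop_le (Θ := Θ) (nonInc_collectRound cm f g m φ) ?_ ?_ ?_ _ _).trans ?_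
  · intro t b ht
    by_cases hI' : Inv t ∧ b ≤ b₀
    · have hI := hI'.1
      have hle := hsize t hI
      have hQ : treeSet t = G := Finset.eq_of_subset_of_card_le hI.2 (by
        rw [hGcard, card_treeSet hI.1]; omega)
      by_cases hb : B ≤ b
      · rw [if_pos ⟨⟨hI.1, hQ⟩, hb⟩]; exact zero_le
      · rw [if_neg fun h => hb h.2]
        simp only [hΘ, if_pos hI']
        refine le_min le_rfl ?_
        rw [ENNReal.one_le_ofReal, hpot, one_le_div hT0]
        have h1 := hterm (k - t.size)
        have h2 : (b : ℝ) + 1 ≤ B := by exact_mod_cast (by omega : b + 1 ≤ B)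
        linarith
    · simp only [hΘ, if_neg hI']
      split_ifs <;> simp
  · intro t ht
    simp only [hΘ]
    split_ifs
    · refine le_min le_rfl ?_
      rw [ENNReal.one_le_ofReal, hpot, one_le_div hT0]
      have h1 := hcond t ht
      have h3 : (0 : ℝ) ≤ B := by positivity
      push_cast
      linarith
    · exact le_rfl
  · intro t b ht
    by_cases hbc : b + 1 ≤ c
    · exact (Timed.loss_le_one _ _ hΘ1).trans (hlarge t b ht hbc)
    push Not at hbc
    by_cases hI' : Inv t ∧ b + 1 ≤ b₀
    swap
    · simp only [hΘ, if_neg hI']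
      exact Timed.loss_le_one _ _ hΘ1
    obtain ⟨hI, hbb⟩ := id hI'
    simp only [hΘ, if_pos hI']
    refine le_min (Timed.loss_le_one _ _ hΘ1) ?_
    have hbb' : (b : ℝ) + 1 ≤ b₀ := by exact_mod_cast hbb
    have hk0 : 0 < k := by omega
    have hkR : (0 : ℝ) < k := by exact_mod_cast hk0
    set i := t.size with hi
    set rem : ℝ := 1 / ((k - i : ℕ) : ℝ) with hrem
    have hki : (0 : ℝ) < ((k - i : ℕ) : ℝ) := by exact_mod_cast (by omega : 0 < k - i)
    have hHstep : harmonicSum (k - i - 1) = harmonicSum (k - i) - rem := by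
      obtain ⟨j, hj⟩ := Nat.exists_eq_add_of_lt (show 0 < k - i by omega)
      have e1 : k - i - 1 = j := by omega
      have e2 : k - i = j + 1 := by omega
      rw [hrem, e1, e2]
      unfold harmonicSum
      rw [Finset.sum_range_succ]
      push_cast; ring
    set v : ℝ := (2 * c * k * harmonicSum (k - i) + b₀ - (b + 1) + c) / (T + 1) with hv
    have hvnew : v - 2 * c * k * rem / (T + 1) =
        (2 * c * k * harmonicSum (k - i - 1) + b₀ - (b + 1) + c) / (T + 1) := by
      rw [hHstep, hv, ← sub_div]; congr 1; ring
    set isNew : Reg κ → Prop := fun x => φ x ∉ treeSet t with hnew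
    set h : Reg κ → ℝ := fun x =>
      v - if f x ∧ isNew x then 2 * c * k * rem / (T + 1) else 0 with hh
    have hloss := loss_collectRound_le cm f g m e φ hI.1 (t := t) (b := b)
      (by rw [← hi]; omega) (by omega) Θ h v ?_ ?_ ?_
    · refine hloss.trans (ENNReal.ofReal_le_ofReal ?_)
      -- Injectivity of `φ` identifies the marked states not yet in the tree with `G \ treeSet t`,
      -- so `k - i` of the `k` marked outcomes are new.
      have hcount : ((Finset.univ.filter fun x => f x ∧ isNew x).card : ℝ) = (k - i : ℕ) := by
        have h1 : ((Finset.univ.filter fun x => f x ∧ isNew x).image φ) = G \ treeSet t := by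
          ext y
          simp only [Finset.mem_image, Finset.mem_filter, Finset.mem_univ, true_and,
            Finset.mem_sdiff, hG, hnew]
          constructor
          · rintro ⟨x, ⟨h1, h2⟩, rfl⟩; exact ⟨⟨x, h1, rfl⟩, h2⟩
          · rintro ⟨⟨x, h1, rfl⟩, h2⟩; exact ⟨x, ⟨h1, h2⟩, rfl⟩
        have h2 := congrArg Finset.card h1
        rw [Finset.card_image_of_injective _ hφ, Finset.card_sdiff_of_subset hI.2, hGcard,
          card_treeSet hI.1] at h2
        exact_mod_cast h2
      have hsum : ∑ x ∈ Finset.univ.filter f, h x = k * v - 2 * c * k / (T + 1) := by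
        simp only [hh]
        rw [Finset.sum_sub_distrib, Finset.sum_const, nsmul_eq_mul]
        have h1 : ((Finset.univ.filter f).card : ℝ) = k := by
          rw [hk]; unfold markedCount; congr!
        have h2 : ∑ x ∈ Finset.univ.filter f, (if f x ∧ isNew x then 2 * c * k * rem / (T + 1) else 0)
            = (k - i : ℕ) * (2 * c * k * rem / (T + 1)) := by
          rw [← hcount, ← Finset.sum_filter, Finset.filter_filter, Finset.sum_const, nsmul_eq_mul]
          congr! 4
          tauto
        rw [h1, h2, hrem]
        field_simp
      rw [hsum, Real.cos_sq']
      have hp := hm hk0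
      set p := Real.sin ((2 * m + 1) * groverAngle f) ^ 2
      have e1 : ((k : ℝ) * v - 2 * c * k / (T + 1)) / k = v - 2 * c / (T + 1) := by
        field_simp
      have e2 : pot t ((b + 1 : ℕ) : ℝ) = v - c / (T + 1) := by
        rw [hpot, hv, ← sub_div]
        push_cast
        congr 1; ring
      rw [e1, e2]
      -- A new seed lowers the numerator by `2 * c * k / (k - i)` and has probability `p * (k - i) /
      -- k`. The expected decrease `2 * c * p` covers the cost `c` of the round.
      have e3 : c / (T + 1) ≤ p * (2 * c / (T + 1)) := by
        have : 0 ≤ (c : ℝ) / (T + 1) := by positivity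
        calc (c : ℝ) / (T + 1) ≤ (2 * p) * (c / (T + 1)) := le_mul_of_one_le_left this (by linarith)
          _ = _ := by ring
      linarith
    · intro x
      simp only [hh]
      split_ifs
      · rw [hvnew]
        apply div_nonneg _ hT0.le
        have := hterm (k - i - 1)
        linarith
      · rw [sub_zero, hv]
        apply div_nonneg _ hT0.le
        have := hterm (k - i)
        linarith
    · intro x hx
      simp only [hh]
      rw [if_neg fun h => hx h.1, sub_zero]
    · intro x b' hb1 hb2
      have hb3 : b' ≤ b₀ := by omega
      have hb4 : (b : ℝ) + 1 ≤ b' + c := by exact_mod_cast hb2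
      by_cases hfx : f x
      · have hins := treeSet_insert (φ x) hI.1
        have hvalid := Ordnode.insert.valid (φ x) hI.1
        have hI2 : Inv (Ordnode.insert (φ x) t) := by
          refine ⟨hvalid, ?_⟩
          rw [hins, Finset.insert_subset_iff]
          exact ⟨Finset.mem_image_of_mem _ (by simpa using hfx), hI.2⟩
        rw [if_pos hfx]
        simp only [hΘ]
        rw [if_pos ⟨hI2, hb3⟩]
        refine (min_le_right _ _).trans (ENNReal.ofReal_le_ofReal ?_)
        simp only [hh, hpot]
        by_cases hx : isNew x
        · have hsz : (Ordnode.insert (φ x) t).size = i + 1 := by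
            rw [← card_treeSet hvalid, hins, Finset.card_insert_of_notMem hx, card_treeSet hI.1]
          rw [if_pos ⟨hfx, hx⟩, hvnew, hsz, ← Nat.sub_sub]
          gcongr
          linarith
        · have hsz : (Ordnode.insert (φ x) t).size = i := by
            rw [← card_treeSet hvalid, hins, Finset.insert_eq_of_mem (not_not.1 hx),
              card_treeSet hI.1]
          rw [if_neg fun h => hx h.2, hsz, sub_zero, hv]
          gcongr
          linarith
      · rw [if_neg hfx]
        simp only [hΘ]
        rw [if_pos ⟨hI, hb3⟩]
        refine (min_le_right _ _).trans (ENNReal.ofReal_le_ofReal ?_)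
        simp only [hh, hpot]
        rw [if_neg fun h => hfx h.1, sub_zero, hv]
        gcongr
        linarith
  · have hI : Inv (.nil : Ordnode α) ∧ b₀ ≤ b₀ := ⟨⟨Ordnode.valid_nil, by simp⟩, le_rfl⟩
    simp only [hΘ, if_pos hI]
    refine (min_le_right _ _).trans (ENNReal.ofReal_le_ofReal ?_)
    simp only [hpot]
    rw [div_le_div_iff₀ hT0 (by norm_num)]
    have h1 : harmonicSum (k - (Ordnode.nil : Ordnode α).size) ≤ e + 1 :=
      harmonicSum_le (by omega)
    have h2 : (T : ℝ) = 40 * (c * (k * (e + 1))) := by rw [hT]; push_cast; ring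
    have h3 : 2 * (c : ℝ) * k * harmonicSum (k - (Ordnode.nil : Ordnode α).size) ≤
        2 * c * k * (e + 1) := by gcongr
    rw [h2]
    linarith

end CollectLoop

/-! ### Quantum seed generation as counting followed by collecting -/

section QuantumSeeds
variable {L n : ℕ} (cfg : Config) (cm : CostModel) (ev : EventRecord L n)

/-- The number of bits of a triplet of labels. -/
def seedBits (n : ℕ) : ℕ := 3 * labelBits n

/-- A bound on the cost of one round of seed generation, when there are `k` good seeds. -/
def seedRoundCost (cm : CostModel) (n k : ℕ) : ℕ :=
  collectRoundCost (Fin 3 × Fin (labelBits n)) cm (seedOracleGates cm n)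
    (groverIterations (seedBits n) k) (seedBits n + 1)

/-- A bound on the cost of quantum seed generation, when there are `k` good seeds. -/
def seedCost (cm : CostModel) (n k : ℕ) : ℕ :=
  (2 * phaseCost cm (seedBits n) (seedOracleGates cm n) (countPrecision (seedBits n) k) + cm.step) +
    (40 * (seedRoundCost cm n k * (k * (seedBits n + 1 + 1))) + k * cm.step)

/-- Quantum seed generation finds exactly the good seeds, in the same order as the classical
version. -/
lemma spec_quantumSeedGeneration :
    Timed.Spec (quantumSeedGeneration cfg cm ev) (seedCost cm n (kSeed cfg ev))
      (ENNReal.ofReal (1 / 20) + ENNReal.ofReal (1 / 20))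
      fun s => s = (seedGeneration cfg cm ev).val := by
  classical
  have hcard : Fintype.card (Fin 3 × Fin (labelBits n)) = seedBits n := by simp [seedBits]
  have hmark := markedCount_seeds cfg ev
  unfold quantumSeedGeneration
  have hcount := spec_quantumCount cm (fun x : Reg (Fin 3 × Fin (labelBits n)) =>
    IsGoodSeed cfg ev (regSeed x)) (seedOracleGates cm n)
  rw [hmark, hcard] at hcount
  refine hcount.bind ?_
  rintro _ rfl
  have hle : kSeed cfg ev ≤ 2 ^ seedBits n := by
    rw [← hmark, ← hcard]; exact markedCount_le _
  have hcoll := spec_collect cm (fun x : Reg (Fin 3 × Fin (labelBits n)) =>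
    IsGoodSeed cfg ev (regSeed x)) (seedOracleGates cm n)
    (groverIterations (seedBits n) (kSeed cfg ev)) (seedBits n + 1) regSeed (regSeed_injective _)
    (by rw [hmark, pow_succ]; have := Nat.one_le_two_pow (n := seedBits n); omega)
    (by
      intro h
      have := half_le_sin_sq _ h
      rwa [hmark, hcard] at this)
  rw [hmark] at hcoll
  have hfin : ∀ t : Ordnode Seed, (t.Valid ∧ treeSet t = (Finset.univ.filter
      fun x : Reg (Fin 3 × Fin (labelBits n)) => IsGoodSeed cfg ev (regSeed x)).image regSeed) →
      Timed.Spec (do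
        Timed.tick (t.size * cm.step)
        pure t.toList : Timed (List Seed)) (kSeed cfg ev * cm.step) 0
        fun s => s = (seedGeneration cfg cm ev).val := by
    rintro t ⟨ht, hset⟩
    rw [image_regSeed cfg cm ev] at hset
    have hsize : t.size = kSeed cfg ev := by
      rw [← card_treeSet ht, hset, List.toFinset_card_of_nodup
        ((pairwise_seedGeneration cfg cm ev).imp fun h => h.ne), length_seedGeneration]
    rw [← hsize]
    refine (Timed.spec_tick _).bind_zero_left (T₂ := 0) fun _ _ => Timed.spec_pure _ ?_
    refine toList_eq_of_mem_iff ht (pairwise_seedGeneration cfg cm ev) fun x => ?_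
    have := Finset.ext_iff.1 hset x
    simpa [treeSet] using this
  have := hcoll.bind hfin
  rw [add_zero] at this
  rw [hcard]
  exact this

end QuantumSeeds

/-! ### Sorting -/

section Sorting
variable {α : Type} (cm : CostModel) (before : α → α → Prop)

lemma mergeLists_eq : ∀ xs ys : List α, (mergeLists cm before xs ys).val.Perm (xs ++ ys) ∧
    (mergeLists cm before xs ys).cost ≤ (xs.length + ys.length) * cm.step
  | [], ys => by simp [mergeLists, Counted.val_pure, Counted.cost_pure]
  | x :: xs, [] => by simp [mergeLists, Counted.val_pure, Counted.cost_pure]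
  | x :: xs, y :: ys => by
    rw [mergeLists]
    split_ifs
    · have ih := mergeLists_eq (x :: xs) ys
      simp only [Counted.val_bind, Counted.cost_bind, Counted.val_pure, Counted.cost_pure,
        Counted.cost_tick, List.length_cons] at ih ⊢
      refine ⟨?_, ?_⟩
      · exact (ih.1.cons y).trans (List.perm_middle.symm)
      · calc _ ≤ cm.step + (((xs.length + 1) + ys.length) * cm.step + 0) := by gcongr; exact ih.2
          _ = _ := by ring
    · have ih := mergeLists_eq xs (y :: ys)
      simp only [Counted.val_bind, Counted.cost_bind, Counted.val_pure, Counted.cost_pure,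
        Counted.cost_tick, List.length_cons] at ih ⊢
      refine ⟨ih.1.cons x, ?_⟩
      calc _ ≤ cm.step + ((xs.length + (ys.length + 1)) * cm.step + 0) := by gcongr; exact ih.2
        _ = _ := by ring
  termination_by xs ys => xs.length + ys.length

/-- Splitting and merging cost at most two steps per element on each of `e` levels. That the result
is sorted is not needed: both versions of the track finder pass the same list to the same
deterministic code, so only length, hit counts and cost matter. -/
lemma mergeSort_eq : ∀ (e : ℕ) (l : List α), l.length ≤ 2 ^ e →
    (mergeSort cm before l).val.Perm l ∧
      (mergeSort cm before l).cost ≤ 2 * (e * (l.length * cm.step)) := by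
  intro e
  induction e with
  | zero =>
    intro l hl
    rw [mergeSort, dif_pos (by simpa using hl)]
    simp [Counted.val_pure, Counted.cost_pure]
  | succ e ih =>
    intro l hl
    rw [mergeSort]
    split_ifs with h
    · simp [Counted.val_pure, Counted.cost_pure]
    · rw [pow_succ] at hl
      have h1 := ih (l.take (l.length / 2)) (by rw [List.length_take]; omega)
      have h2 := ih (l.drop (l.length / 2)) (by rw [List.length_drop]; omega)
      have h3 := mergeLists_eq cm before (mergeSort cm before (l.take (l.length / 2))).val
        (mergeSort cm before (l.drop (l.length / 2))).val
      simp only [Counted.val_bind, Counted.cost_bind, Counted.cost_tick]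
      refine ⟨?_, ?_⟩
      · refine h3.1.trans ((h1.1.append h2.1).trans ?_)
        rw [List.take_append_drop]
      · have h4 := h3.2
        have e1 : (l.take (l.length / 2)).length + (l.drop (l.length / 2)).length = l.length := by
          rw [List.length_take, List.length_drop]; omega
        rw [h1.1.length_eq, h2.1.length_eq, e1] at h4
        have h5 : 2 * (e * ((l.take (l.length / 2)).length * cm.step)) +
            2 * (e * ((l.drop (l.length / 2)).length * cm.step)) =
            2 * (e * (l.length * cm.step)) := by
          rw [← Nat.mul_add, ← Nat.mul_add, ← Nat.add_mul, e1]
        calc _ ≤ l.length * cm.step + (2 * (e * ((l.take (l.length / 2)).length * cm.step)) +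
              (2 * (e * ((l.drop (l.length / 2)).length * cm.step)) + l.length * cm.step)) := by
              gcongr
              · exact h1.2
              · exact h2.2
          _ = 2 * (e * (l.length * cm.step)) + 2 * (l.length * cm.step) := by rw [← h5]; ring
          _ = _ := by ring

end Sorting

/-! ### The cost of cleaning and selection -/

section Cleaning
variable {L n : ℕ} (cfg : Config) (cm : CostModel)

lemma shareBound_le {h L : ℕ} (hL : h ≤ L) : shareBound cfg h ≤ shareBound cfg L := by
  unfold shareBound
  rcases le_or_gt 0 cfg.shareFrac with hf | hf
  · gcongr
  · have h1 : cfg.shareFrac * h ≤ 0 := mul_nonpos_of_nonpos_of_nonneg hf.le (by positivity)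
    rw [Nat.ceil_eq_zero.2 h1]
    exact Nat.zero_le _

lemma length_sublistsLen_le {β : Type} {l : List β} {L : ℕ} (h : l.length ≤ L) (i : ℕ) :
    (List.sublistsLen i l).length ≤ 2 ^ L := by
  rw [List.length_sublistsLen]
  exact (Nat.choose_le_two_pow _ _).trans (Nat.pow_le_pow_right (by norm_num) h)

lemma cost_anyMem_le (tuples : List HitTuple) {T : Ordnode HitTuple} (hT : T.Valid) {e : ℕ}
    (he : T.size + 1 ≤ 2 ^ e) :
    (anyMem cm tuples T).cost ≤ tuples.length * ((3 * e + 1) * cm.step) := by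
  unfold anyMem
  refine (Counted.cost_foldlM_le _ (fun _ _ => True) _ tuples 0 false trivial ?_).1
  intro j hj b _
  refine ⟨?_, trivial⟩
  rw [Counted.cost_bind, Counted.cost_pure, add_zero]
  exact Nat.mul_le_mul_right _ (searchPath_le _ hT he)

/-- A bound on the cost of treating one track with at most `L` hits. -/
def cleanStepCost (cm : CostModel) (L R e : ℕ) : ℕ :=
  cm.step + (2 * R + 1) * (2 ^ L * ((3 * e + 1) * cm.step))

/-- The state of cleaning after `j` tracks. -/
def CleanInv (L R j : ℕ) (st : (ℕ → ℕ → Ordnode HitTuple) × List Candidate) : Prop :=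
  (∀ i i', (st.1 i i').Valid ∧ (st.1 i i').size ≤ j * (R * 2 ^ L)) ∧ st.2.length ≤ j

/-- A track of at most `L` hits has at most `2 ^ L` tuples of each size, so it adds at most `R * 2 ^
L` nodes to any tree. Trees therefore stay linear in the number of tracks treated, and each access
costs `3 * e + 1` steps. -/
lemma cleanStep_spec {t : Candidate} (ht : t.hits.length ≤ L) {j e : ℕ}
    {st : (ℕ → ℕ → Ordnode HitTuple) × List Candidate}
    (hst : CleanInv L (shareBound cfg L) j st)
    (he : (j + 1) * (shareBound cfg L * 2 ^ L) + 1 ≤ 2 ^ e) :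
    (cleanStep cfg cm (shareBound cfg L) st t).cost ≤ cleanStepCost cm L (shareBound cfg L) e ∧
      CleanInv L (shareBound cfg L) (j + 1) (cleanStep cfg cm (shareBound cfg L) st t).val := by
  set R := shareBound cfg L with hR
  have hr : shareBound cfg t.hits.length ≤ R := shareBound_le cfg ht
  set r := shareBound cfg t.hits.length with hr'
  set Q := (3 * e + 1) * cm.step with hQ
  have hlen : ∀ i, (List.sublistsLen i t.hits).length ≤ 2 ^ L := length_sublistsLen_le ht
  have hjR : (j + 1) * (R * 2 ^ L) = j * (R * 2 ^ L) + R * 2 ^ L := by ring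
  have hany : ∀ i i' i'', (anyMem cm (List.sublistsLen i t.hits) (st.1 i' i'')).cost ≤ 2 ^ L * Q := by
    intro i i' i''
    have h1 := (hst.1 i' i'').2
    exact (cost_anyMem_le cm _ (hst.1 i' i'').1 (e := e) (by omega)).trans
      (Nat.mul_le_mul_right _ (hlen i))
  have hloop : ∀ (l : List ℕ) (F : ℕ → Counted Bool), (∀ i, (F i).cost ≤ 2 ^ L * Q) →
      (l.foldlM (fun b i => do
        let c ← F i
        pure (b || c)) false : Counted Bool).cost ≤ l.length * (2 ^ L * Q) := by
    intro l F hF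
    refine (Counted.cost_foldlM_le _ (fun _ _ => True) _ l 0 false trivial ?_).1
    intro j hj b _
    refine ⟨?_, trivial⟩
    rw [Counted.cost_bind, Counted.cost_pure, add_zero]
    exact hF _
  have hb1 := hloop (List.range' 1 r) (fun i => anyMem cm (List.sublistsLen i t.hits) (st.1 i i))
    fun i => hany _ _ _
  have hb2 := hloop (List.range' r (R + 1 - r))
    (fun i => anyMem cm (List.sublistsLen r t.hits) (st.1 r i)) fun i => hany _ _ _
  rw [List.length_range'] at hb1 hb2
  have hins := Counted.cost_foldlM_le (fun (trees : ℕ → ℕ → Ordnode HitTuple) i => (do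
      let T ← (List.sublistsLen i t.hits).foldlM (fun T x => treeInsert cm x T) (trees i r)
      pure (Function.update trees i (Function.update (trees i) r T)) : Counted _))
    (fun p trees => ∀ i i', (trees i i').Valid ∧ (trees i i').size ≤ j * (R * 2 ^ L) + p * 2 ^ L)
    (2 ^ L * Q) (List.range' 1 r) 0 st.1
    (fun i i' => ⟨(hst.1 i i').1, by have := (hst.1 i i').2; omega⟩) (by
      intro p hp trees hI
      rw [List.length_range'] at hp
      rw [zero_add] at hI ⊢
      have hpR : p * 2 ^ L + 2 ^ L ≤ R * 2 ^ L := by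
        rw [← Nat.succ_mul]; exact Nat.mul_le_mul_right _ (by omega)
      set i := (List.range' 1 r)[p]
      have hin := Counted.cost_foldlM_le (fun T x => treeInsert cm x T)
        (fun u (T : Ordnode HitTuple) => T.Valid ∧ T.size ≤ j * (R * 2 ^ L) + p * 2 ^ L + u) Q
        (List.sublistsLen i t.hits) 0 (trees i r) (hI i r) (by
          intro u hu T hT
          have hu' := hu.trans_le (hlen i)
          refine ⟨Nat.mul_le_mul_right _ (searchPath_le _ hT.1 (by omega)),
            Ordnode.insert.valid _ hT.1, ?_⟩
          have := size_insert_le (List.sublistsLen i t.hits)[u] hT.1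
          exact this.trans (by omega))
      rw [Counted.cost_bind, Counted.val_bind, Counted.cost_pure, Counted.val_pure, add_zero]
      refine ⟨hin.1.trans (Nat.mul_le_mul_right _ (hlen i)), fun a a' => ?_⟩
      have hp1 : (p + 1) * 2 ^ L = p * 2 ^ L + 2 ^ L := by ring
      rw [hp1]
      by_cases ha : a = i
      · subst ha
        by_cases ha' : a' = r
        · subst ha'
          simp only [Function.update_self]
          have := hin.2.2
          have := hlen i
          exact ⟨hin.2.1, by omega⟩
        · rw [Function.update_self, Function.update_of_ne ha']
          obtain ⟨h1, h2⟩ := hI i a'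
          exact ⟨h1, h2.trans (by rw [← Nat.add_assoc]; exact Nat.le_add_right _ _)⟩
      · rw [Function.update_of_ne ha]
        obtain ⟨h1, h2⟩ := hI a a'
        exact ⟨h1, h2.trans (by rw [← Nat.add_assoc]; exact Nat.le_add_right _ _)⟩)
  rw [List.length_range'] at hins
  unfold cleanStep
  rw [← hr']
  simp only [Counted.cost_bind, Counted.val_bind, Counted.cost_tick]
  have htot : r * (2 ^ L * Q) + (R + 1 - r) * (2 ^ L * Q) = (R + 1) * (2 ^ L * Q) := by
    rw [← Nat.add_mul]; congr 1; omega
  have htot2 : r * (2 ^ L * Q) ≤ R * (2 ^ L * Q) := Nat.mul_le_mul_right _ hr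
  have htot3 : (2 * R + 1) * (2 ^ L * Q) = (R + 1) * (2 ^ L * Q) + R * (2 ^ L * Q) := by ring
  unfold cleanStepCost
  rw [← hQ, htot3]
  split_ifs with hb
  · rw [Counted.cost_pure, Counted.val_pure]
    refine ⟨by omega, fun i i' => ⟨(hst.1 i i').1, ?_⟩, by have := hst.2; omega⟩
    have := (hst.1 i i').2
    omega
  · rw [Counted.cost_bind, Counted.val_bind, Counted.cost_pure, Counted.val_pure]
    obtain ⟨hc, hI⟩ := hins
    refine ⟨?_, fun i i' => ?_, ?_⟩
    · rw [add_zero]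
      refine Nat.add_le_add_left ?_ _
      rw [← htot, Nat.add_assoc]
      exact Nat.add_le_add hb1 (Nat.add_le_add hb2 (hc.trans htot2))
    · obtain ⟨h1, h3⟩ := hI i i'
      have h2 : (0 + r) * 2 ^ L ≤ R * 2 ^ L := Nat.mul_le_mul_right _ (by omega)
      exact ⟨h1, h3.trans (by omega)⟩
    · rw [List.length_append]
      have := hst.2
      simpa using this

/-- The cost of cleaning is almost linear. -/
lemma improvedCleaning_spec {ts : List Candidate} (hts : ∀ t ∈ ts, t.hits.length ≤ L) {e : ℕ}
    (he : ts.length * (shareBound cfg L * 2 ^ L + 1) + 1 ≤ 2 ^ e) :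
    (improvedCleaning cfg cm L ts).cost ≤ 2 * (e * (ts.length * cm.step)) +
      (shareBound cfg L ^ 2 * cm.step + ts.length * cleanStepCost cm L (shareBound cfg L) e) ∧
    (improvedCleaning cfg cm L ts).val.length ≤ ts.length := by
  set R := shareBound cfg L with hR
  have he1 : ts.length ≤ 2 ^ e := by
    have : ts.length * 1 ≤ ts.length * (R * 2 ^ L + 1) := Nat.mul_le_mul_left _ (by omega)
    omega
  obtain ⟨hperm, hcost⟩ := mergeSort_eq cm
    (fun t u => quality cfg (L - 1) u < quality cfg (L - 1) t) e ts he1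
  have hlen := hperm.length_eq
  have hfold := Counted.cost_foldlM_le (cleanStep cfg cm R) (CleanInv L R)
    (cleanStepCost cm L R e) (mergeSort cm
      (fun t u => quality cfg (L - 1) u < quality cfg (L - 1) t) ts).val 0
    (fun _ _ => Ordnode.nil, [])
    ⟨fun i i' => ⟨Ordnode.valid_nil, Nat.zero_le _⟩, Nat.zero_le _⟩ (by
      intro j hj st hst
      rw [zero_add] at hst ⊢
      refine cleanStep_spec cfg cm (hts _ (hperm.mem_iff.1 (List.getElem_mem hj))) hst ?_
      have h1 : (j + 1) * (R * 2 ^ L) ≤ ts.length * (R * 2 ^ L + 1) :=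
        Nat.mul_le_mul (by omega) (by omega)
      exact (Nat.add_le_add_right h1 1).trans he)
  rw [hlen, zero_add] at hfold
  unfold improvedCleaning
  simp only [Counted.cost_bind, Counted.val_bind, Counted.cost_tick, Counted.cost_pure,
    Counted.val_pure, ← hR]
  exact ⟨by have := hfold.1; omega, hfold.2.2⟩

lemma cost_trackSelection (ev : EventRecord L n) (ts : List Candidate) :
    (trackSelection cfg cm ev ts).cost = ts.length * cm.step := by
  unfold trackSelection
  simp [Counted.cost_forEach, Counted.cost_bind, Counted.cost_tick, Counted.cost_pure]

end Cleaning

/-! ### Asymptotic bounds -/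

section Bounds

lemma two_pow_labelBits_le {n : ℕ} (hn : 1 ≤ n) : 2 ^ labelBits n ≤ 2 * n := by
  unfold labelBits
  rcases Nat.lt_or_ge 1 n with h | h
  · have := Nat.pow_pred_clog_lt_self (b := 2) (by norm_num) h
    have h1 : Nat.clog 2 n ≠ 0 := (Nat.clog_pos (by norm_num) h).ne'
    obtain ⟨j, hj⟩ := Nat.exists_eq_succ_of_ne_zero h1
    rw [hj, Nat.succ_eq_add_one] at this ⊢
    simp only [Nat.pred_eq_sub_one, Nat.add_sub_cancel] at this
    rw [pow_succ]
    omega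
  · have : n = 1 := by omega
    subst this
    simp

/-- The hypothesis `3 ≤ n` gives `log n ≥ 1`, which absorbs the additive constants of rounding up
and of the extra `1`. -/
lemma labelBits_succ_le {n : ℕ} (hn : 3 ≤ n) : ((labelBits n + 1 : ℕ) : ℝ) ≤ 4 * Real.log n := by
  have hn0 : (0 : ℝ) < n := by exact_mod_cast (by omega : 0 < n)
  have h1 : (1 : ℝ) ≤ Real.log n := by
    rw [Real.le_log_iff_exp_le hn0]
    have : (3 : ℝ) ≤ n := by exact_mod_cast hn
    linarith [Real.exp_one_lt_d9]
  have h2 : (labelBits n : ℝ) * Real.log 2 ≤ Real.log 2 + Real.log n := by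
    rw [← Real.log_pow, ← Real.log_mul (by norm_num) hn0.ne']
    apply Real.log_le_log (by positivity)
    exact_mod_cast two_pow_labelBits_le (by omega : 1 ≤ n)
  have h3 := Real.log_two_gt_d9
  have h4 := Real.log_two_lt_d9
  push_cast
  nlinarith

variable (cfg : Config) (cm : CostModel)

lemma seedOracleGates_le (n : ℕ) :
    seedOracleGates cm n ≤ (6 * cm.qram + cm.step) * (labelBits n + 1) := by
  unfold seedOracleGates
  calc _ ≤ 2 * (3 * (cm.qram * (labelBits n + 1))) + cm.step * (labelBits n + 1) := by
        gcongr; exact Nat.le_mul_of_pos_right _ (by omega)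
    _ = _ := by ring

/-- A constant for the cost of a Grover iteration in seed generation. -/
def seedIterationConst (cm : CostModel) : ℕ := 6 + 3 * cm.gate + 6 * cm.qram + cm.step

lemma seedIteration_le (n : ℕ) :
    seedBits n + (cm.gate * seedBits n + (seedBits n + seedOracleGates cm n)) ≤
      seedIterationConst cm * (labelBits n + 1) := by
  have h := seedOracleGates_le cm n
  have h1 : seedBits n ≤ 3 * (labelBits n + 1) := by unfold seedBits; omega
  unfold seedIterationConst
  calc _ ≤ 3 * (labelBits n + 1) + (cm.gate * (3 * (labelBits n + 1)) + (3 * (labelBits n + 1) +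
        (6 * cm.qram + cm.step) * (labelBits n + 1))) := by gcongr
    _ = _ := by ring

lemma countPrecision_le {n k : ℕ} (hk : k ≤ n ^ 3) :
    countPrecision (seedBits n) k ≤ 12 * (labelBits n + 1) := by
  have h1 : k ≤ 2 ^ seedBits n := hk.trans (by
    unfold seedBits; rw [mul_comm, pow_mul]; exact Nat.pow_le_pow_left (le_two_pow_labelBits n) 3)
  have h2 : (k : ℝ) + 1 ≤ 2 ^ (seedBits n + 2) := by
    have := Nat.one_le_two_pow (n := seedBits n)
    exact_mod_cast (by rw [pow_add]; omega : k + 1 ≤ 2 ^ (seedBits n + 2))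
  have h3 : √(((k : ℝ) + 1) * 2 ^ seedBits n) ≤ 2 ^ (seedBits n + 1) := by
    rw [Real.sqrt_le_left (by positivity)]
    calc ((k : ℝ) + 1) * 2 ^ seedBits n ≤ 2 ^ (seedBits n + 2) * 2 ^ seedBits n := by gcongr
      _ = _ := by ring
  unfold countPrecision
  have h4 : ⌈2 ^ 11 * √(((k : ℝ) + 1) * 2 ^ seedBits n)⌉₊ ≤ 2 ^ (seedBits n + 12) := by
    rw [Nat.ceil_le]
    calc 2 ^ 11 * √(((k : ℝ) + 1) * 2 ^ seedBits n) ≤ 2 ^ 11 * 2 ^ (seedBits n + 1) := by gcongr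
      _ = _ := by push_cast; ring
  refine (Nat.clog_le_of_le_pow h4).trans ?_
  unfold seedBits
  omega

lemma two_pow_seedBits_le {n : ℕ} (hn : 1 ≤ n) : (2 : ℝ) ^ seedBits n ≤ 8 * n ^ 3 := by
  have h := two_pow_labelBits_le hn
  have h' : (2 : ℝ) ^ labelBits n ≤ 2 * n := by exact_mod_cast h
  unfold seedBits
  rw [mul_comm, pow_mul]
  calc ((2 : ℝ) ^ labelBits n) ^ 3 ≤ (2 * n) ^ 3 := by gcongr
    _ = _ := by ring

section SeedCost
variable {n k : ℕ}

lemma one_le_seedRoot (hn : 1 ≤ n) : 1 ≤ √((n : ℝ) ^ 3 * max (k : ℝ) 1) := by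
  rw [Real.one_le_sqrt]
  have : (1 : ℝ) ≤ n := by exact_mod_cast hn
  exact one_le_mul_of_one_le_of_one_le (one_le_pow₀ this) (le_max_right _ _)

/-- As `k ≤ n ^ 3`, contributions linear in the number of seeds, such as listing them, are absorbed
by the square root. -/
lemma le_seedRoot (hk : k ≤ n ^ 3) : (k : ℝ) ≤ √((n : ℝ) ^ 3 * max (k : ℝ) 1) := by
  apply Real.le_sqrt_of_sq_le
  rw [sq]
  have : (k : ℝ) ≤ (n : ℝ) ^ 3 := by exact_mod_cast hk
  exact mul_le_mul this (le_max_left _ _) (by positivity) (by positivity)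

lemma two_pow_countPrecision_le (hn : 1 ≤ n) :
    (2 : ℝ) ^ countPrecision (seedBits n) k ≤ 2 ^ 15 * √((n : ℝ) ^ 3 * max (k : ℝ) 1) := by
  have h1 : √(((k : ℝ) + 1) * 2 ^ seedBits n) ≤ 4 * √((n : ℝ) ^ 3 * max (k : ℝ) 1) := by
    rw [show (4 : ℝ) = √(4 ^ 2) by rw [Real.sqrt_sq (by norm_num)], ← Real.sqrt_mul (by norm_num)]
    apply Real.sqrt_le_sqrt
    have h2 := two_pow_seedBits_le hn
    have h3 : (k : ℝ) + 1 ≤ 2 * max (k : ℝ) 1 := by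
      linarith [le_max_left (k : ℝ) 1, le_max_right (k : ℝ) 1]
    calc ((k : ℝ) + 1) * 2 ^ seedBits n ≤ (2 * max (k : ℝ) 1) * (8 * n ^ 3) := by gcongr
      _ = _ := by ring
  have h4 : (1 : ℝ) ≤ √(((k : ℝ) + 1) * 2 ^ seedBits n) := by
    rw [Real.one_le_sqrt]
    exact one_le_mul_of_one_le_of_one_le (by simp) (one_le_pow₀ (by norm_num))
  have h5 := two_pow_clog_le (x := 2 ^ 11 * √(((k : ℝ) + 1) * 2 ^ seedBits n)) (by linarith)
  push_cast at h5
  unfold countPrecision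
  linarith

/-- Collecting `k` seeds by searches of length `√(N / k)` costs `√(N k)`, with `N ≤ 8 n ^ 3` after
padding the labels to powers of two. -/
lemma groverIterations_mul_le (hn : 1 ≤ n) (hk : k ≤ n ^ 3) :
    (groverIterations (seedBits n) k : ℝ) * k ≤ 3 * √((n : ℝ) ^ 3 * max (k : ℝ) 1) := by
  rcases Nat.eq_zero_or_pos k with rfl | hk0
  · simp
  have hkR : (0 : ℝ) < k := by exact_mod_cast hk0
  have h1 : k ≤ 2 ^ seedBits n := hk.trans (by
    unfold seedBits; rw [mul_comm, pow_mul]; exact Nat.pow_le_pow_left (le_two_pow_labelBits n) 3)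
  calc (groverIterations (seedBits n) k : ℝ) * k ≤ √(2 ^ seedBits n / k) * k := by
        gcongr; exact groverIterations_le hk0 h1
    _ = √(2 ^ seedBits n / k * k ^ 2) := by
        rw [Real.sqrt_mul (by positivity), Real.sqrt_sq hkR.le]
    _ ≤ √(3 ^ 2 * ((n : ℝ) ^ 3 * max (k : ℝ) 1)) := by
        apply Real.sqrt_le_sqrt
        have h2 := two_pow_seedBits_le hn
        calc (2 : ℝ) ^ seedBits n / k * k ^ 2 = 2 ^ seedBits n * k := by field_simp
          _ ≤ (9 * n ^ 3) * max (k : ℝ) 1 := by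
            gcongr
            · have : (0 : ℝ) ≤ (n : ℝ) ^ 3 := by positivity
              linarith
            · exact le_max_left _ _
          _ = _ := by ring
    _ = 3 * √((n : ℝ) ^ 3 * max (k : ℝ) 1) := by
        rw [Real.sqrt_mul (by norm_num), Real.sqrt_sq (by norm_num)]

lemma phaseCost_le (hn : 1 ≤ n) (hk : k ≤ n ^ 3) :
    (phaseCost cm (seedBits n) (seedOracleGates cm n) (countPrecision (seedBits n) k) : ℝ) ≤
      (144 * cm.gate + 2 ^ 15 * (cm.gate * seedIterationConst cm) + 15) *
        (((labelBits n + 1 : ℕ) : ℝ) ^ 2 * √((n : ℝ) ^ 3 * max (k : ℝ) 1)) := by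
  have hS := one_le_seedRoot (k := k) hn
  have hp2 := two_pow_countPrecision_le (k := k) hn
  have hp := countPrecision_le hk
  have hG := seedIteration_le cm n
  have hc : seedBits n ≤ 3 * (labelBits n + 1) := by unfold seedBits; omega
  have hU : (1 : ℝ) ≤ ((labelBits n + 1 : ℕ) : ℝ) := by exact_mod_cast Nat.le_add_left 1 _
  generalize √((n : ℝ) ^ 3 * max (k : ℝ) 1) = S at *
  unfold phaseCost
  generalize countPrecision (seedBits n) k = p at *
  generalize seedBits n + (cm.gate * seedBits n + (seedBits n + seedOracleGates cm n)) = G at *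
  generalize labelBits n + 1 = u at *
  generalize seedBits n = c at *
  generalize seedIterationConst cm = K at *
  have h1 : cm.gate * p ^ 2 + ((2 ^ p - 1) * (cm.gate * G) + (c + p)) ≤
      cm.gate * (12 * u) ^ 2 + (2 ^ p * (cm.gate * (K * u)) + (3 * u + 12 * u)) := by
    gcongr; exact Nat.sub_le _ _
  have h2 : ((cm.gate * p ^ 2 + ((2 ^ p - 1) * (cm.gate * G) + (c + p)) : ℕ) : ℝ) ≤
      cm.gate * (12 * u) ^ 2 + (2 ^ p * (cm.gate * (K * u)) + (3 * u + 12 * u)) := by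
    exact_mod_cast h1
  refine h2.trans ?_
  have hU2 : (u : ℝ) ≤ u ^ 2 := by nlinarith
  calc (cm.gate : ℝ) * (12 * u) ^ 2 + (2 ^ p * (cm.gate * (K * u)) + (3 * u + 12 * u))
      ≤ cm.gate * (12 * u) ^ 2 * S + (2 ^ 15 * S * (cm.gate * (K * u ^ 2)) + 15 * (u ^ 2 * S)) := by
        refine add_le_add (le_mul_of_one_le_right (by positivity) hS) (add_le_add ?_ ?_)
        · gcongr
        · have : (u : ℝ) ^ 2 ≤ u ^ 2 * S := le_mul_of_one_le_right (by positivity) hS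
          linarith
    _ = _ := by ring

lemma seedRoundCost_mul_le (hn : 1 ≤ n) (hk : k ≤ n ^ 3) :
    (seedRoundCost cm n k : ℝ) * k ≤ (4 + 10 * cm.step + 3 * seedIterationConst cm) *
        (((labelBits n + 1 : ℕ) : ℝ) * √((n : ℝ) ^ 3 * max (k : ℝ) 1)) := by
  have hkS := le_seedRoot hk
  have hm := groverIterations_mul_le hn hk
  have hG := seedIteration_le cm n
  have hcard : Fintype.card (Fin 3 × Fin (labelBits n)) = seedBits n := by simp [seedBits]
  unfold seedRoundCost collectRoundCost groverGates
  rw [hcard]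
  generalize √((n : ℝ) ^ 3 * max (k : ℝ) 1) = S at *
  generalize groverIterations (seedBits n) k = m at *
  have h1 : 1 + (m * (seedBits n + (cm.gate * seedBits n + (seedBits n + seedOracleGates cm n))) +
      seedBits n) + cm.step + (3 * (seedBits n + 1) + 1) * cm.step ≤
      (4 + 10 * cm.step + seedIterationConst cm * m) * (labelBits n + 1) := by
    calc _ ≤ (labelBits n + 1) + (m * (seedIterationConst cm * (labelBits n + 1)) +
          3 * (labelBits n + 1)) + cm.step * (labelBits n + 1) + (9 * (labelBits n + 1)) * cm.step := by
          gcongr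
          · omega
          · unfold seedBits; omega
          · exact Nat.le_mul_of_pos_right _ (by omega)
          · unfold seedBits; omega
      _ = _ := by ring
  have h2 : ((1 + (m * (seedBits n + (cm.gate * seedBits n + (seedBits n + seedOracleGates cm n))) +
      seedBits n) + cm.step + (3 * (seedBits n + 1) + 1) * cm.step : ℕ) : ℝ) ≤
      (4 + 10 * cm.step + seedIterationConst cm * m) * ((labelBits n + 1 : ℕ) : ℝ) := by
    exact_mod_cast h1
  have hU0 : 0 ≤ ((labelBits n + 1 : ℕ) : ℝ) := by positivity
  generalize ((labelBits n + 1 : ℕ) : ℝ) = U at *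
  calc _ ≤ (4 + 10 * cm.step + seedIterationConst cm * m) * U * k := by gcongr
    _ = U * ((4 + 10 * cm.step) * k + seedIterationConst cm * (m * k)) := by ring
    _ ≤ U * ((4 + 10 * cm.step) * S + seedIterationConst cm * (3 * S)) := by gcongr
    _ = _ := by ring

/-- A constant for the cost of quantum seed generation. -/
def seedConst (cm : CostModel) : ℝ :=
  2 * (144 * cm.gate + 2 ^ 15 * (cm.gate * seedIterationConst cm) + 15) + 2 * cm.step +
    120 * (4 + 10 * cm.step + 3 * seedIterationConst cm)

/-- One logarithm comes from the gates of a Grover iteration, the other from the harmonic sum of the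
collector; in counting, the second one is needed for the quadratic cost of the Fourier transform. -/
lemma seedCost_le (hn : 1 ≤ n) (hk : k ≤ n ^ 3) :
    (seedCost cm n k : ℝ) ≤ seedConst cm *
      (((labelBits n + 1 : ℕ) : ℝ) ^ 2 * √((n : ℝ) ^ 3 * max (k : ℝ) 1)) := by
  have h1 := phaseCost_le cm hn hk
  have h2 := seedRoundCost_mul_le cm hn hk
  have hS := one_le_seedRoot (k := k) hn
  have hkS := le_seedRoot hk
  have hU : (1 : ℝ) ≤ ((labelBits n + 1 : ℕ) : ℝ) := by exact_mod_cast Nat.le_add_left 1 _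
  have hbits : ((seedBits n + 1 + 1 : ℕ) : ℝ) ≤ 3 * ((labelBits n + 1 : ℕ) : ℝ) := by
    exact_mod_cast (by unfold seedBits; omega : seedBits n + 1 + 1 ≤ 3 * (labelBits n + 1))
  have hV : (0 : ℝ) ≤ ((seedBits n + 1 + 1 : ℕ) : ℝ) := by positivity
  unfold seedCost seedConst
  rw [Nat.cast_add, Nat.cast_add, Nat.cast_add, Nat.cast_mul, Nat.cast_mul 40,
    Nat.cast_mul (seedRoundCost cm n k), Nat.cast_mul k, Nat.cast_mul k]
  generalize √((n : ℝ) ^ 3 * max (k : ℝ) 1) = S at *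
  generalize ((labelBits n + 1 : ℕ) : ℝ) = U at *
  generalize (phaseCost cm (seedBits n) (seedOracleGates cm n) (countPrecision (seedBits n) k) : ℝ)
    = P at *
  generalize ((seedBits n + 1 + 1 : ℕ) : ℝ) = V at *
  have hs0 : (0 : ℝ) ≤ cm.step := by positivity
  have hU2 : 1 ≤ U ^ 2 := one_le_pow₀ hU
  have hX : S ≤ U ^ 2 * S := le_mul_of_one_le_left (by linarith) hU2
  have h3 : (seedRoundCost cm n k : ℝ) * (k * V) ≤
      3 * ((4 + 10 * cm.step + 3 * seedIterationConst cm) * (U ^ 2 * S)) := by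
    calc (seedRoundCost cm n k : ℝ) * (k * V) = (seedRoundCost cm n k : ℝ) * k * V := by ring
      _ ≤ (4 + 10 * cm.step + 3 * seedIterationConst cm) * (U * S) * (3 * U) := by gcongr
      _ = _ := by ring
  have h4 : (cm.step : ℝ) ≤ cm.step * (U ^ 2 * S) := le_mul_of_one_le_right hs0 (by linarith)
  have h5 : (k : ℝ) * cm.step ≤ cm.step * (U ^ 2 * S) := by
    rw [mul_comm]; gcongr; linarith
  push_cast
  linarith

end SeedCost

end Bounds

/-! ### Asymptotic cost of track finding, cleaning and selection -/

section TrackBounds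
variable (cfg : Config) (cm : CostModel)

/-- A constant for the cost of an oracle call in quantum minimum finding. -/
def findCallConst (cfg : Config) (cm : CostModel) : ℕ :=
  4 + cm.gate + 2 * (2 * cm.qram + 3 * cm.step + cfg.lam + 1)

lemma findCallCost_le (n : ℕ) :
    findCallCost cfg cm n ≤ findCallConst cfg cm * (labelBits n + 1) := by
  have h : findOracleGates cfg cm n ≤
      (2 * cm.qram + 3 * cm.step + cfg.lam + 1) * (labelBits n + 1) := by
    unfold findOracleGates
    calc _ ≤ 2 * (cm.qram * (labelBits n + 1)) + 3 * (cm.step * (labelBits n + 1)) +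
          (cfg.lam + 1) * (labelBits n + 1) := by
          gcongr; exact Nat.le_mul_of_pos_right _ (by omega)
      _ = _ := by ring
  unfold findCallCost findCallConst
  generalize findOracleGates cfg cm n = g at *
  generalize labelBits n = q at *
  calc _ ≤ (q + 1) + ((q + 1) + (cm.gate * (q + 1) + ((q + 1) +
        (2 * cm.qram + 3 * cm.step + cfg.lam + 1) * (q + 1)))) + (q + 1) +
        (2 * cm.qram + 3 * cm.step + cfg.lam + 1) * (q + 1) := by
        gcongr <;> omega
    _ = _ := by ring

lemma findCalls_le {n : ℕ} (hn : 1 ≤ n) : (findCalls n : ℝ) ≤ 36 * √(n : ℝ) := by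
  have hs : 1 ≤ √(n : ℝ) := Real.one_le_sqrt.mpr (by exact_mod_cast hn)
  have h1 : √((2 : ℝ) ^ labelBits n) ≤ 1.42 * √(n : ℝ) := by
    rw [Real.sqrt_le_left (by positivity), mul_pow, Real.sq_sqrt (by positivity)]
    have h : (2 : ℝ) ^ labelBits n ≤ 2 * n := by exact_mod_cast two_pow_labelBits_le hn
    have : (0 : ℝ) ≤ n := by positivity
    linarith
  have h2 : (findCalls n : ℝ) < 24.5 * √((2 : ℝ) ^ labelBits n) + 1 :=
    Nat.ceil_lt_add_one (by positivity)
  linarith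

lemma clog_mul_cube_le (a n : ℕ) : Nat.clog 2 (a * n ^ 3) ≤ (a + 3) * (labelBits n + 1) := by
  have h : a * n ^ 3 ≤ 2 ^ (a + 3 * labelBits n) := by
    rw [pow_add, mul_comm 3, pow_mul]
    exact Nat.mul_le_mul Nat.lt_two_pow_self.le
      (Nat.pow_le_pow_left (le_two_pow_labelBits n) 3)
  refine (Nat.clog_le_of_le_pow h).trans ?_
  calc a + 3 * labelBits n ≤ a * (labelBits n + 1) + 3 * (labelBits n + 1) := by
        gcongr
        · exact Nat.le_mul_of_pos_right _ (by omega)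
        · omega
    _ = _ := by ring

/-- A constant for the cost of quantum filtering. -/
def filterConst (cfg : Config) (cm : CostModel) (L : ℕ) : ℝ :=
  2 * cm.step + cfg.lam * ((3 * L * cfg.lam ^ 2 + 3) * (findCallConst cfg cm * 36 + cm.step) +
    cm.step)

lemma filterCost_le (L : ℕ) {n : ℕ} (hn : 1 ≤ n) : (filterCost cfg cm L n : ℝ) ≤
    filterConst cfg cm L * (((labelBits n + 1 : ℕ) : ℝ) ^ 2 * √(n : ℝ)) := by
  have hs : 1 ≤ √(n : ℝ) := Real.one_le_sqrt.mpr (by exact_mod_cast hn)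
  have hU : (1 : ℝ) ≤ ((labelBits n + 1 : ℕ) : ℝ) := by exact_mod_cast Nat.le_add_left 1 _
  have h1 : (findRepetitions cfg L n : ℝ) ≤ (3 * L * cfg.lam ^ 2 + 3) * ((labelBits n + 1 : ℕ) : ℝ) := by
    exact_mod_cast clog_mul_cube_le (3 * L * cfg.lam ^ 2) n
  have h2 : (findCallCost cfg cm n : ℝ) ≤ findCallConst cfg cm * ((labelBits n + 1 : ℕ) : ℝ) := by
    exact_mod_cast findCallCost_le cfg cm n
  have h3 := findCalls_le hn
  unfold filterCost filterConst
  simp only [Nat.cast_add (2 * cm.step), Nat.cast_add _ cm.step, Nat.cast_mul, Nat.cast_ofNat]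
  generalize ((labelBits n + 1 : ℕ) : ℝ) = U at *
  generalize √(n : ℝ) = s at *
  have hU2 : 1 ≤ U ^ 2 := one_le_pow₀ hU
  have hX : 1 ≤ U ^ 2 * s := one_le_mul_of_one_le_of_one_le hU2 hs
  have hX2 : U ≤ U * (U * s) :=
    le_mul_of_one_le_right (by linarith) (one_le_mul_of_one_le_of_one_le hU hs)
  have hUs : 1 ≤ U * s := one_le_mul_of_one_le_of_one_le hU hs
  have hst : (0 : ℝ) ≤ cm.step := by positivity
  calc 2 * (cm.step : ℝ) + cfg.lam * (findRepetitions cfg L n *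
        (findCallCost cfg cm n * findCalls n + cm.step) + cm.step)
      ≤ 2 * (cm.step * (U ^ 2 * s)) + cfg.lam * (((3 * L * cfg.lam ^ 2 + 3) * U) *
        ((findCallConst cfg cm * U) * (36 * s) + cm.step * (U * s)) + cm.step * (U ^ 2 * s)) := by
        gcongr
        · exact le_mul_of_one_le_right hst hX
        · exact le_mul_of_one_le_right hst hUs
        · exact le_mul_of_one_le_right hst hX
    _ = _ := by ring

/-- A constant for the cost of following a seed. -/
def seedTrackConst (cfg : Config) (cm : CostModel) (L : ℕ) : ℝ :=
  cm.step + L * (cfg.lam * filterConst cfg cm L + cfg.lam * cfg.lam * ((cfg.lam + 1) * cm.step))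

lemma filterConst_nonneg (L : ℕ) : 0 ≤ filterConst cfg cm L := by
  unfold filterConst; positivity

lemma seedTrackCost_le (L : ℕ) {n : ℕ} (hn : 1 ≤ n) : (seedTrackCost cfg cm L n : ℝ) ≤
    seedTrackConst cfg cm L * (((labelBits n + 1 : ℕ) : ℝ) ^ 2 * √(n : ℝ)) := by
  have h := filterCost_le cfg cm L hn
  have hs : 1 ≤ √(n : ℝ) := Real.one_le_sqrt.mpr (by exact_mod_cast hn)
  have hU : (1 : ℝ) ≤ ((labelBits n + 1 : ℕ) : ℝ) := by exact_mod_cast Nat.le_add_left 1 _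
  have hX : 1 ≤ ((labelBits n + 1 : ℕ) : ℝ) ^ 2 * √(n : ℝ) :=
    one_le_mul_of_one_le_of_one_le (one_le_pow₀ hU) hs
  have hL : ((L - 3 : ℕ) : ℝ) ≤ L := by exact_mod_cast Nat.sub_le _ _
  unfold seedTrackCost seedTrackConst
  generalize ((labelBits n + 1 : ℕ) : ℝ) ^ 2 * √(n : ℝ) = X at *
  have hF := filterConst_nonneg cfg cm L
  have hst : (0 : ℝ) ≤ cm.step := by positivity
  rw [Nat.cast_add, Nat.cast_mul]
  push_cast [-Nat.cast_sub]
  calc (cm.step : ℝ) + ((L - 3 : ℕ) : ℝ) * (cfg.lam * (filterCost cfg cm L n : ℝ) +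
        cfg.lam * cfg.lam * ((cfg.lam + 1) * cm.step))
      ≤ cm.step * X + L * (cfg.lam * (filterConst cfg cm L * X) +
        cfg.lam * cfg.lam * ((cfg.lam + 1) * (cm.step * X))) := by
        gcongr
        · exact le_mul_of_one_le_right hst hX
        · exact le_mul_of_one_le_right hst hX
    _ = _ := by ring

/-- A constant for the logarithm of the size of the trees in cleaning. -/
def cleanExpConst (cfg : Config) (L : ℕ) : ℕ := cfg.lam * (shareBound cfg L * 2 ^ L + 1) + 1

/-- A constant for the cost of cleaning and selection. -/
def cleanConst (cfg : Config) (cm : CostModel) (L : ℕ) : ℕ :=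
  2 * ((cleanExpConst cfg L + 3) * (cfg.lam * cm.step)) + (shareBound cfg L ^ 2 * cm.step +
    cfg.lam * (cm.step + (2 * shareBound cfg L + 1) *
      (2 ^ L * ((3 * (cleanExpConst cfg L + 3) + 1) * cm.step)))) + cfg.lam * cm.step

/-- There are at most `lam * n ^ 3` tracks with a bounded number of tuples each, so the exponent `e`
governing sorting and tree depth is a constant times `labelBits n + 1`. The `k + 1` instead of `k`
covers the fixed cost of setting up the trees. -/
lemma cost_cleaning_selection_le {L n : ℕ} (ev : EventRecord L n) {k : ℕ} (hn : 1 ≤ n)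
    (hk : k ≤ n ^ 3) {ts : List Candidate} (hlen : ts.length ≤ k * cfg.lam)
    (hts : ∀ t ∈ ts, t.hits.length ≤ L) :
    (improvedCleaning cfg cm L ts).cost +
      (trackSelection cfg cm ev (improvedCleaning cfg cm L ts).val).cost ≤
        cleanConst cfg cm L * ((labelBits n + 1) * (k + 1)) := by
  set e := Nat.clog 2 (cleanExpConst cfg L * n ^ 3) with he
  have he2 := clog_mul_cube_le (cleanExpConst cfg L) n
  rw [← he] at he2
  have hpow : ts.length * (shareBound cfg L * 2 ^ L + 1) + 1 ≤ 2 ^ e := by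
    refine le_trans ?_ (Nat.le_pow_clog (by norm_num) _)
    unfold cleanExpConst
    have h1 : 1 ≤ n ^ 3 := Nat.one_le_pow _ _ hn
    calc ts.length * (shareBound cfg L * 2 ^ L + 1) + 1
        ≤ (n ^ 3 * cfg.lam) * (shareBound cfg L * 2 ^ L + 1) + n ^ 3 := by
          gcongr; exact hlen.trans (Nat.mul_le_mul_right _ hk)
      _ = _ := by ring
  obtain ⟨h1, h2⟩ := improvedCleaning_spec cfg cm hts hpow
  rw [cost_trackSelection]
  unfold cleanStepCost at h1
  unfold cleanConst
  generalize cleanExpConst cfg L + 3 = K at *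
  generalize shareBound cfg L = R at *
  generalize (improvedCleaning cfg cm L ts).cost = c at *
  generalize (improvedCleaning cfg cm L ts).val.length = l at *
  generalize ts.length = m at *
  clear_value e
  have hu : 1 ≤ labelBits n + 1 := by omega
  generalize labelBits n + 1 = u at *
  have hm : m ≤ (k + 1) * cfg.lam := hlen.trans (Nat.mul_le_mul_right _ (by omega))
  have hk1 : 1 ≤ u * (k + 1) := Nat.one_le_iff_ne_zero.2 (by positivity)
  calc c + l * cm.step ≤ 2 * (e * (m * cm.step)) + (R ^ 2 * cm.step +
        m * (cm.step + (2 * R + 1) * (2 ^ L * ((3 * e + 1) * cm.step)))) + m * cm.step := by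
        gcongr
    _ ≤ 2 * ((K * u) * (((k + 1) * cfg.lam) * cm.step)) + (R ^ 2 * (cm.step * (u * (k + 1))) +
        ((k + 1) * cfg.lam) * (cm.step * u + (2 * R + 1) * (2 ^ L * ((3 * (K * u) + 1 * u) * cm.step)))) +
        ((k + 1) * cfg.lam) * (cm.step * u) := by
        gcongr
        · exact Nat.le_mul_of_pos_right _ hk1
        · exact Nat.le_mul_of_pos_right _ hu
        · exact Nat.le_mul_of_pos_right _ hu
        · exact Nat.le_mul_of_pos_right _ hu
    _ = _ := by ring

end TrackBounds

/-! ### The complete track finders -/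

section Complete
variable {L n : ℕ} (cfg : Config) (cm : CostModel) (ev : EventRecord L n)

/-- The tracks found by the classical version. -/
def classicalTracks : List Candidate :=
  (trackFinding cfg cm ev (seedGeneration cfg cm ev).val).val

/-- The cost of cleaning and selection. -/
def finishCost : ℕ :=
  (improvedCleaning cfg cm L (classicalTracks cfg cm ev)).cost +
    (trackSelection cfg cm ev (improvedCleaning cfg cm L (classicalTracks cfg cm ev)).val).cost

lemma cost_classicalCTF : (classicalCTF cfg cm ev).cost = n * (n * (n * cm.step)) +
    ((trackFinding cfg cm ev (seedGeneration cfg cm ev).val).cost + finishCost cfg cm ev) := by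
  rw [← cost_seedGeneration cfg cm ev]
  rfl

lemma finishCost_le (hL : 3 ≤ L) (hn : 1 ≤ n) : finishCost cfg cm ev ≤
    cleanConst cfg cm L * ((labelBits n + 1) * (kSeed cfg ev + 1)) := by
  refine cost_cleaning_selection_le cfg cm ev hn (kSeed_le cfg ev) ?_
    (length_hits_trackFinding cfg cm ev hL _)
  rw [← length_seedGeneration cfg cm ev]
  exact length_trackFinding_le cfg cm ev _

/-- The union bound over all calls of repeated minimum finding. -/
lemma trackFailure_le {k : ℕ} (hk : k ≤ n ^ 3) :
    (k : ℝ≥0∞) * ((L - 3 : ℕ) * (cfg.lam * (cfg.lam *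
      ENNReal.ofReal (1 / 2) ^ findRepetitions cfg L n))) ≤ ENNReal.ofReal (1 / 3) := by
  have h1 : 3 * L * cfg.lam ^ 2 * n ^ 3 ≤ 2 ^ findRepetitions cfg L n :=
    Nat.le_pow_clog (by norm_num) _
  have h2 : 3 * (k * ((L - 3) * (cfg.lam * cfg.lam))) ≤ 2 ^ findRepetitions cfg L n := by
    refine le_trans ?_ h1
    calc 3 * (k * ((L - 3) * (cfg.lam * cfg.lam))) ≤ 3 * (n ^ 3 * (L * (cfg.lam * cfg.lam))) := by
          gcongr; exact Nat.sub_le _ _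
      _ = _ := by ring
  generalize findRepetitions cfg L n = r at *
  have h3 : 3 * ((k : ℝ) * (((L - 3 : ℕ) : ℝ) * (cfg.lam * cfg.lam))) ≤ 2 ^ r := by
    exact_mod_cast h2
  have e : (k : ℝ≥0∞) * ((L - 3 : ℕ) * (cfg.lam * (cfg.lam * ENNReal.ofReal (1 / 2) ^ r))) =
      ENNReal.ofReal (k * (((L - 3 : ℕ) : ℝ) * (cfg.lam * (cfg.lam * (1 / 2) ^ r)))) := by
    rw [ENNReal.ofReal_mul (by positivity), ENNReal.ofReal_mul (by positivity),
      ENNReal.ofReal_mul (by positivity), ENNReal.ofReal_mul (by positivity),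
      ENNReal.ofReal_pow (by positivity)]
    simp only [ENNReal.ofReal_natCast]
  rw [e]
  apply ENNReal.ofReal_le_ofReal
  rw [one_div_pow]
  have h4 : (0 : ℝ) < 2 ^ r := by positivity
  calc (k : ℝ) * (((L - 3 : ℕ) : ℝ) * (cfg.lam * (cfg.lam * (1 / 2 ^ r))))
      = ((k : ℝ) * (((L - 3 : ℕ) : ℝ) * (cfg.lam * cfg.lam))) / 2 ^ r := by ring
    _ ≤ 1 / 3 := by rw [div_le_div_iff₀ h4 (by norm_num)]; linarith

/-- Quantum track finding, cleaning and selection. -/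
def quantumFinish (seeds : List Seed) : Timed (List Candidate) := do
  let tracks ← quantumTrackFinding cfg cm ev seeds
  let cleaned ← Timed.ofCounted (improvedCleaning cfg cm L tracks)
  Timed.ofCounted (trackSelection cfg cm ev cleaned)

lemma spec_quantumFinish (hn : 136 ^ 4 ≤ n) :
    Timed.Spec (quantumFinish cfg cm ev (seedGeneration cfg cm ev).val)
      (kSeed cfg ev * seedTrackCost cfg cm L n + finishCost cfg cm ev) (ENNReal.ofReal (1 / 3))
      fun r => r = (classicalCTF cfg cm ev).val := by
  have h1 := spec_quantumTrackFinding cfg cm ev hn (seedGeneration cfg cm ev).val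
  rw [length_seedGeneration] at h1
  have h2 := h1.mono le_rfl (trackFailure_le cfg (kSeed_le cfg ev)) fun _ h => h
  have h3 := h2.bind (f := fun tracks => (do
      let cleaned ← Timed.ofCounted (improvedCleaning cfg cm L tracks)
      Timed.ofCounted (trackSelection cfg cm ev cleaned))) (T₂ := finishCost cfg cm ev) (ε₂ := 0)
      (Q₂ := fun r => r = (classicalCTF cfg cm ev).val) (by
    rintro _ rfl
    refine (Timed.spec_ofCounted _).bind_zero_left ?_
    rintro _ rfl
    exact Timed.spec_ofCounted _)
  rw [add_zero] at h3
  exact h3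

/-- The three sources of failure are counting, collecting and track finding: `1 / 20 + 1 / 20 + 1 /
3 = 13 / 30`. -/
lemma spec_quantumCTF (hn : 136 ^ 4 ≤ n) :
    Timed.Spec (quantumCTF cfg cm ev) (seedCost cm n (kSeed cfg ev) +
      (kSeed cfg ev * seedTrackCost cfg cm L n + finishCost cfg cm ev)) (1 / 2)
      fun r => r = (classicalCTF cfg cm ev).val := by
  have h := (spec_quantumSeedGeneration cfg cm ev).bind (f := quantumFinish cfg cm ev)
    (fun s hs => by rw [hs]; exact spec_quantumFinish cfg cm ev hn)
  refine h.mono le_rfl ?_ fun _ h => h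
  rw [← ENNReal.ofReal_add (by norm_num) (by norm_num), ← ENNReal.ofReal_add (by norm_num) (by norm_num)]
  have e : (1 / 2 : ℝ≥0∞) = ENNReal.ofReal (1 / 2) := by
    rw [ENNReal.ofReal_div_of_pos (by norm_num)]; simp
  rw [e]
  exact ENNReal.ofReal_le_ofReal (by norm_num)

lemma spec_semiQuantumCTF (hn : 136 ^ 4 ≤ n) :
    Timed.Spec (semiQuantumCTF cfg cm ev) (n * (n * (n * cm.step)) +
      (kSeed cfg ev * seedTrackCost cfg cm L n + finishCost cfg cm ev)) (1 / 2)
      fun r => r = (classicalCTF cfg cm ev).val := by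
  have h := (Timed.spec_ofCounted (seedGeneration cfg cm ev)).bind_zero_left
    (f := quantumFinish cfg cm ev) (fun s hs => by rw [hs]; exact spec_quantumFinish cfg cm ev hn)
  rw [cost_seedGeneration] at h
  refine h.mono le_rfl ?_ fun _ h => h
  have e : (1 / 2 : ℝ≥0∞) = ENNReal.ofReal (1 / 2) := by
    rw [ENNReal.ofReal_div_of_pos (by norm_num)]; simp
  rw [e]
  exact ENNReal.ofReal_le_ofReal (by norm_num)

lemma half_le_probWithin {x : Timed (List Candidate)} {T T' : ℕ} {a : List Candidate}
    (h : Timed.Spec x T (1 / 2) fun r => r = a) (hT : T ≤ T') : 1 / 2 ≤ x.probWithin T' a := by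
  have h1 := h.le_probWithin hT
  rwa [show (1 : ℝ≥0∞) - 1 / 2 = 1 / 2 by rw [one_div]; exact ENNReal.one_sub_inv_two] at h1

/-- A constant for the cost of following a seed classically. -/
def classicalTrackConst (cfg : Config) (cm : CostModel) (L : ℕ) : ℕ :=
  cm.step + L * (cfg.lam * (4 * cm.step) + cfg.lam * 2 * ((cfg.lam + 1) * cm.step))

lemma classicalSeedTrackCost_le (hn : 1 ≤ n) :
    classicalSeedTrackCost cfg cm L n ≤ classicalTrackConst cfg cm L * n := by
  unfold classicalSeedTrackCost classicalTrackConst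
  calc _ ≤ cm.step * n + L * (cfg.lam * ((4 * n) * cm.step) +
        cfg.lam * (2 * n) * ((cfg.lam + 1) * cm.step)) := by
        gcongr
        · exact Nat.le_mul_of_pos_right _ hn
        · exact Nat.sub_le _ _
        · omega
        · omega
    _ = _ := by ring

/-- A constant for the running times of all versions. -/
def ctfConst (cfg : Config) (cm : CostModel) (L : ℕ) : ℝ :=
  seedConst cm + seedTrackConst cfg cm L + 2 * cleanConst cfg cm L + cm.step +
    classicalTrackConst cfg cm L

lemma seedConst_nonneg : 0 ≤ seedConst cm := by unfold seedConst; positivity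

lemma seedTrackConst_nonneg (L : ℕ) : 0 ≤ seedTrackConst cfg cm L := by
  have := filterConst_nonneg cfg cm L
  unfold seedTrackConst; positivity

lemma ctfConst_pos : 0 < ctfConst cfg cm L := by
  have h1 := seedConst_nonneg cm
  have h2 := seedTrackConst_nonneg cfg cm L
  have h3 : (0 : ℝ) < cm.step := by exact_mod_cast cm.step_pos
  unfold ctfConst
  positivity

/-- The cost after seed generation. -/
lemma finish_bound (hL : 3 ≤ L) (hn : 1 ≤ n) {U A : ℝ} (hU : U = ((labelBits n + 1 : ℕ) : ℝ))
    (hA : (kSeed cfg ev : ℝ) + 1 ≤ 2 * A) :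
    ((kSeed cfg ev * seedTrackCost cfg cm L n + finishCost cfg cm ev : ℕ) : ℝ) ≤
      (seedTrackConst cfg cm L + 2 * cleanConst cfg cm L) *
        (U ^ 2 * (A + √(n : ℝ) * kSeed cfg ev)) := by
  have h1 := seedTrackCost_le cfg cm L hn
  have h2 : (finishCost cfg cm ev : ℝ) ≤ cleanConst cfg cm L *
      (((labelBits n + 1 : ℕ) : ℝ) * (kSeed cfg ev + 1)) := by
    exact_mod_cast finishCost_le cfg cm ev hL hn
  rw [← hU] at h1 h2
  have hU1 : 1 ≤ U := by rw [hU]; exact_mod_cast Nat.le_add_left 1 _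
  have hUU : U ≤ U ^ 2 := by nlinarith
  have hT := seedTrackConst_nonneg cfg cm L
  have hk0 : (0 : ℝ) ≤ kSeed cfg ev := by positivity
  have hA0 : 0 ≤ A := by linarith
  rw [Nat.cast_add, Nat.cast_mul]
  generalize (kSeed cfg ev : ℝ) = k at *
  have hs0 := Real.sqrt_nonneg (n : ℝ)
  generalize √(n : ℝ) = s at *
  have h3 : k * (seedTrackCost cfg cm L n : ℝ) ≤ seedTrackConst cfg cm L * (U ^ 2 * (s * k)) := by
    calc k * (seedTrackCost cfg cm L n : ℝ) ≤ k * (seedTrackConst cfg cm L * (U ^ 2 * s)) := by gcongr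
      _ = _ := by ring
  have h4 : (finishCost cfg cm ev : ℝ) ≤ 2 * cleanConst cfg cm L * (U ^ 2 * A) := by
    calc (finishCost cfg cm ev : ℝ) ≤ cleanConst cfg cm L * (U * (k + 1)) := h2
      _ ≤ cleanConst cfg cm L * (U ^ 2 * (2 * A)) := by gcongr
      _ = _ := by ring
  have h5 : 0 ≤ seedTrackConst cfg cm L * (U ^ 2 * A) := by positivity
  have h6 : 0 ≤ 2 * (cleanConst cfg cm L : ℝ) * (U ^ 2 * (s * k)) := by positivity
  linarith

lemma quantumTime_le (hL : 3 ≤ L) (hn : 1 ≤ n) :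
    ((seedCost cm n (kSeed cfg ev) + (kSeed cfg ev * seedTrackCost cfg cm L n +
      finishCost cfg cm ev) : ℕ) : ℝ) ≤ ctfConst cfg cm L * (((labelBits n + 1 : ℕ) : ℝ) ^ 2 *
        (√((n : ℝ) ^ 3 * max (kSeed cfg ev : ℝ) 1) + √(n : ℝ) * kSeed cfg ev)) := by
  have hk := kSeed_le cfg ev
  have h1 := seedCost_le cm hn hk
  have hS := one_le_seedRoot (k := kSeed cfg ev) hn
  have hkS := le_seedRoot hk
  have h2 := finish_bound cfg cm ev hL hn rfl
    (A := √((n : ℝ) ^ 3 * max (kSeed cfg ev : ℝ) 1)) (by linarith)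
  rw [Nat.cast_add]
  generalize ((kSeed cfg ev * seedTrackCost cfg cm L n + finishCost cfg cm ev : ℕ) : ℝ) = F at *
  generalize √((n : ℝ) ^ 3 * max (kSeed cfg ev : ℝ) 1) = S at *
  have h3 : 0 ≤ √(n : ℝ) * kSeed cfg ev := by positivity
  generalize √(n : ℝ) * kSeed cfg ev = W at *
  have hV : 0 ≤ ((labelBits n + 1 : ℕ) : ℝ) ^ 2 := by positivity
  generalize ((labelBits n + 1 : ℕ) : ℝ) ^ 2 = V at *
  have h4 := seedConst_nonneg cm
  unfold ctfConst
  have e1 : 0 ≤ seedConst cm * (V * W) := by positivity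
  have e2 : 0 ≤ ((cm.step : ℝ) + classicalTrackConst cfg cm L) * (V * (S + W)) := by positivity
  linarith

lemma semiQuantumTime_le (hL : 3 ≤ L) (hn : 1 ≤ n) :
    ((n * (n * (n * cm.step)) + (kSeed cfg ev * seedTrackCost cfg cm L n +
      finishCost cfg cm ev) : ℕ) : ℝ) ≤ ctfConst cfg cm L * (((labelBits n + 1 : ℕ) : ℝ) ^ 2 *
        ((n : ℝ) ^ 3 + √(n : ℝ) * kSeed cfg ev)) := by
  have hk : (kSeed cfg ev : ℝ) ≤ (n : ℝ) ^ 3 := by exact_mod_cast kSeed_le cfg ev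
  have hn1 : (1 : ℝ) ≤ n := by exact_mod_cast hn
  have hn3 : (1 : ℝ) ≤ (n : ℝ) ^ 3 := one_le_pow₀ hn1
  have h2 := finish_bound cfg cm ev hL hn rfl (A := (n : ℝ) ^ 3) (by linarith)
  have hU : (1 : ℝ) ≤ ((labelBits n + 1 : ℕ) : ℝ) := by exact_mod_cast Nat.le_add_left 1 _
  have hV : (1 : ℝ) ≤ ((labelBits n + 1 : ℕ) : ℝ) ^ 2 := one_le_pow₀ hU
  have h1 : ((n * (n * (n * cm.step)) : ℕ) : ℝ) = cm.step * (n : ℝ) ^ 3 := by push_cast; ring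
  rw [Nat.cast_add, h1]
  generalize ((kSeed cfg ev * seedTrackCost cfg cm L n + finishCost cfg cm ev : ℕ) : ℝ) = F at *
  have h3 : 0 ≤ √(n : ℝ) * kSeed cfg ev := by positivity
  generalize √(n : ℝ) * kSeed cfg ev = W at *
  generalize (n : ℝ) ^ 3 = S at *
  generalize ((labelBits n + 1 : ℕ) : ℝ) ^ 2 = V at *
  have h4 := seedConst_nonneg cm
  unfold ctfConst
  have e1 : (cm.step : ℝ) * S ≤ cm.step * (V * (S + W)) := by
    gcongr
    nlinarith
  have e2 : 0 ≤ (seedConst cm + classicalTrackConst cfg cm L) * (V * (S + W)) := by positivity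
  linarith

lemma classicalTime_le (hL : 3 ≤ L) (hn : 1 ≤ n) : ((classicalCTF cfg cm ev).cost : ℝ) ≤
    ctfConst cfg cm L * ((n : ℝ) ^ 3 + n * kSeed cfg ev) := by
  have h1 := cost_trackFinding_le cfg cm ev (seedGeneration cfg cm ev).val
  rw [length_seedGeneration] at h1
  have h2 := finishCost_le cfg cm ev hL hn
  have h3 := classicalSeedTrackCost_le (L := L) cfg cm hn
  -- The logarithm of cleaning is absorbed by a factor `n`, so the classical bound needs no
  -- polylogarithmic factor.
  have hu : labelBits n + 1 ≤ n := by
    have : n ≤ 2 ^ (n - 1) := by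
      have := (Nat.lt_two_pow_self : n - 1 < 2 ^ (n - 1))
      omega
    have := Nat.clog_le_of_le_pow this
    unfold labelBits
    omega
  have h4 : (classicalCTF cfg cm ev).cost ≤ n * (n * (n * cm.step)) +
      (kSeed cfg ev * (classicalTrackConst cfg cm L * n) +
        cleanConst cfg cm L * (n * (kSeed cfg ev + 1))) := by
    rw [cost_classicalCTF]
    gcongr
    · exact h1.trans (Nat.mul_le_mul_left _ h3)
    · exact h2.trans (by gcongr)
  have h5 : ((classicalCTF cfg cm ev).cost : ℝ) ≤ n * (n * (n * cm.step)) +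
      (kSeed cfg ev * (classicalTrackConst cfg cm L * n) +
        cleanConst cfg cm L * (n * (kSeed cfg ev + 1))) := by exact_mod_cast h4
  refine h5.trans ?_
  have hn1 : (1 : ℝ) ≤ n := by exact_mod_cast hn
  have hn3 : (n : ℝ) ≤ (n : ℝ) ^ 3 := le_self_pow₀ hn1 (by norm_num)
  have hk0 : (0 : ℝ) ≤ kSeed cfg ev := by positivity
  have hs := seedConst_nonneg cm
  have ht := seedTrackConst_nonneg cfg cm L
  unfold ctfConst
  have hX : 0 ≤ (n : ℝ) * kSeed cfg ev := by positivity
  have hY : (n : ℝ) * (kSeed cfg ev + 1) ≤ (n : ℝ) ^ 3 + n * kSeed cfg ev := by linarith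
  have hZ : 0 ≤ (n : ℝ) ^ 3 := by positivity
  calc (n : ℝ) * (n * (n * cm.step)) + (kSeed cfg ev * (classicalTrackConst cfg cm L * n) +
        cleanConst cfg cm L * (n * (kSeed cfg ev + 1)))
      = cm.step * (n : ℝ) ^ 3 + (classicalTrackConst cfg cm L * (n * kSeed cfg ev) +
        cleanConst cfg cm L * (n * (kSeed cfg ev + 1))) := by ring
    _ ≤ cm.step * ((n : ℝ) ^ 3 + n * kSeed cfg ev) +
        (classicalTrackConst cfg cm L * ((n : ℝ) ^ 3 + n * kSeed cfg ev) +
        cleanConst cfg cm L * ((n : ℝ) ^ 3 + n * kSeed cfg ev)) := by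
        gcongr <;> linarith
    _ ≤ _ := by
        have : 0 ≤ (seedConst cm + seedTrackConst cfg cm L + cleanConst cfg cm L) *
          ((n : ℝ) ^ 3 + n * kSeed cfg ev) := by positivity
        linarith

lemma le_classicalTime (hL : 4 ≤ L) :
    (n : ℝ) ^ 3 + n * kSeed cfg ev ≤ ((classicalCTF cfg cm ev).cost : ℝ) := by
  have h1 := le_cost_trackFinding cfg cm ev hL (seedGeneration cfg cm ev).val
  rw [length_seedGeneration] at h1
  have h2 : n ^ 3 + n * kSeed cfg ev ≤ (classicalCTF cfg cm ev).cost := by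
    rw [cost_classicalCTF]
    have hs := cm.step_pos
    calc n ^ 3 + n * kSeed cfg ev = n * (n * (n * 1)) + kSeed cfg ev * (n * 1) := by ring
      _ ≤ n * (n * (n * cm.step)) + kSeed cfg ev * (n * cm.step) := by gcongr <;> omega
      _ ≤ _ := by omega
  exact_mod_cast h2

/-- After squaring, `n ^ 4 * max k 1` is compared with `(n ^ 3 + n k) ^ 2`: the first square covers
the case of few seeds and the mixed term `2 n ^ 4 k` the case of many. The second summand of the
bound becomes `n k` exactly. -/
lemma bound_mul_sqrt_le {k : ℕ} (hn : 1 ≤ n) :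
    (√((n : ℝ) ^ 3 * max (k : ℝ) 1) + √(n : ℝ) * k) * √(n : ℝ) ≤ 2 * ((n : ℝ) ^ 3 + n * k) := by
  have hn1 : (1 : ℝ) ≤ n := by exact_mod_cast hn
  have hk0 : (0 : ℝ) ≤ k := by positivity
  have h1 : √((n : ℝ) ^ 3 * max (k : ℝ) 1) * √(n : ℝ) ≤ (n : ℝ) ^ 3 + n * k := by
    rw [← Real.sqrt_mul (by positivity), Real.sqrt_le_left (by positivity)]
    have h2 : max (k : ℝ) 1 ≤ n ^ 2 + 2 * k := by
      have : (1 : ℝ) ≤ (n : ℝ) ^ 2 := one_le_pow₀ hn1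
      exact max_le (by linarith) (by linarith)
    calc (n : ℝ) ^ 3 * max (k : ℝ) 1 * n ≤ (n : ℝ) ^ 3 * (n ^ 2 + 2 * k) * n := by gcongr
      _ ≤ ((n : ℝ) ^ 3 + n * k) ^ 2 := by
        have : 0 ≤ ((n : ℝ) * k) ^ 2 := by positivity
        have : (n : ℝ) ^ 3 * (n ^ 2 + 2 * k) * n = (n : ℝ) ^ 6 + 2 * ((n : ℝ) ^ 4 * k) := by ring
        nlinarith
  have h3 : √(n : ℝ) * k * √(n : ℝ) = n * k := by
    rw [mul_right_comm, Real.mul_self_sqrt (by positivity)]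
  have h4 : 0 ≤ (n : ℝ) ^ 3 := by positivity
  rw [add_mul, h3]
  linarith

lemma rpow_seven_half (n : ℕ) : (n : ℝ) ^ (7 / 2 : ℝ) = (n : ℝ) ^ 3 * √(n : ℝ) := by
  rw [Real.sqrt_eq_rpow, ← Real.rpow_natCast, ← Real.rpow_add_of_nonneg (by positivity)
    (by norm_num) (by norm_num)]
  norm_num

end Complete

end CTF

end

/-! ### Assembly of the main theorem -/

theorem mainTheorem2 {L : ℕ} (hL : 3 ≤ L) (cfg : CTF.Config) (cm : CTF.CostModel) :
    ∃ (C D c : ℝ) (a n₀ : ℕ), 0 < C ∧ 0 < D ∧ 0 < c ∧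
      ∀ n : ℕ, n₀ ≤ n → ∀ ev : CTF.EventRecord L n,
        let k : ℕ := CTF.kSeed cfg ev
        let out : List CTF.Candidate := (CTF.classicalCTF cfg cm ev).val
        let classicalTime : ℝ := (CTF.classicalCTF cfg cm ev).cost
        let polylog : ℝ := Real.log n ^ a
        let bound : ℝ := √((n : ℝ) ^ 3 * max (k : ℝ) 1) + √(n : ℝ) * k
        -- quantum seeding and quantum track finding reproduce the classical output in time `bound`
        (1 / 2 ≤ (CTF.quantumCTF cfg cm ev).probWithin ⌊C * polylog * bound⌋₊ out) ∧
        -- worst case over the number of seeds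
        (1 / 2 ≤ (CTF.quantumCTF cfg cm ev).probWithin
          ⌊C * polylog * (n : ℝ) ^ (7 / 2 : ℝ)⌋₊ out) ∧
        -- classical seeding and quantum track finding
        (1 / 2 ≤ (CTF.semiQuantumCTF cfg cm ev).probWithin
          ⌊C * polylog * ((n : ℝ) ^ 3 + √(n : ℝ) * k)⌋₊ out) ∧
        (1 / 2 ≤ (CTF.semiQuantumCTF cfg cm ev).probWithin
          ⌊C * polylog * (n : ℝ) ^ (7 / 2 : ℝ)⌋₊ out) ∧
        -- the running time of the classical version
        classicalTime ≤ C * ((n : ℝ) ^ 3 + n * k) ∧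
        classicalTime ≤ C * (n : ℝ) ^ 4 ∧
        -- if there is at least one layer beyond the seeding layers, this is tight, and the quantum
        -- running time is smaller by a factor `√n` up to logarithms, for every event
        (4 ≤ L → c * ((n : ℝ) ^ 3 + n * k) ≤ classicalTime ∧
          C * polylog * bound ≤ D * polylog / √(n : ℝ) * classicalTime) := by
  have hK := CTF.ctfConst_pos (L := L) cfg cm
  -- The exponent `2` stems from the square of `labelBits n + 1 ≤ 4 log n`, which also yields `16`.
  -- A further factor `2` is spent on the worst-case bounds, where two summands are each at most `n
  -- ^ (7 / 2)`. The constant `64` doubles `32` by `bound_mul_sqrt_le`, and `136 ^ 4` is the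
  -- threshold of minimum finding.
  refine ⟨32 * CTF.ctfConst cfg cm L, 64 * CTF.ctfConst cfg cm L, 1, 2, 136 ^ 4, by positivity,
    by positivity, one_pos, ?_⟩
  intro n hn ev k out classicalTime polylog bound
  have hn1 : 1 ≤ n := le_trans (by norm_num) hn
  have hn3 : 3 ≤ n := le_trans (by norm_num) hn
  have hnR : (1 : ℝ) ≤ n := by exact_mod_cast hn1
  have hq := CTF.quantumTime_le cfg cm ev hL hn1
  have hs := CTF.semiQuantumTime_le cfg cm ev hL hn1
  have hc := CTF.classicalTime_le cfg cm ev hL hn1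
  have hsq : 1 ≤ √(n : ℝ) := Real.one_le_sqrt.mpr hnR
  have hk3 : (k : ℝ) ≤ (n : ℝ) ^ 3 := by exact_mod_cast CTF.kSeed_le cfg ev
  have hlog : ((CTF.labelBits n + 1 : ℕ) : ℝ) ^ 2 ≤ 16 * polylog := by
    calc ((CTF.labelBits n + 1 : ℕ) : ℝ) ^ 2 ≤ (4 * Real.log n) ^ 2 := by
          gcongr; exact CTF.labelBits_succ_le hn3
      _ = 16 * polylog := by simp only [polylog]; ring
  have hpoly : 0 ≤ polylog := by positivity
  have htime : ∀ {T : ℕ} {X Y : ℝ}, 0 ≤ X → X ≤ 2 * Y →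
      (T : ℝ) ≤ CTF.ctfConst cfg cm L * (((CTF.labelBits n + 1 : ℕ) : ℝ) ^ 2 * X) →
      T ≤ ⌊32 * CTF.ctfConst cfg cm L * polylog * Y⌋₊ := by
    intro T X Y hX hXY hT
    apply Nat.le_floor
    calc (T : ℝ) ≤ CTF.ctfConst cfg cm L * (((CTF.labelBits n + 1 : ℕ) : ℝ) ^ 2 * X) := hT
      _ ≤ CTF.ctfConst cfg cm L * (16 * polylog * (2 * Y)) := by gcongr
      _ = _ := by ring
  have hbound0 : 0 ≤ bound := by positivity
  have hsemi0 : 0 ≤ (n : ℝ) ^ 3 + √(n : ℝ) * k := by positivity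
  have hpow := CTF.rpow_seven_half n
  have hsk : √(n : ℝ) * k ≤ (n : ℝ) ^ 3 * √(n : ℝ) := by
    rw [mul_comm]; gcongr
  have hcube : (n : ℝ) ^ 3 ≤ (n : ℝ) ^ 3 * √(n : ℝ) := le_mul_of_one_le_right (by positivity) hsq
  have hroot : √((n : ℝ) ^ 3 * max (k : ℝ) 1) ≤ (n : ℝ) ^ 3 := by
    rw [Real.sqrt_le_left (by positivity), sq]
    gcongr
    exact max_le hk3 (one_le_pow₀ hnR)
  have hbound7 : bound ≤ 2 * (n : ℝ) ^ (7 / 2 : ℝ) := by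
    rw [hpow]; simp only [bound]; linarith
  have hsemi7 : (n : ℝ) ^ 3 + √(n : ℝ) * k ≤ 2 * (n : ℝ) ^ (7 / 2 : ℝ) := by
    rw [hpow]; linarith
  have hQ := CTF.spec_quantumCTF cfg cm ev hn
  have hS := CTF.spec_semiQuantumCTF cfg cm ev hn
  have hX0 : 0 ≤ (n : ℝ) ^ 3 + n * k := by positivity
  refine ⟨CTF.half_le_probWithin hQ (htime hbound0 (by linarith) hq),
    CTF.half_le_probWithin hQ (htime hbound0 hbound7 hq),
    CTF.half_le_probWithin hS (htime hsemi0 (by linarith) hs),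
    CTF.half_le_probWithin hS (htime hsemi0 hsemi7 hs), ?_, ?_, ?_⟩
  · calc classicalTime ≤ CTF.ctfConst cfg cm L * ((n : ℝ) ^ 3 + n * k) := hc
      _ ≤ 32 * CTF.ctfConst cfg cm L * ((n : ℝ) ^ 3 + n * k) := by gcongr; linarith
  · have h4 : (n : ℝ) ^ 3 + n * k ≤ 2 * (n : ℝ) ^ 4 := by
      have h5 : (n : ℝ) ^ 3 ≤ n ^ 4 := pow_le_pow_right₀ hnR (by norm_num)
      have h6 : (n : ℝ) * k ≤ n * n ^ 3 := by gcongr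
      have h7 : (n : ℝ) * n ^ 3 = n ^ 4 := by ring
      linarith
    calc classicalTime ≤ CTF.ctfConst cfg cm L * ((n : ℝ) ^ 3 + n * k) := hc
      _ ≤ CTF.ctfConst cfg cm L * (2 * (n : ℝ) ^ 4) := by gcongr
      _ = 2 * CTF.ctfConst cfg cm L * (n : ℝ) ^ 4 := by ring
      _ ≤ 32 * CTF.ctfConst cfg cm L * (n : ℝ) ^ 4 := by gcongr; norm_num
  · intro hL4
    have hlow := CTF.le_classicalTime cfg cm ev hL4
    refine ⟨by rw [one_mul]; exact hlow, ?_⟩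
    have h1 : bound * √(n : ℝ) ≤ 2 * classicalTime :=
      (CTF.bound_mul_sqrt_le hn1).trans (by gcongr)
    rw [div_mul_eq_mul_div, le_div_iff₀ (by linarith)]
    calc 32 * CTF.ctfConst cfg cm L * polylog * bound * √(n : ℝ)
        = 32 * CTF.ctfConst cfg cm L * polylog * (bound * √(n : ℝ)) := by ring
      _ ≤ 32 * CTF.ctfConst cfg cm L * polylog * (2 * classicalTime) := by gcongr
      _ = 64 * CTF.ctfConst cfg cm L * polylog * classicalTime := by ring
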